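/- For each $n$ consider the linear model $\mathbf y=X\beta^0+\epsilon$ with an $n\times p$ design matrix $X$, $p=p_n$, and $\epsilon\sim N(0,\sigma_0^2I_n)$, $\sigma_0>0$ fixed, where $X$ is deterministic, or random and independent of $\epsilon$. A model is a subset $\gamma\subseteq\{1,\dots,p\}$; the true model is $\gamma^0=\{j:\beta^0_j\neq0\}$. Write $Z=(\mathbf y,X)$ and let $p(\gamma\mid Z)$ be the posterior probability of $\gamma$ under the hierarchical prior $$\mathbf y\mid\beta,\sigma^2\sim N(X\beta,\sigma^2I_n),\quad \beta_j\mid\gamma,\sigma^2,c\ \stackrel{\text{ind.}}{\sim}\ \begin{cases}N(0,c\sigma^2),& j\in\gamma,\\ \delta_0,& j\notin\gamma,\end{cases}\quad 1/\sigma^2\sim\chi^2_\nu,\quad c\sim g,\quad \gamma\sim p(\gamma),$$ where $\nu>0$ and the probability distribution $g$ on $[0,\infty)$ do not depend on $n$, and $p(\cdot)$ is a probability distribution on the set of models (which may depend on $n$); $p(\gamma\mid Z)$ is obtained by integrating out $\beta,\sigma^2$ and $c$. Suppose that, for all large $n$ and constants $C_0,\bar c>0$ not depending on $n$: $\gamma^0\ne\emptyset$;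 $\max_\gamma p(\gamma)/p(\gamma^0)\le C_0$; almost surely all eigenvalues of $\frac1nX^TX$ lie in $[1/\bar c,\bar c]$; and $\min_{j\in\gamma^0}|\beta^0_j|\ge\psi_n$ for a positive sequence $\psi_n\asymp n^{-1/4}\sqrt{\log n}$. Suppose also $\|\beta^0\|_2=O(1)$ and $|\gamma^0|=O(1)$ as $n\to\infty$. Here $a_n\asymp b_n$ means that $|a_n|/|b_n|$ is eventually bounded above and away from zero. (i) If the support of $g$ is contained in $[\underline\phi,\bar\phi]$ with $0<\underline\phi\le\bar\phi<\infty$, and $p\asymp n^r$ for some $0<r<1/2$, then $\max_{\gamma\ne\gamma^0}p(\gamma\mid Z)/p(\gamma^0\mid Z)\to0$ in probability. (ii) If $g$ is any probability distribution on $[0,\infty)$ other than the point mass at $0$ (for instance, any distribution with a density), and $p\asymp n^r$ for some $0<r<1/4$, then $p(\gamma^0\mid Z)\to1$ in probability. -/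

import Mathlib

open MeasureTheory ProbabilityTheory Filter Topology Asymptotics
open scoped NNReal ENNReal

noncomputable section

namespace BayesVarSel

/-- The model (state vector) of a coefficient vector: the set of indices of its nonzero entries.
A state vector in `{0,1}^p` is identified with the set of indices where it equals `1`. -/
def trueModel {p : ℕ} (β : Fin p → ℝ) : Finset (Fin p) :=
  Finset.univ.filter fun j => β j ≠ 0

/-- The prior law of `β ∈ ℝ^p` given the model `γ`, with slab variance `v`: independent
coordinates, `β_j ∼ N(0, v)` for `j ∈ γ` and `β_j = 0` for `j ∉ γ`. -/
def coefPrior {p : ℕ} (γ : Finset (Fin p)) (v : ℝ≥0) : Measure (Fin p → ℝ) :=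
  Measure.pi fun j => if j ∈ γ then gaussianReal 0 v else Measure.dirac 0

/-- The density at `y` of the law `N(X β, v I_n)`. -/
def likelihood {n p : ℕ} (X : Matrix (Fin n) (Fin p) ℝ) (y : Fin n → ℝ) (β : Fin p → ℝ)
    (v : ℝ≥0) : ℝ≥0∞ :=
  ∏ i, gaussianPDF (X.mulVec β i) v (y i)

/-- The chi-square distribution with `ν` degrees of freedom, `Gamma(ν/2, 1/2)`. -/
def chiSquareMeasure (ν : ℝ) : Measure ℝ := gammaMeasure (ν / 2) (1 / 2)

/-- The marginal likelihood of the model `γ` for the data `(y, X)`: the likelihood integrated over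
`c ∼ g`, then `τ = 1/σ² ∼ χ²_ν`, then `β | γ, σ², c`, whose nonzero coordinates are
`N(0, c σ²)`. -/
def marginalLikelihood {n p : ℕ} (ν : ℝ) (g : Measure ℝ≥0) (X : Matrix (Fin n) (Fin p) ℝ)
    (y : Fin n → ℝ) (γ : Finset (Fin p)) : ℝ≥0∞ :=
  ∫⁻ c, ∫⁻ τ, ∫⁻ β, likelihood X y β (τ.toNNReal)⁻¹
    ∂(coefPrior γ (c * (τ.toNNReal)⁻¹)) ∂(chiSquareMeasure ν) ∂g

/-- The posterior probability `p(γ | Z)` of the model `γ` given the data `Z = (y, X)`, by Bayes'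
formula, for the prior `π` on models. -/
def posterior {n p : ℕ} (ν : ℝ) (g : Measure ℝ≥0) (π : PMF (Finset (Fin p)))
    (X : Matrix (Fin n) (Fin p) ℝ) (y : Fin n → ℝ) (γ : Finset (Fin p)) : ℝ :=
  (π γ * marginalLikelihood ν g X y γ /
    ∑ γ' : Finset (Fin p), π γ' * marginalLikelihood ν g X y γ').toReal

/-- The largest posterior odds ratio `max_{γ ≠ γ₀} p(γ | Z) / p(γ₀ | Z)`. -/
def maxPosteriorOdds {n p : ℕ} (ν : ℝ) (g : Measure ℝ≥0) (π : PMF (Finset (Fin p)))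
    (X : Matrix (Fin n) (Fin p) ℝ) (y : Fin n → ℝ) (γ₀ : Finset (Fin p)) : ℝ :=
  ⨆ γ : {γ : Finset (Fin p) // γ ≠ γ₀},
    posterior ν g π X y (γ : Finset (Fin p)) / posterior ν g π X y γ₀

/-- All eigenvalues of `Xᵀ X / n` lie in `[1/b, b]`. -/
def WellConditioned {n p : ℕ} (b : ℝ) (X : Matrix (Fin n) (Fin p) ℝ) : Prop :=
  spectrum ℝ ((n : ℝ)⁻¹ • (X.transpose * X)) ⊆ Set.Icc (1 / b) b

end BayesVarSel

end

/-!
Given `c` and the precision `τ`, the marginal likelihood of a model `γ` is a Gaussian integral over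
the coefficients, of order an Occam factor times `exp (-τ T / 2)`, where `T` is the ridge criterion;
mixing over `τ` turns the exponential into the Student kernel `(1 + T) ^ (-(n + ν) / 2)`.

A model missing a true variable pays `T ≥ ‖P e‖² + C n ψ_n²`, with `P` a residual projection and
`n ψ_n²` of order `√n log n`. This beats the number `2 ^ p` of models and the at most `exp (C p)`
gained by fitting noise, since `p = o(√n)`.

A model with `m` spurious variables gains only by fitting noise. For a fixed `γ`, the exponential of
this gain is dominated by a Gaussian mixture `fitStat` of exponentials of linear functions of the
noise, whose mean is at most `R ^ |γ|`. One application of Markov's inequality to the sum of these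
statistics with weights `n ^ (-r m) m!` controls all such models at once: their number is
`C(p, m)`, and the sum is small as soon as `p = o(n ^ r)`. The Occam factor `n ^ (-ρ m)` with
`ρ > r` then wins. It has exponent `ρ = 1/2` when `c` is bounded below. If `c` may approach zero, a
small `c` shrinks the nonzero true coefficients at a cost `‖β⁰‖² / c`; the `c` for which this cost
is affordable are of order at least `n ^ (-1/2) / m`, which leaves `ρ = 1/4`.
-/

namespace BayesVarSel

section ProductMeasures

theorem lintegral_pi_fin_prod {n : ℕ} {α : Fin n → Type*} [∀ i, MeasurableSpace (α i)]
    (μ : ∀ i, Measure (α i)) [∀ i, SigmaFinite (μ i)] {f : ∀ i, α i → ℝ≥0∞}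
    (hf : ∀ i, Measurable (f i)) :
    ∫⁻ x, ∏ i, f i (x i) ∂Measure.pi μ = ∏ i, ∫⁻ x, f i x ∂μ i := by
  induction n with
  | zero => simp
  | succ n ih =>
    calc ∫⁻ x, ∏ i, f i (x i) ∂Measure.pi μ
        = ∫⁻ x : α 0 × ∀ i : Fin n, α i.succ, f 0 x.1 * ∏ i : Fin n, f i.succ (x.2 i)
            ∂(μ 0).prod (Measure.pi fun i => μ i.succ) := by
          refine ((measurePreserving_piFinSuccAbove μ 0).symm.lintegral_comp_emb
            (MeasurableEquiv.measurableEmbedding _) _).symm.trans (lintegral_congr fun x => ?_)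
          rw [Fin.prod_univ_succ]
          rfl
      _ = ∏ i, ∫⁻ x, f i x ∂μ i := by
          rw [Fin.prod_univ_succ, ← ih (fun i => μ i.succ) fun i => hf _]
          exact lintegral_prod_mul (hf 0).aemeasurable
            (Finset.measurable_fun_prod _ fun i _ =>
              (hf _).comp (measurable_pi_apply i)).aemeasurable

variable {ι : Type*} [Fintype ι]

theorem lintegral_pi_prod {α : ι → Type*} [∀ i, MeasurableSpace (α i)] (μ : ∀ i, Measure (α i))
    [∀ i, SigmaFinite (μ i)] {f : ∀ i, α i → ℝ≥0∞} (hf : ∀ i, Measurable (f i)) :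
    ∫⁻ x, ∏ i, f i (x i) ∂Measure.pi μ = ∏ i, ∫⁻ x, f i x ∂μ i := by
  let e := (Fintype.equivFin ι).symm
  rw [← (measurePreserving_piCongrLeft μ e).lintegral_comp_emb
    (MeasurableEquiv.measurableEmbedding _)]
  simp_rw [← e.prod_comp, MeasurableEquiv.coe_piCongrLeft, Equiv.piCongrLeft_apply_apply]
  exact lintegral_pi_fin_prod _ fun i => hf _

theorem pi_withDensity {α : ι → Type*} [∀ i, MeasurableSpace (α i)] (μ : ∀ i, Measure (α i))
    [∀ i, SigmaFinite (μ i)] {f : ∀ i, α i → ℝ≥0∞} (hf : ∀ i, Measurable (f i))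
    [∀ i, SigmaFinite ((μ i).withDensity (f i))] :
    Measure.pi (fun i => (μ i).withDensity (f i)) =
      (Measure.pi μ).withDensity fun x => ∏ i, f i (x i) := by
  refine Measure.pi_eq fun s hs => ?_
  have hindicator (x : ∀ i, α i) : (Set.univ.pi s).indicator (fun x => ∏ i, f i (x i)) x =
      ∏ i, (s i).indicator (f i) (x i) := by
    by_cases hx : x ∈ Set.univ.pi s
    · rw [Set.indicator_of_mem hx]
      exact Finset.prod_congr rfl fun i _ => (Set.indicator_of_mem (hx i (Set.mem_univ i)) _).symm
    · obtain ⟨i, hi⟩ : ∃ i, x i ∉ s i := by simpa using hx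
      rw [Set.indicator_of_notMem hx,
        Finset.prod_eq_zero (Finset.mem_univ i) (Set.indicator_of_notMem hi _)]
  rw [withDensity_apply _ (MeasurableSet.univ_pi hs),
    ← lintegral_indicator (MeasurableSet.univ_pi hs)]
  simp_rw [hindicator, lintegral_pi_prod μ fun i => (hf i).indicator (hs i),
    withDensity_apply _ (hs _), lintegral_indicator (hs _)]

end ProductMeasures

section SpikeSlab

variable {ι : Type*} [Fintype ι] [DecidableEq ι] (γ : Finset ι) (μ : Measure ℝ)

/-- The spike-and-slab measure of the model `γ`: the coordinates in `γ` carry `μ`, the others the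
unit mass at `0`. The prior `coefPrior γ v` is the case of a Gaussian `μ`, and a Lebesgue `μ` gives
Lebesgue measure on the subspace of vectors supported in `γ`. -/
noncomputable def spikeSlab : Measure (ι → ℝ) :=
  Measure.pi fun j => if j ∈ γ then μ else Measure.dirac 0

instance [SigmaFinite μ] (j : ι) : SigmaFinite (if j ∈ γ then μ else Measure.dirac 0) := by
  split_ifs <;> infer_instance

instance [IsProbabilityMeasure μ] (j : ι) :
    IsProbabilityMeasure (if j ∈ γ then μ else Measure.dirac 0) := by
  split_ifs <;> infer_instance

instance [SigmaFinite μ] : SigmaFinite (spikeSlab γ μ) := by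
  unfold spikeSlab; infer_instance

instance [IsProbabilityMeasure μ] : IsProbabilityMeasure (spikeSlab γ μ) := by
  unfold spikeSlab; infer_instance

theorem ae_spikeSlab_support [SigmaFinite μ] : ∀ᵐ x ∂spikeSlab γ μ, ∀ j ∉ γ, x j = 0 := by
  refine ae_all_iff.2 fun j => ?_
  by_cases hj : j ∈ γ
  · simp [hj]
  · have hdirac : ∀ᵐ x ∂(if j ∈ γ then μ else Measure.dirac 0), x = 0 := by
      simp [hj, ae_dirac_eq]
    filter_upwards [Measure.tendsto_eval_ae_ae
      (μ := fun j => if j ∈ γ then μ else Measure.dirac 0) hdirac] with x hx _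
    exact hx

instance [SigmaFinite μ] [μ.IsNegInvariant] : (spikeSlab γ μ).IsNegInvariant := by
  refine ⟨(measurePreserving_pi _ _ (f := fun _ x => -x) fun j => ?_).map_eq⟩
  by_cases hj : j ∈ γ
  · simpa [hj] using Measure.measurePreserving_neg μ
  · simp only [hj, if_false]
    exact ⟨measurable_neg, by simp [Measure.map_dirac' measurable_neg]⟩

variable {γ}

theorem lintegral_spikeSlab_add [SigmaFinite μ] [μ.IsAddRightInvariant] {m : ι → ℝ}
    (hm : ∀ j ∉ γ, m j = 0) (f : (ι → ℝ) → ℝ≥0∞) :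
    ∫⁻ x, f (x + m) ∂spikeSlab γ μ = ∫⁻ x, f x ∂spikeSlab γ μ := by
  have hpres : MeasurePreserving (fun x => x + m) (spikeSlab γ μ) (spikeSlab γ μ) := by
    refine measurePreserving_pi _ _ (f := fun j x => x + m j) fun j => ?_
    by_cases hj : j ∈ γ
    · simpa [hj] using measurePreserving_add_right μ (m j)
    · simpa only [hj, hm j hj, if_false, add_zero] using! MeasurePreserving.id _
  exact hpres.lintegral_comp_emb (MeasurableEquiv.addRight m).measurableEmbedding f

variable (γ)

theorem lintegral_spikeSlab_prod [SigmaFinite μ] {f : ℝ → ℝ≥0∞} (hf : Measurable f) :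
    ∫⁻ x, ∏ j ∈ γ, f (x j) ∂spikeSlab γ μ = (∫⁻ x, f x ∂μ) ^ γ.card := by
  have hfactor (j : ι) : Measurable fun x => if j ∈ γ then f x else 1 := by
    split_ifs <;> fun_prop
  have hprod (x : ι → ℝ) : ∏ j ∈ γ, f (x j) = ∏ j, if j ∈ γ then f (x j) else 1 := by simp
  simp_rw [hprod]
  rw [spikeSlab, lintegral_pi_prod _ hfactor, ← Finset.prod_const,
    ← Finset.prod_subset (Finset.subset_univ γ)]
  · exact Finset.prod_congr rfl fun j hj => by simp [hj]
  · intro j _ hj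
    simp [hj]

theorem spikeSlab_withDensity [SigmaFinite μ] {f : ℝ → ℝ≥0∞} (hf : Measurable f)
    [SigmaFinite (μ.withDensity f)] :
    spikeSlab γ (μ.withDensity f) = (spikeSlab γ μ).withDensity fun x => ∏ j ∈ γ, f (x j) := by
  have hfactor (j : ι) : Measurable fun x => if j ∈ γ then f x else 1 := by
    split_ifs <;> fun_prop
  have hite (j : ι) : (if j ∈ γ then μ else Measure.dirac 0).withDensity
      (fun x => if j ∈ γ then f x else 1) =
        if j ∈ γ then μ.withDensity f else Measure.dirac 0 := by
    split_ifs
    · rfl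
    · exact withDensity_one
  have (j : ι) : SigmaFinite ((if j ∈ γ then μ else Measure.dirac 0).withDensity
      fun x => if j ∈ γ then f x else 1) := by
    rw [hite]; infer_instance
  have hpi := pi_withDensity (fun j => if j ∈ γ then μ else Measure.dirac 0) hfactor
  simp_rw [hite] at hpi
  simp [spikeSlab, hpi]

end SpikeSlab

theorem lintegral_exp_le_of_add_neg {G : Type*} [MeasurableSpace G] [InvolutiveNeg G]
    [MeasurableNeg G] (μ : Measure G) [μ.IsNegInvariant] {f g : G → ℝ} (hf : Measurable f)
    (hg : Measurable g) (hfg : ∀ x, 2 * g x ≤ f x + f (-x)) :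
    ∫⁻ x, ENNReal.ofReal (Real.exp (g x)) ∂μ ≤ ∫⁻ x, ENNReal.ofReal (Real.exp (f x)) ∂μ := by
  have hpoint (x : G) : 2 * Real.exp (g x) ≤ Real.exp (f x) + Real.exp (f (-x)) := by
    have hmid : Real.exp (g x) ≤ Real.exp (f x / 2) * Real.exp (f (-x) / 2) := by
      rw [← Real.exp_add, Real.exp_le_exp]; linarith [hfg x]
    have hsq (u : ℝ) : Real.exp u = Real.exp (u / 2) ^ 2 := by
      rw [← Real.exp_nat_mul]; congr 1; push_cast; ring
    nlinarith [sq_nonneg (Real.exp (f x / 2) - Real.exp (f (-x) / 2)), hsq (f x), hsq (f (-x))]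
  have hdouble : 2 * ∫⁻ x, ENNReal.ofReal (Real.exp (g x)) ∂μ ≤
      2 * ∫⁻ x, ENNReal.ofReal (Real.exp (f x)) ∂μ := by
    calc 2 * ∫⁻ x, ENNReal.ofReal (Real.exp (g x)) ∂μ
        = ∫⁻ x, ENNReal.ofReal (2 * Real.exp (g x)) ∂μ := by
          simp_rw [ENNReal.ofReal_mul zero_le_two, ENNReal.ofReal_ofNat]
          rw [lintegral_const_mul _ (by fun_prop)]
      _ ≤ ∫⁻ x, ENNReal.ofReal (Real.exp (f x) + Real.exp (f (-x))) ∂μ :=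
          lintegral_mono fun x => ENNReal.ofReal_le_ofReal (hpoint x)
      _ = 2 * ∫⁻ x, ENNReal.ofReal (Real.exp (f x)) ∂μ := by
          simp_rw [ENNReal.ofReal_add (Real.exp_nonneg _) (Real.exp_nonneg _)]
          rw [lintegral_add_left (by fun_prop),
            lintegral_neg_eq_self (μ := μ) fun x => ENNReal.ofReal (Real.exp (f x)), two_mul]
  exact (ENNReal.mul_le_mul_iff_right (by norm_num) (by norm_num)).1 hdouble

section SqNorm

variable {ι : Type*} [Fintype ι]

/-- The squared Euclidean norm of a coordinate vector; the norm of `ι → ℝ` is the sup norm. -/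
def sqNorm (v : ι → ℝ) : ℝ := ∑ i, v i ^ 2

theorem sqNorm_nonneg (v : ι → ℝ) : 0 ≤ sqNorm v := Finset.sum_nonneg fun _ _ => sq_nonneg _

theorem sq_apply_le_sqNorm (v : ι → ℝ) (i : ι) : v i ^ 2 ≤ sqNorm v :=
  Finset.single_le_sum (f := fun i => v i ^ 2) (fun _ _ => sq_nonneg _) (Finset.mem_univ i)

@[simp]
theorem sqNorm_neg (v : ι → ℝ) : sqNorm (-v) = sqNorm v := by simp [sqNorm]

theorem sqNorm_smul (a : ℝ) (v : ι → ℝ) : sqNorm (a • v) = a ^ 2 * sqNorm v := by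
  simp [sqNorm, mul_pow, Finset.mul_sum]

theorem sqNorm_add (v w : ι → ℝ) : sqNorm (v + w) = sqNorm v + 2 * (v ⬝ᵥ w) + sqNorm w := by
  simp only [sqNorm, dotProduct, Finset.mul_sum, ← Finset.sum_add_distrib, Pi.add_apply]
  exact Finset.sum_congr rfl fun i _ => by ring

theorem sqNorm_sub (v w : ι → ℝ) : sqNorm (v - w) = sqNorm v - 2 * (v ⬝ᵥ w) + sqNorm w := by
  rw [sub_eq_add_neg, sqNorm_add, sqNorm_neg, dotProduct_neg]; ring

@[fun_prop]
theorem measurable_sqNorm : Measurable (sqNorm : (ι → ℝ) → ℝ) := by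
  unfold sqNorm; fun_prop

@[fun_prop]
theorem measurable_mulVec {κ : Type*} (X : Matrix κ ι ℝ) : Measurable fun v => X.mulVec v := by
  refine measurable_pi_lambda _ fun i => ?_
  simp only [Matrix.mulVec, dotProduct]
  fun_prop

@[fun_prop]
theorem measurable_dotProduct (v : ι → ℝ) : Measurable fun w => v ⬝ᵥ w := by
  simp only [dotProduct]
  fun_prop

end SqNorm

section GaussianIntegrals

theorem lintegral_exp_neg_mul_sq {a : ℝ} (ha : 0 < a) :
    ∫⁻ x, ENNReal.ofReal (Real.exp (-a * x ^ 2)) = ENNReal.ofReal √(Real.pi / a) := by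
  rw [← ofReal_integral_eq_lintegral_ofReal (integrable_exp_neg_mul_sq ha)
      (ae_of_all _ fun x => Real.exp_nonneg _), integral_gaussian]

theorem lintegral_gaussianReal_exp_mul_sq {v : ℝ≥0} (hv : v ≠ 0) {s : ℝ} (hs : 2 * s * v < 1) :
    ∫⁻ x, ENNReal.ofReal (Real.exp (s * x ^ 2)) ∂gaussianReal 0 v =
      ENNReal.ofReal √(1 / (1 - 2 * s * v)) := by
  have : (0 : ℝ) < v := NNReal.coe_pos.2 (pos_iff_ne_zero.2 hv)
  have ha : 0 < 1 / (2 * v) - s := by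
    rw [sub_pos, lt_div_iff₀ (by positivity)]; linarith
  have hprod (x : ℝ) : gaussianPDF 0 v x * ENNReal.ofReal (Real.exp (s * x ^ 2)) =
      ENNReal.ofReal (√(2 * Real.pi * v))⁻¹ *
        ENNReal.ofReal (Real.exp (-(1 / (2 * v) - s) * x ^ 2)) := by
    rw [gaussianPDF, gaussianPDFReal, ENNReal.ofReal_mul (by positivity), mul_assoc,
      ← ENNReal.ofReal_mul (by positivity), ← Real.exp_add]
    congr 3
    ring
  rw [gaussianReal_of_var_ne_zero 0 hv,
    lintegral_withDensity_eq_lintegral_mul _ (measurable_gaussianPDF 0 v) (by fun_prop)]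
  simp_rw [Pi.mul_apply, hprod]
  rw [lintegral_const_mul _ (by fun_prop), lintegral_exp_neg_mul_sq ha,
    ← ENNReal.ofReal_mul (by positivity), ← Real.sqrt_inv, ← Real.sqrt_mul (by positivity)]
  congr 2
  field_simp

theorem lintegral_gaussianReal_exp_mul (v : ℝ≥0) (t : ℝ) :
    ∫⁻ x, ENNReal.ofReal (Real.exp (t * x)) ∂gaussianReal 0 v =
      ENNReal.ofReal (Real.exp (v * t ^ 2 / 2)) := by
  have hmgf := congrFun (mgf_fun_id_gaussianReal (μ := 0) (v := v)) t
  rw [mgf] at hmgf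
  rw [← ofReal_integral_eq_lintegral_ofReal (integrable_exp_mul_gaussianReal t)
      (ae_of_all _ fun x => Real.exp_nonneg _), hmgf]
  simp

variable {ι : Type*} [Fintype ι] [DecidableEq ι] (γ : Finset ι)

theorem lintegral_spikeSlab_exp_neg_mul_sqNorm {a : ℝ} (ha : 0 < a) :
    ∫⁻ β, ENNReal.ofReal (Real.exp (-a * sqNorm β)) ∂spikeSlab γ volume =
      ENNReal.ofReal √(Real.pi / a) ^ γ.card := by
  rw [← lintegral_exp_neg_mul_sq ha, ← lintegral_spikeSlab_prod γ volume (by fun_prop)]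
  refine lintegral_congr_ae ?_
  filter_upwards [ae_spikeSlab_support γ volume] with β hβ
  have hsum : sqNorm β = ∑ j ∈ γ, β j ^ 2 :=
    (Finset.sum_subset (Finset.subset_univ γ) fun j _ hj => by simp [hβ j hj]).symm
  rw [hsum, Finset.mul_sum, Real.exp_sum,
    ENNReal.ofReal_prod_of_nonneg fun _ _ => Real.exp_nonneg _]

end GaussianIntegrals

section ConditionalMarginal

variable {n p : ℕ}

theorem coefPrior_eq_withDensity (γ : Finset (Fin p)) {v : ℝ≥0} (hv : v ≠ 0) :
    coefPrior γ v = (spikeSlab γ volume).withDensity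
      fun β => ∏ j ∈ γ, gaussianPDF 0 v (β j) := by
  have : SigmaFinite ((volume : Measure ℝ).withDensity (gaussianPDF 0 v)) := by
    rw [← gaussianReal_of_var_ne_zero 0 hv]; infer_instance
  rw [← spikeSlab_withDensity γ volume (measurable_gaussianPDF 0 v),
    ← gaussianReal_of_var_ne_zero 0 hv]
  rfl

theorem ae_coefPrior_support (γ : Finset (Fin p)) (v : ℝ≥0) :
    ∀ᵐ β ∂coefPrior γ v, ∀ j ∉ γ, β j = 0 :=
  ae_spikeSlab_support γ (gaussianReal 0 v)

instance (γ : Finset (Fin p)) (v : ℝ≥0) : IsProbabilityMeasure (coefPrior γ v) :=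
  inferInstanceAs (IsProbabilityMeasure (spikeSlab γ (gaussianReal 0 v)))

theorem coefPrior_zero (γ : Finset (Fin p)) : coefPrior γ 0 = coefPrior ∅ 0 := by
  simp [coefPrior]

theorem prod_gaussianPDF {ι : Type*} (s : Finset ι) (m x : ι → ℝ) (v : ℝ≥0) :
    ∏ i ∈ s, gaussianPDF (m i) v (x i) = ENNReal.ofReal
      ((√(2 * Real.pi * v))⁻¹ ^ s.card * Real.exp (-(∑ i ∈ s, (x i - m i) ^ 2) / (2 * v))) := by
  simp only [gaussianPDF, gaussianPDFReal]
  rw [← ENNReal.ofReal_prod_of_nonneg fun _ _ => by positivity, Finset.prod_mul_distrib,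
    Finset.prod_const, ← Real.exp_sum, ← Finset.sum_div, Finset.sum_neg_distrib]

/-- The Gaussian likelihood of `n` observations with precision `t` and residual sum of
squares `T`. -/
noncomputable def gaussKernel (n : ℕ) (t T : ℝ) : ℝ :=
  √(t / (2 * Real.pi)) ^ n * Real.exp (-(t / 2) * T)

theorem gaussKernel_anti (n : ℕ) {t : ℝ} (ht : 0 ≤ t) : Antitone (gaussKernel n t) := by
  intro T₁ T₂ hT
  unfold gaussKernel
  gcongr _ * Real.exp ?_
  nlinarith

variable (X : Matrix (Fin n) (Fin p) ℝ) (y : Fin n → ℝ)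

theorem likelihood_eq (β : Fin p → ℝ) {t : ℝ≥0} (ht : t ≠ 0) :
    likelihood X y β t⁻¹ = ENNReal.ofReal (gaussKernel n t (sqNorm (y - X.mulVec β))) := by
  have : (0 : ℝ) < t := NNReal.coe_pos.2 (pos_iff_ne_zero.2 ht)
  rw [likelihood, prod_gaussianPDF, gaussKernel, ← Real.sqrt_inv]
  simp only [sqNorm, Pi.sub_apply, Finset.card_univ, Fintype.card_fin]
  congr 3
  · push_cast; field_simp
  · push_cast; field_simp

/-- The likelihood integrated over the coefficients, given the model `γ`, the slab scale `c` and
the precision `t = 1/σ²`. -/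
noncomputable def condMarginal (γ : Finset (Fin p)) (c t : ℝ≥0) : ℝ≥0∞ :=
  ∫⁻ β, likelihood X y β t⁻¹ ∂coefPrior γ (c * t⁻¹)

/-- The ridge criterion at `β`: residual sum of squares plus the penalty `‖β‖²/c` contributed by
the Gaussian slab. -/
noncomputable def ridgeRSS (c : ℝ) (β : Fin p → ℝ) : ℝ := sqNorm (y - X.mulVec β) + sqNorm β / c

@[fun_prop]
theorem measurable_ridgeRSS (c : ℝ) : Measurable (ridgeRSS X y c) := by
  unfold ridgeRSS; fun_prop

theorem condMarginal_eq (γ : Finset (Fin p)) {c t : ℝ≥0} (hc : c ≠ 0) (ht : t ≠ 0) :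
    condMarginal X y γ c t =
      ENNReal.ofReal (√(t / (2 * Real.pi)) ^ n * √(t / (2 * Real.pi * c)) ^ γ.card) *
        ∫⁻ β, ENNReal.ofReal (Real.exp (-(t / 2) * ridgeRSS X y c β)) ∂spikeSlab γ volume := by
  have : (0 : ℝ) < t := NNReal.coe_pos.2 (pos_iff_ne_zero.2 ht)
  have : (0 : ℝ) < c := NNReal.coe_pos.2 (pos_iff_ne_zero.2 hc)
  rw [condMarginal, coefPrior_eq_withDensity γ (mul_ne_zero hc (inv_ne_zero ht))]
  simp_rw [likelihood_eq X y _ ht]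
  have hdensity : Measurable fun β : Fin p → ℝ => ∏ j ∈ γ, gaussianPDF 0 (c * t⁻¹) (β j) :=
    Finset.measurable_fun_prod _ fun j _ =>
      (measurable_gaussianPDF _ _).comp (measurable_pi_apply j)
  rw [lintegral_withDensity_eq_lintegral_mul _ hdensity (by unfold gaussKernel; fun_prop),
    ← lintegral_const_mul _ (by fun_prop)]
  refine lintegral_congr_ae ?_
  filter_upwards [ae_spikeSlab_support γ volume] with β hβ
  have hsum : ∑ j ∈ γ, (β j - 0) ^ 2 = sqNorm β := by
    simp only [sub_zero]
    exact Finset.sum_subset (Finset.subset_univ γ) fun j _ hj => by simp [hβ j hj]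
  have hvar : (√(2 * Real.pi * (c * t⁻¹ : ℝ≥0)))⁻¹ = √(t / (2 * Real.pi * c)) := by
    rw [← Real.sqrt_inv]; congr 1; push_cast; field_simp
  have hexp : -(t / 2) * ridgeRSS X y c β =
      -sqNorm β / (2 * (c * t⁻¹ : ℝ≥0)) + -(t / 2) * sqNorm (y - X.mulVec β) := by
    unfold ridgeRSS; push_cast; field_simp; ring
  rw [Pi.mul_apply, prod_gaussianPDF γ fun _ => 0, hsum, hvar, gaussKernel,
    ← ENNReal.ofReal_mul (by positivity), ← ENNReal.ofReal_mul (by positivity), hexp, Real.exp_add]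
  congr 1
  ring

theorem condMarginal_gaussian (γ : Finset (Fin p)) {c t : ℝ≥0} (hc : c ≠ 0) (ht : t ≠ 0) {a : ℝ}
    (ha : 0 < a) (T : ℝ) :
    ENNReal.ofReal (√(t / (2 * Real.pi)) ^ n * √(t / (2 * Real.pi * c)) ^ γ.card) *
        ∫⁻ δ, ENNReal.ofReal (Real.exp (-(t / 2) * (T + a * sqNorm δ))) ∂spikeSlab γ volume =
      ENNReal.ofReal √(1 / (a * c)) ^ γ.card * ENNReal.ofReal (gaussKernel n t T) := by
  have : (0 : ℝ) < t := NNReal.coe_pos.2 (pos_iff_ne_zero.2 ht)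
  have : (0 : ℝ) < c := NNReal.coe_pos.2 (pos_iff_ne_zero.2 hc)
  have hexp (δ : Fin p → ℝ) : Real.exp (-(t / 2) * (T + a * sqNorm δ)) =
      Real.exp (-(t / 2) * T) * Real.exp (-(t / 2 * a) * sqNorm δ) := by
    rw [← Real.exp_add]; congr 1; ring
  have hsqrt : √(1 / (a * c)) = √(t / (2 * Real.pi * c)) * √(Real.pi / (t / 2 * a)) := by
    rw [← Real.sqrt_mul (by positivity)]; congr 1; field_simp
  simp_rw [hexp, ENNReal.ofReal_mul (Real.exp_nonneg (-(t / 2) * T))]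
  rw [lintegral_const_mul _ (by fun_prop),
    lintegral_spikeSlab_exp_neg_mul_sqNorm γ (by positivity),
    ← ENNReal.ofReal_pow (by positivity), ← ENNReal.ofReal_pow (by positivity),
    ← ENNReal.ofReal_mul (by positivity), ← ENNReal.ofReal_mul (by positivity),
    ← ENNReal.ofReal_mul (by positivity), hsqrt, mul_pow, gaussKernel]
  congr 1
  ring

variable {X y} {γ : Finset (Fin p)} {c t : ℝ≥0} {a T : ℝ} {m : Fin p → ℝ}

theorem condMarginal_le_of_le_ridgeRSS (hc : c ≠ 0) (ht : t ≠ 0) (ha : 0 < a)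
    (hm : ∀ j ∉ γ, m j = 0)
    (h : ∀ β, (∀ j ∉ γ, β j = 0) → T + a * sqNorm (β - m) ≤ ridgeRSS X y c β) :
    condMarginal X y γ c t ≤
      ENNReal.ofReal √(1 / (a * c)) ^ γ.card * ENNReal.ofReal (gaussKernel n t T) := by
  rw [condMarginal_eq X y γ hc ht, ← condMarginal_gaussian γ hc ht ha,
    ← lintegral_spikeSlab_add volume hm]
  gcongr _ * ?_
  refine lintegral_mono_ae ?_
  filter_upwards [ae_spikeSlab_support γ volume] with δ hδ
  have hδm := h (δ + m) fun j hj => by simp [hδ j hj, hm j hj]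
  rw [add_sub_cancel_right] at hδm
  gcongr ENNReal.ofReal (Real.exp ?_)
  nlinarith [t.2]

theorem le_condMarginal_of_ridgeRSS_le (hc : c ≠ 0) (ht : t ≠ 0) (ha : 0 < a)
    (hm : ∀ j ∉ γ, m j = 0)
    (h : ∀ δ, ridgeRSS X y c (m + δ) + ridgeRSS X y c (m - δ) ≤ 2 * (T + a * sqNorm δ)) :
    ENNReal.ofReal √(1 / (a * c)) ^ γ.card * ENNReal.ofReal (gaussKernel n t T) ≤
      condMarginal X y γ c t := by
  rw [condMarginal_eq X y γ hc ht, ← lintegral_spikeSlab_add volume hm,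
    ← condMarginal_gaussian γ hc ht ha]
  gcongr _ * ?_
  refine lintegral_exp_le_of_add_neg _ (by fun_prop) (by fun_prop) fun δ => ?_
  have hδ := h δ
  rw [add_comm m, sub_eq_neg_add] at hδ
  nlinarith [t.2]

theorem condMarginal_le_of_le_sqNorm (ht : t ≠ 0)
    (h : ∀ β, (∀ j ∉ γ, β j = 0) → T ≤ sqNorm (y - X.mulVec β)) :
    condMarginal X y γ c t ≤ ENNReal.ofReal (gaussKernel n t T) := by
  calc condMarginal X y γ c t
      ≤ ∫⁻ _, ENNReal.ofReal (gaussKernel n t T) ∂coefPrior γ (c * t⁻¹) := by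
        refine lintegral_mono_ae ?_
        filter_upwards [ae_coefPrior_support γ (c * t⁻¹)] with β hβ
        rw [likelihood_eq X y β ht]
        exact ENNReal.ofReal_le_ofReal (gaussKernel_anti n t.2 (h β hβ))
    _ = ENNReal.ofReal (gaussKernel n t T) := by simp

end ConditionalMarginal

section Gamma

variable {a r s u : ℝ}

theorem measurable_gammaPDF (a r : ℝ) : Measurable (gammaPDF a r) :=
  (measurable_gammaPDFReal a r).ennreal_ofReal

theorem ae_gammaMeasure_pos (a r : ℝ) : ∀ᵐ τ ∂gammaMeasure a r, 0 < τ := by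
  rw [gammaMeasure, ae_withDensity_iff (measurable_gammaPDF _ _)]
  filter_upwards [Measure.ae_ne volume (0 : ℝ)] with τ hτ hpdf
  exact hτ.symm.lt_of_le (not_lt.1 fun hneg => hpdf (gammaPDF_of_neg hneg))

theorem lintegral_gammaMeasure_rpow_mul_exp (ha : 0 < a) (hr : 0 < r) (has : 0 < a + s)
    (hru : 0 < r + u) :
    ∫⁻ τ, ENNReal.ofReal (τ ^ s * Real.exp (-(u * τ))) ∂gammaMeasure a r =
      ENNReal.ofReal (r ^ a * Real.Gamma (a + s) / Real.Gamma a * (r + u) ^ (-(a + s))) := by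
  have : 0 < Real.Gamma a := Real.Gamma_pos_of_pos ha
  have : 0 < Real.Gamma (a + s) := Real.Gamma_pos_of_pos has
  rw [gammaMeasure, lintegral_withDensity_eq_lintegral_mul _ (measurable_gammaPDF _ _)
    (by fun_prop), ← mul_one (ENNReal.ofReal _), ← lintegral_gammaPDF_eq_one has hru,
    ← lintegral_const_mul _ (measurable_gammaPDF _ _)]
  refine lintegral_congr_ae ?_
  filter_upwards [Measure.ae_ne volume (0 : ℝ)] with τ hτ
  rw [Pi.mul_apply]
  rcases lt_or_gt_of_ne hτ with hneg | hpos
  · simp [gammaPDF_of_neg hneg]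
  rw [gammaPDF_of_nonneg hpos.le, gammaPDF_of_nonneg hpos.le, ← ENNReal.ofReal_mul (by positivity),
    ← ENNReal.ofReal_mul (by positivity), Real.rpow_neg hru.le,
    show a + s - 1 = (a - 1) + s by ring, Real.rpow_add hpos,
    show -((r + u) * τ) = -(r * τ) + -(u * τ) by ring, Real.exp_add]
  have hpow : (r + u) ^ (a + s) ≠ 0 := (Real.rpow_pos_of_pos hru _).ne'
  congr 1
  field_simp

end Gamma

section StudentKernel

/-- The Gaussian kernel mixed over the precision `τ ∼ χ²_ν`: up to a constant factor, the density
`(1 + T)^{-(n+ν)/2}` of a multivariate `t` distribution, as a function of the residual `T`. -/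
noncomputable def studentKernel (n : ℕ) (ν T : ℝ) : ℝ≥0∞ :=
  ∫⁻ τ, ENNReal.ofReal (gaussKernel n τ.toNNReal T) ∂chiSquareMeasure ν

theorem studentKernel_anti (n : ℕ) (ν : ℝ) : Antitone (studentKernel n ν) := fun _ _ h =>
  lintegral_mono fun τ => ENNReal.ofReal_le_ofReal (gaussKernel_anti n τ.toNNReal.2 h)

theorem exists_studentKernel_eq (n : ℕ) {ν : ℝ} (hν : 0 < ν) :
    ∃ K : ℝ, 0 < K ∧ ∀ T : ℝ, -1 < T →
      studentKernel n ν T = ENNReal.ofReal (K * (1 + T) ^ (-((n + ν) / 2))) := by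
  have ha : 0 < ν / 2 := by positivity
  have has : 0 < ν / 2 + n / 2 := by positivity
  refine ⟨√(1 / (2 * Real.pi)) ^ n * ((1 / 2) ^ (ν / 2) * Real.Gamma (ν / 2 + n / 2) /
    Real.Gamma (ν / 2) * (1 / 2) ^ (-(ν / 2 + n / 2))), ?_, fun T hT => ?_⟩
  · have := Real.Gamma_pos_of_pos ha
    have := Real.Gamma_pos_of_pos has
    positivity
  have hkernel : studentKernel n ν T = ENNReal.ofReal (√(1 / (2 * Real.pi)) ^ n) *
      ∫⁻ τ, ENNReal.ofReal (τ ^ (n / 2 : ℝ) * Real.exp (-(T / 2 * τ))) ∂chiSquareMeasure ν := by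
    rw [studentKernel, ← lintegral_const_mul' _ _ ENNReal.ofReal_ne_top]
    refine lintegral_congr_ae ?_
    filter_upwards [ae_gammaMeasure_pos (ν / 2) (1 / 2)] with τ hτ
    have hsqrt : √τ ^ n = τ ^ (n / 2 : ℝ) := by
      rw [Real.sqrt_eq_rpow, ← Real.rpow_mul_natCast hτ.le]; congr 1; ring
    rw [← ENNReal.ofReal_mul (by positivity), gaussKernel, Real.coe_toNNReal _ hτ.le,
      div_eq_mul_one_div τ, Real.sqrt_mul hτ.le, mul_pow, hsqrt]
    ring_nf
  rw [hkernel, chiSquareMeasure, lintegral_gammaMeasure_rpow_mul_exp ha one_half_pos has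
    (by linarith), ← ENNReal.ofReal_mul (by positivity),
    show 1 / 2 + T / 2 = 1 / 2 * (1 + T) by ring, Real.mul_rpow (by norm_num) (by linarith),
    show -(ν / 2 + n / 2) = -((n + ν) / 2) by ring]
  congr 1
  ring

variable {n : ℕ} {ν T T₁ T₂ : ℝ}

theorem studentKernel_pos (hν : 0 < ν) (hT : 0 ≤ T) : 0 < studentKernel n ν T := by
  obtain ⟨K, hK, hstudent⟩ := exists_studentKernel_eq n hν
  rw [hstudent T (by linarith), ENNReal.ofReal_pos]
  positivity

theorem studentKernel_ne_top (hν : 0 < ν) (hT : 0 ≤ T) : studentKernel n ν T ≠ ∞ := by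
  obtain ⟨K, _, hstudent⟩ := exists_studentKernel_eq n hν
  exact hstudent T (by linarith) ▸ ENNReal.ofReal_ne_top

theorem studentKernel_le_exp_mul (hν : 0 < ν) (h₁ : 0 ≤ T₁) (h₂ : 0 ≤ T₂) :
    studentKernel n ν T₁ ≤
      ENNReal.ofReal (Real.exp ((T₂ - T₁) / (1 + T₁) * ((n + ν) / 2))) * studentKernel n ν T₂ := by
  obtain ⟨K, hK, hstudent⟩ := exists_studentKernel_eq n hν
  rw [hstudent T₁ (by linarith), hstudent T₂ (by linarith), ← ENNReal.ofReal_mul (by positivity)]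
  refine ENNReal.ofReal_le_ofReal ?_
  have hratio : (1 + T₂) / (1 + T₁) ≤ Real.exp ((T₂ - T₁) / (1 + T₁)) := by
    calc (1 + T₂) / (1 + T₁) = (T₂ - T₁) / (1 + T₁) + 1 := by field_simp; ring
      _ ≤ _ := Real.add_one_le_exp _
  have hpow : (1 + T₁) ^ (-((n + ν) / 2)) =
      ((1 + T₂) / (1 + T₁)) ^ ((n + ν) / 2) * (1 + T₂) ^ (-((n + ν) / 2)) := by
    have : (1 + T₂) ^ ((n + ν) / 2) ≠ 0 := (Real.rpow_pos_of_pos (by linarith) _).ne'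
    rw [Real.div_rpow (by linarith) (by linarith), Real.rpow_neg (by linarith),
      Real.rpow_neg (by linarith)]
    field_simp
  calc K * (1 + T₁) ^ (-((n + ν) / 2))
      = ((1 + T₂) / (1 + T₁)) ^ ((n + ν) / 2) * (K * (1 + T₂) ^ (-((n + ν) / 2))) := by
        rw [hpow]; ring
    _ ≤ Real.exp ((T₂ - T₁) / (1 + T₁)) ^ ((n + ν) / 2) * (K * (1 + T₂) ^ (-((n + ν) / 2))) := by
        gcongr
    _ = _ := by rw [← Real.exp_mul]

theorem studentKernel_le_exp_mul_of_sub_le (hν : 0 < ν) (h₁ : 0 ≤ T₁) (h₂ : 0 ≤ T₂)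
    {κ Δ : ℝ} (hκ : (n + ν) / 2 ≤ κ * (1 + T₁)) (hΔ : T₂ - T₁ ≤ Δ) (hΔ0 : 0 ≤ Δ) :
    studentKernel n ν T₁ ≤ ENNReal.ofReal (Real.exp (κ * Δ)) * studentKernel n ν T₂ := by
  refine (studentKernel_le_exp_mul hν h₁ h₂).trans ?_
  gcongr ENNReal.ofReal (Real.exp ?_) * _
  calc (T₂ - T₁) / (1 + T₁) * ((n + ν) / 2) ≤ Δ / (1 + T₁) * (κ * (1 + T₁)) := by gcongr
    _ = κ * Δ := by field_simp

theorem studentKernel_add_le (hν : 0 < ν) (hT : 0 ≤ T) {κ L : ℝ} (hL : 0 ≤ L)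
    (hκ : κ * (1 + T + L) ≤ (n + ν) / 2) :
    studentKernel n ν (T + L) ≤ ENNReal.ofReal (Real.exp (-(κ * L))) * studentKernel n ν T := by
  refine (studentKernel_le_exp_mul hν (add_nonneg hT hL) hT).trans ?_
  gcongr
  calc (T - (T + L)) / (1 + (T + L)) * ((n + ν) / 2)
      = -(L / (1 + T + L) * ((n + ν) / 2)) := by field_simp; ring
    _ ≤ -(L / (1 + T + L) * (κ * (1 + T + L))) := by gcongr
    _ = -(κ * L) := by field_simp

end StudentKernel

section ScaleMarginal

variable {n p : ℕ} {ν : ℝ} {X : Matrix (Fin n) (Fin p) ℝ} {y : Fin n → ℝ} {γ : Finset (Fin p)}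
  {c : ℝ≥0} {K : ℝ≥0∞} {T : ℝ}

/-- The marginal likelihood of the model `γ` given the prior scale `c`. -/
noncomputable def scaleMarginal (ν : ℝ) (X : Matrix (Fin n) (Fin p) ℝ) (y : Fin n → ℝ)
    (γ : Finset (Fin p)) (c : ℝ≥0) : ℝ≥0∞ :=
  ∫⁻ τ, condMarginal X y γ c τ.toNNReal ∂chiSquareMeasure ν

theorem marginalLikelihood_eq_lintegral_scaleMarginal (g : Measure ℝ≥0) :
    marginalLikelihood ν g X y γ = ∫⁻ c, scaleMarginal ν X y γ c ∂g := rfl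

theorem scaleMarginal_le (hK : K ≠ ∞)
    (h : ∀ t : ℝ≥0, t ≠ 0 → condMarginal X y γ c t ≤ K * ENNReal.ofReal (gaussKernel n t T)) :
    scaleMarginal ν X y γ c ≤ K * studentKernel n ν T := by
  rw [studentKernel, ← lintegral_const_mul' _ _ hK]
  refine lintegral_mono_ae ?_
  filter_upwards [ae_gammaMeasure_pos (ν / 2) (1 / 2)] with τ hτ
  exact h _ (Real.toNNReal_pos.2 hτ).ne'

theorem le_scaleMarginal (hK : K ≠ ∞)
    (h : ∀ t : ℝ≥0, t ≠ 0 → K * ENNReal.ofReal (gaussKernel n t T) ≤ condMarginal X y γ c t) :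
    K * studentKernel n ν T ≤ scaleMarginal ν X y γ c := by
  rw [studentKernel, ← lintegral_const_mul' _ _ hK]
  refine lintegral_mono_ae ?_
  filter_upwards [ae_gammaMeasure_pos (ν / 2) (1 / 2)] with τ hτ
  exact h _ (Real.toNNReal_pos.2 hτ).ne'

theorem scaleMarginal_le_of_le_sqNorm
    (h : ∀ β, (∀ j ∉ γ, β j = 0) → T ≤ sqNorm (y - X.mulVec β)) :
    scaleMarginal ν X y γ c ≤ studentKernel n ν T := by
  simpa only [one_mul] using scaleMarginal_le ENNReal.one_ne_top fun t ht => by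
    simpa only [one_mul] using condMarginal_le_of_le_sqNorm ht h

theorem marginalLikelihood_ne_top (hν : 0 < ν) (g : Measure ℝ≥0) [IsProbabilityMeasure g] :
    marginalLikelihood ν g X y γ ≠ ∞ := by
  refine ne_top_of_le_ne_top (studentKernel_ne_top (n := n) hν le_rfl) ?_
  calc marginalLikelihood ν g X y γ ≤ ∫⁻ _, studentKernel n ν 0 ∂g :=
        lintegral_mono fun c => scaleMarginal_le_of_le_sqNorm fun β _ => sqNorm_nonneg _
    _ = studentKernel n ν 0 := by simp

end ScaleMarginal

section NoiseResidual

variable {n p : ℕ} {ν : ℝ} {X : Matrix (Fin n) (Fin p) ℝ} {e : Fin n → ℝ} {γ : Finset (Fin p)}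
  {β₀ : Fin p → ℝ} {c : ℝ≥0} {A D T : ℝ}

theorem sqNorm_div_add_le {ι : Type*} [Fintype ι] {A c : ℝ} (hA : 0 < A) (hc : 0 < c)
    (β β₀ : ι → ℝ) : sqNorm β₀ / (c + 1 / A) ≤ A * sqNorm (β - β₀) + sqNorm β / c := by
  simp only [sqNorm, Finset.sum_div, Finset.mul_sum, ← Finset.sum_add_distrib, Pi.sub_apply]
  refine Finset.sum_le_sum fun j _ => (div_le_iff₀ (by positivity)).2 ?_
  calc β₀ j ^ 2 ≤ β₀ j ^ 2 + (A * c * (β j - β₀ j) + β j) ^ 2 / (A * c) :=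
        le_add_of_nonneg_right (by positivity)
    _ = (A * (β j - β₀ j) ^ 2 + β j ^ 2 / c) * (c + 1 / A) := by field_simp; ring

theorem residual_eq (X : Matrix (Fin n) (Fin p) ℝ) (e : Fin n → ℝ) (β β₀ : Fin p → ℝ) :
    X.mulVec β₀ + e - X.mulVec β = e - X.mulVec (β - β₀) := by
  rw [Matrix.mulVec_sub]; abel

/-- Projecting the noise `e` on the columns of `γ` leaves at least `T` of its squared norm, and
the residual grows with curvature `2 A`; the two halves of the curvature are later spent on the
bias and on the integral over the slab. -/
def ResidualBound (γ : Finset (Fin p)) (X : Matrix (Fin n) (Fin p) ℝ) (e : Fin n → ℝ)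
    (A T : ℝ) : Prop :=
  ∀ δ, (∀ j ∉ γ, δ j = 0) → T + 2 * A * sqNorm δ ≤ sqNorm (e - X.mulVec δ)

theorem ResidualBound.le_sqNorm (hR : ResidualBound γ X e A T) : T ≤ sqNorm e := by
  simpa [sqNorm] using hR 0 fun _ _ => rfl

theorem ResidualBound.scaleMarginal_le (hR : ResidualBound γ X e A T) (hA : 0 < A)
    (hβ₀ : ∀ j ∉ γ, β₀ j = 0) (hc : c ≠ 0) :
    scaleMarginal ν X (X.mulVec β₀ + e) γ c ≤ ENNReal.ofReal √(1 / (A * c)) ^ γ.card *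
      studentKernel n ν (T + sqNorm β₀ / (c + 1 / A)) := by
  refine BayesVarSel.scaleMarginal_le (ENNReal.pow_ne_top ENNReal.ofReal_ne_top) fun t ht =>
    condMarginal_le_of_le_ridgeRSS hc ht hA hβ₀ fun β hβ => ?_
  have hresidual := hR (β - β₀) fun j hj => by simp [hβ j hj, hβ₀ j hj]
  have hbias := sqNorm_div_add_le hA (NNReal.coe_pos.2 (pos_iff_ne_zero.2 hc)) β β₀
  rw [ridgeRSS, residual_eq]
  linarith

theorem ResidualBound.scaleMarginal_le_sqrt_two (hR : ResidualBound γ X e A T) (hA : 0 < A)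
    (hβ₀ : ∀ j ∉ γ, β₀ j = 0) (c : ℝ≥0) :
    scaleMarginal ν X (X.mulVec β₀ + e) γ c ≤ ENNReal.ofReal √2 ^ γ.card *
      studentKernel n ν (T + sqNorm β₀ / (2 * c + 1 / A)) := by
  refine BayesVarSel.scaleMarginal_le (ENNReal.pow_ne_top ENNReal.ofReal_ne_top) fun t ht => ?_
  rcases eq_or_ne c 0 with rfl | hc
  · have hzero :
        condMarginal X (X.mulVec β₀ + e) γ 0 t = condMarginal X (X.mulVec β₀ + e) ∅ 0 t := by
      simp only [condMarginal, zero_mul, coefPrior_zero γ]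
    rw [hzero]
    refine (condMarginal_le_of_le_sqNorm ht fun β hβ => ?_).trans
      (le_mul_of_one_le_left zero_le (one_le_pow₀ ?_))
    · have hresidual := hR (β - β₀) fun j hj => by simp [hβ j (Finset.notMem_empty j), hβ₀ j hj]
      obtain rfl : β = 0 := funext fun j => hβ j (Finset.notMem_empty j)
      rw [zero_sub, sqNorm_neg] at hresidual
      rw [residual_eq, zero_sub, NNReal.coe_zero, mul_zero, zero_add, div_div_eq_mul_div, div_one]
      nlinarith [mul_nonneg hA.le (sqNorm_nonneg β₀)]
    · rw [ENNReal.one_le_ofReal, Real.one_le_sqrt]; norm_num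
  · have : (0 : ℝ) < c := NNReal.coe_pos.2 (pos_iff_ne_zero.2 hc)
    have hvar : 1 / (1 / (2 * (c : ℝ)) * c) = 2 := by field_simp
    refine (condMarginal_le_of_le_ridgeRSS hc ht (a := 1 / (2 * c)) (m := 0) (by positivity)
      (fun _ _ => rfl) fun β hβ => ?_).trans_eq (by rw [hvar])
    have hresidual := hR (β - β₀) fun j hj => by simp [hβ j hj, hβ₀ j hj]
    have hbias := sqNorm_div_add_le hA (by positivity : 0 < 2 * (c : ℝ)) β β₀
    have hhalf : sqNorm β / (2 * c) + 1 / (2 * c) * sqNorm β = sqNorm β / c := by field_simp; ring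
    rw [ridgeRSS, residual_eq, sub_zero]
    nlinarith [mul_nonneg hA.le (sqNorm_nonneg (β - β₀))]

theorem ResidualBound.scaleMarginal_le_of_notMem (hR : ResidualBound Finset.univ X e A T)
    (hA : 0 ≤ A) {j : Fin p} (hj : j ∉ γ) {ψ : ℝ} (hψ : 0 ≤ ψ) (hψj : ψ ≤ |β₀ j|) (c : ℝ≥0) :
    scaleMarginal ν X (X.mulVec β₀ + e) γ c ≤ studentKernel n ν (T + 2 * A * ψ ^ 2) := by
  refine scaleMarginal_le_of_le_sqNorm fun β hβ => ?_
  rw [residual_eq]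
  refine le_trans ?_ (hR (β - β₀) fun j hj => absurd (Finset.mem_univ j) hj)
  gcongr
  calc ψ ^ 2 ≤ |β₀ j| ^ 2 := by gcongr
    _ = (β - β₀) j ^ 2 := by simp [hβ j hj]
    _ ≤ sqNorm (β - β₀) := sq_apply_le_sqNorm _ j

theorem studentKernel_le_scaleMarginal (hD : 0 ≤ D) (hβ₀ : ∀ j ∉ γ, β₀ j = 0)
    (hX : ∀ δ, sqNorm (X.mulVec δ) ≤ D * sqNorm δ) (hc : c ≠ 0) :
    studentKernel n ν (sqNorm e + sqNorm β₀ / c) ≤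
      ENNReal.ofReal √(1 + c * D) ^ γ.card * scaleMarginal ν X (X.mulVec β₀ + e) γ c := by
  have : (0 : ℝ) < c := NNReal.coe_pos.2 (pos_iff_ne_zero.2 hc)
  have hlower : ENNReal.ofReal √(1 / ((D + 1 / c) * c)) ^ γ.card *
      studentKernel n ν (sqNorm e + sqNorm β₀ / c) ≤ scaleMarginal ν X (X.mulVec β₀ + e) γ c := by
    refine le_scaleMarginal (ENNReal.pow_ne_top ENNReal.ofReal_ne_top) fun t ht =>
      le_condMarginal_of_ridgeRSS_le hc ht (by positivity) hβ₀ fun δ => ?_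
    have hcurvature := hX δ
    simp only [ridgeRSS, residual_eq, add_sub_cancel_left, sub_sub_cancel_left, Matrix.mulVec_neg,
      sub_neg_eq_add, sqNorm_add, sqNorm_sub]
    simp only [add_div, sub_div, add_mul, one_div_mul_eq_div]
    linarith
  have hcancel : √(1 + c * D) * √(1 / ((D + 1 / c) * c)) = 1 := by
    rw [← Real.sqrt_mul (by positivity), Real.sqrt_eq_one]; field_simp; ring
  calc studentKernel n ν (sqNorm e + sqNorm β₀ / c)
      = ENNReal.ofReal √(1 + c * D) ^ γ.card * (ENNReal.ofReal √(1 / ((D + 1 / c) * c)) ^ γ.card *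
          studentKernel n ν (sqNorm e + sqNorm β₀ / c)) := by
        rw [← mul_assoc, ← mul_pow, ← ENNReal.ofReal_mul (by positivity), hcancel]; simp
    _ ≤ _ := by gcongr

theorem studentKernel_le_marginalLikelihood (g : Measure ℝ≥0) [IsFiniteMeasure g] (hD : 0 ≤ D)
    (hβ₀ : ∀ j ∉ γ, β₀ j = 0) (hX : ∀ δ, sqNorm (X.mulVec δ) ≤ D * sqNorm δ) {φ Φ : ℝ≥0}
    (hφ : φ ≠ 0) (hg : g (Set.Icc φ Φ) ≠ 0) :
    studentKernel n ν (sqNorm e + sqNorm β₀ / φ) ≤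
      ENNReal.ofReal (√(1 + Φ * D) ^ γ.card / (g (Set.Icc φ Φ)).toReal) *
        marginalLikelihood ν g X (X.mulVec β₀ + e) γ := by
  have : (0 : ℝ) < φ := NNReal.coe_pos.2 (pos_iff_ne_zero.2 hφ)
  have hprod : studentKernel n ν (sqNorm e + sqNorm β₀ / φ) * g (Set.Icc φ Φ) ≤
      ENNReal.ofReal (√(1 + Φ * D)) ^ γ.card * marginalLikelihood ν g X (X.mulVec β₀ + e) γ := by
    rw [marginalLikelihood_eq_lintegral_scaleMarginal, ← setLIntegral_const,
      ← lintegral_const_mul' _ _ (ENNReal.pow_ne_top ENNReal.ofReal_ne_top)]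
    refine (setLIntegral_mono' measurableSet_Icc fun c hc => ?_).trans
      (setLIntegral_le_lintegral (Set.Icc φ Φ) _)
    have hφc : (φ : ℝ) ≤ c := NNReal.coe_le_coe.2 hc.1
    have hcΦ : (c : ℝ) ≤ Φ := NNReal.coe_le_coe.2 hc.2
    have hc0 : c ≠ 0 := ((pos_iff_ne_zero.2 hφ).trans_le hc.1).ne'
    calc studentKernel n ν (sqNorm e + sqNorm β₀ / φ)
        ≤ studentKernel n ν (sqNorm e + sqNorm β₀ / c) :=
          studentKernel_anti n ν (by have := sqNorm_nonneg β₀; gcongr)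
      _ ≤ ENNReal.ofReal √(1 + c * D) ^ γ.card * scaleMarginal ν X (X.mulVec β₀ + e) γ c :=
          studentKernel_le_scaleMarginal hD hβ₀ hX hc0
      _ ≤ _ := by gcongr
  rw [ENNReal.ofReal_div_of_pos (ENNReal.toReal_pos hg (measure_ne_top g _)),
    ENNReal.ofReal_toReal (measure_ne_top g _), ENNReal.ofReal_pow (by positivity),
    ← ENNReal.mul_div_right_comm]
  exact (ENNReal.le_div_iff_mul_le (.inl hg) (.inl (measure_ne_top g _))).2 hprod

end NoiseResidual

section Conditioning

variable {n p : ℕ} {b : ℝ} {X : Matrix (Fin n) (Fin p) ℝ}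

/-- The quadratic form of `Xᵀ X / n` lies between `1/b` and `b` times the squared norm: the form in
which the eigenvalue condition is used. -/
def IsConditioned {n p : ℕ} (b : ℝ) (X : Matrix (Fin n) (Fin p) ℝ) : Prop :=
  ∀ v : Fin p → ℝ, n / b * sqNorm v ≤ sqNorm (X.mulVec v) ∧ sqNorm (X.mulVec v) ≤ n * b * sqNorm v

theorem mul_sqNorm_le_dotProduct_mulVec_of_spectrum {ι : Type*} [Fintype ι] [DecidableEq ι]
    {M : Matrix ι ι ℝ} (hM : M.IsHermitian) {r : ℝ} (h : ∀ x ∈ spectrum ℝ M, r ≤ x) (v : ι → ℝ) :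
    r * sqNorm v ≤ v ⬝ᵥ M.mulVec v := by
  have hshift : (M - algebraMap ℝ _ r).IsHermitian := by
    rw [Matrix.algebraMap_eq_diagonal]
    exact hM.sub (Matrix.isHermitian_diagonal _)
  have hpos : (M - algebraMap ℝ _ r).PosSemidef := by
    rw [hshift.posSemidef_iff_eigenvalues_nonneg]
    intro i
    have hmem := hshift.eigenvalues_mem_spectrum_real i
    rw [← spectrum.sub_singleton_eq, Set.sub_singleton] at hmem
    obtain ⟨x, hx, hxi⟩ := hmem
    exact (sub_nonneg.2 (h x hx)).trans_eq hxi
  have hquad := hpos.dotProduct_mulVec_nonneg v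
  have hsq : v ⬝ᵥ v = sqNorm v := by simp only [dotProduct, sqNorm, sq]
  rw [Matrix.sub_mulVec, dotProduct_sub, Algebra.algebraMap_eq_smul_one, Matrix.smul_mulVec,
    Matrix.one_mulVec, dotProduct_smul, smul_eq_mul, star_trivial, hsq] at hquad
  linarith

theorem WellConditioned.isConditioned (hn : 0 < n) (h : WellConditioned b X) :
    IsConditioned b X := by
  have hn' : (0 : ℝ) < n := Nat.cast_pos.2 hn
  set M := (n : ℝ)⁻¹ • (X.transpose * X) with hMdef
  have hM : M.IsHermitian := by
    have hXX := Matrix.isHermitian_conjTranspose_mul_self X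
    rw [Matrix.conjTranspose_eq_transpose_of_trivial] at hXX
    exact hXX.smul (IsSelfAdjoint.all _)
  intro v
  have hquad : v ⬝ᵥ M.mulVec v = (n : ℝ)⁻¹ * sqNorm (X.mulVec v) := by
    rw [hMdef, Matrix.smul_mulVec, dotProduct_smul, smul_eq_mul, ← Matrix.mulVec_mulVec,
      Matrix.dotProduct_mulVec, Matrix.vecMul_transpose]
    simp only [dotProduct, sqNorm, sq]
  have hlower := mul_sqNorm_le_dotProduct_mulVec_of_spectrum hM (fun x hx => (h hx).1) v
  have hupper := mul_sqNorm_le_dotProduct_mulVec_of_spectrum (r := -b) hM.neg (fun x hx => by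
    rw [← spectrum.neg_eq] at hx
    exact neg_le.1 (h hx).2) v
  rw [Matrix.neg_mulVec, dotProduct_neg] at hupper
  rw [hquad, inv_mul_eq_div] at hlower hupper
  rw [le_div_iff₀ hn'] at hlower
  rw [neg_mul, neg_le_neg_iff, div_le_iff₀ hn'] at hupper
  exact ⟨by linarith [show n / b * sqNorm v = 1 / b * sqNorm v * n by ring], by linarith⟩

theorem isClosed_isConditioned (n p : ℕ) (b : ℝ) :
    IsClosed {x : Fin n → Fin p → ℝ | IsConditioned b (Matrix.of x)} := by
  have hcont (v : Fin p → ℝ) :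
      Continuous fun x : Fin n → Fin p → ℝ => sqNorm ((Matrix.of x).mulVec v) := by
    simp only [sqNorm, Matrix.mulVec, dotProduct, Matrix.of_apply]
    fun_prop
  simp only [IsConditioned, Set.ofPred_forall, Set.ofPred_and]
  exact isClosed_iInter fun v =>
    (isClosed_le continuous_const (hcont v)).inter (isClosed_le (hcont v) continuous_const)

end Conditioning

section GaussianNoise

variable {ι : Type*} [Fintype ι] {v : ℝ≥0} {s l : ℝ}

theorem lintegral_pi_gaussianReal_exp_dotProduct (v : ℝ≥0) (a : ℝ) (u : ι → ℝ) :
    ∫⁻ e, ENNReal.ofReal (Real.exp (a * (e ⬝ᵥ u))) ∂Measure.pi (fun _ : ι => gaussianReal 0 v) =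
      ENNReal.ofReal (Real.exp (a ^ 2 * v / 2 * sqNorm u)) := by
  have hexp (e : ι → ℝ) : ENNReal.ofReal (Real.exp (a * (e ⬝ᵥ u))) =
      ∏ i, ENNReal.ofReal (Real.exp (a * u i * e i)) := by
    rw [← ENNReal.ofReal_prod_of_nonneg fun i _ => Real.exp_nonneg _, ← Real.exp_sum, dotProduct,
      Finset.mul_sum]
    congr! 3 with i
    ring
  simp_rw [hexp]
  rw [lintegral_pi_prod _ (f := fun i x => ENNReal.ofReal (Real.exp (a * u i * x)))
    fun i => by fun_prop]
  simp_rw [lintegral_gaussianReal_exp_mul]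
  rw [← ENNReal.ofReal_prod_of_nonneg fun i _ => Real.exp_nonneg _, ← Real.exp_sum, sqNorm,
    Finset.mul_sum]
  congr! 3 with i
  ring

theorem lintegral_pi_gaussianReal_exp_mul_sqNorm (hv : v ≠ 0) (hs : 2 * s * v < 1) :
    ∫⁻ e, ENNReal.ofReal (Real.exp (s * sqNorm e)) ∂Measure.pi (fun _ : ι => gaussianReal 0 v) =
      ENNReal.ofReal √(1 / (1 - 2 * s * v)) ^ Fintype.card ι := by
  simp_rw [sqNorm, Finset.mul_sum, Real.exp_sum,
    ENNReal.ofReal_prod_of_nonneg fun _ _ => Real.exp_nonneg _]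
  rw [lintegral_pi_prod _ (f := fun _ x => ENNReal.ofReal (Real.exp (s * x ^ 2)))
    fun _ => by fun_prop]
  simp [lintegral_gaussianReal_exp_mul_sq hv hs]

theorem pi_gaussianReal_le_chernoff (hv : v ≠ 0) (hs : 2 * s * v < 1) {S : Set (ι → ℝ)}
    (hS : ∀ e ∈ S, s * (l * Fintype.card ι * v) ≤ s * sqNorm e) :
    Measure.pi (fun _ : ι => gaussianReal 0 v) S ≤
      ENNReal.ofReal (Real.exp (-(s * l * v)) * √(1 / (1 - 2 * s * v))) ^ Fintype.card ι := by
  refine (meas_le_lintegral₀ (f := fun e => ENNReal.ofReal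
    (Real.exp (-(s * (l * Fintype.card ι * v)))) * ENNReal.ofReal (Real.exp (s * sqNorm e)))
    (by fun_prop) fun e he => ?_).trans_eq ?_
  · rw [← ENNReal.ofReal_mul (Real.exp_nonneg _), ← Real.exp_add, ENNReal.one_le_ofReal,
      Real.one_le_exp_iff]
    linarith [hS e he]
  · rw [lintegral_const_mul' _ _ ENNReal.ofReal_ne_top,
      lintegral_pi_gaussianReal_exp_mul_sqNorm hv hs, ENNReal.ofReal_mul (Real.exp_nonneg _),
      mul_pow, ← ENNReal.ofReal_pow (Real.exp_nonneg _), ← Real.exp_nat_mul]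
    congr 3
    ring

theorem exists_pi_gaussianReal_sqNorm_lt_le (hl0 : 0 < l) (hl1 : l < 1) :
    ∃ q : ℝ, 0 ≤ q ∧ q < 1 ∧ ∀ (n : ℕ) (v : ℝ≥0), v ≠ 0 →
      Measure.pi (fun _ : Fin n => gaussianReal 0 v) {e | sqNorm e < l * n * v} ≤
        ENNReal.ofReal q ^ n := by
  refine ⟨Real.exp ((1 - l) * l / 2) * √(1 / (2 - l)), by positivity, ?_, fun n v hv => ?_⟩
  · have hexp : Real.exp ((1 - l) * l) ≤ 1 / (1 - (1 - l) * l) := by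
      have hpos : 0 < 1 - (1 - l) * l := by nlinarith [sq_nonneg (l - 1 / 2)]
      rw [le_one_div (Real.exp_pos _) hpos, one_div, ← Real.exp_neg]
      exact Real.one_sub_le_exp_neg _
    rw [Real.exp_half, ← Real.sqrt_mul (Real.exp_nonneg _), Real.sqrt_lt' one_pos, one_pow,
      mul_one_div, div_lt_one (by linarith)]
    refine hexp.trans_lt ((div_lt_iff₀ (by nlinarith [sq_nonneg (l - 1 / 2)])).2 ?_)
    nlinarith [mul_pos (mul_pos (sub_pos.2 hl1) (sub_pos.2 hl1)) (sub_pos.2 hl1)]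
  · have : (0 : ℝ) < v := NNReal.coe_pos.2 (pos_iff_ne_zero.2 hv)
    have hsv : 2 * (-(1 - l) / (2 * v)) * v = -(1 - l) := by field_simp
    have hslv : -(-(1 - l) / (2 * v) * l * v) = (1 - l) * l / 2 := by field_simp
    refine (pi_gaussianReal_le_chernoff hv (s := -(1 - l) / (2 * v)) (l := l)
      (by rw [hsv]; linarith) fun e he => mul_le_mul_of_nonpos_left ?_
        (div_nonpos_of_nonpos_of_nonneg (by linarith) (by positivity))).trans_eq ?_
    · rw [Fintype.card_fin]
      exact le_of_lt he
    · rw [hsv, hslv, Fintype.card_fin, show 1 - -(1 - l) = 2 - l by ring]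

theorem exists_pi_gaussianReal_lt_sqNorm_le :
    ∃ q : ℝ, 0 ≤ q ∧ q < 1 ∧ ∀ (n : ℕ) (v : ℝ≥0), v ≠ 0 →
      Measure.pi (fun _ : Fin n => gaussianReal 0 v) {e | 4 * n * v < sqNorm e} ≤
        ENNReal.ofReal q ^ n := by
  refine ⟨Real.exp (-1) * √2, by positivity, ?_, fun n v hv => ?_⟩
  · have hsqrt : √2 < 2 := by rw [Real.sqrt_lt' (by norm_num)]; norm_num
    rw [Real.exp_neg, inv_mul_lt_iff₀ (Real.exp_pos _), mul_one]
    linarith [Real.add_one_le_exp (1 : ℝ)]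
  · have : (0 : ℝ) < v := NNReal.coe_pos.2 (pos_iff_ne_zero.2 hv)
    have hsv : 2 * (1 / (4 * v)) * (v : ℝ) = 1 / 2 := by field_simp; norm_num
    have hslv : -(1 / (4 * v) * 4 * v) = (-1 : ℝ) := by field_simp
    refine (pi_gaussianReal_le_chernoff hv (s := 1 / (4 * v)) (l := 4)
      (by rw [hsv]; norm_num) fun e he => mul_le_mul_of_nonneg_left ?_ (by positivity)).trans_eq ?_
    · rw [Fintype.card_fin]
      exact le_of_lt he
    · rw [hsv, hslv, Fintype.card_fin, show 1 / (1 - 1 / 2) = (2 : ℝ) by norm_num]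

end GaussianNoise

section FitStatistic

variable {n p : ℕ} {a b : ℝ} {γ : Finset (Fin p)} {X : Matrix (Fin n) (Fin p) ℝ}

/-- A mixture over `δ` supported on `γ` of exponentials of the gain `a ⟨e, X δ⟩ - ‖X δ‖²/2` from
fitting the noise `e` by `X δ`, normalised so that under `IsConditioned b X` it dominates each of
them while its expectation under Gaussian noise is at most exponential in `|γ|`. -/
noncomputable def fitStat {n p : ℕ} (a b : ℝ) (γ : Finset (Fin p)) (X : Matrix (Fin n) (Fin p) ℝ)
    (e : Fin n → ℝ) : ℝ≥0∞ :=
  ENNReal.ofReal √(n * b / (2 * Real.pi)) ^ γ.card *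
    ∫⁻ δ, ENNReal.ofReal (Real.exp (a * (e ⬝ᵥ X.mulVec δ) - sqNorm (X.mulVec δ) / 2))
      ∂spikeSlab γ volume

theorem measurable_fitStat (a b : ℝ) (γ : Finset (Fin p)) :
    Measurable fun z : (Fin n → Fin p → ℝ) × (Fin n → ℝ) => fitStat a b γ (Matrix.of z.1) z.2 := by
  refine Measurable.const_mul (Measurable.lintegral_prod_right'
    (f := fun q : ((Fin n → Fin p → ℝ) × (Fin n → ℝ)) × (Fin p → ℝ) =>
      ENNReal.ofReal (Real.exp (a * (q.1.2 ⬝ᵥ (Matrix.of q.1.1).mulVec q.2) -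
        sqNorm ((Matrix.of q.1.1).mulVec q.2) / 2))) ?_) _
  simp only [sqNorm, dotProduct, Matrix.mulVec, Matrix.of_apply]
  fun_prop

theorem ofReal_exp_le_fitStat (hn : 0 < n) (hb : 0 < b) (hX : IsConditioned b X) (a : ℝ)
    (e : Fin n → ℝ) {δ₀ : Fin p → ℝ} (hδ₀ : ∀ j ∉ γ, δ₀ j = 0) :
    ENNReal.ofReal (Real.exp (a * (e ⬝ᵥ X.mulVec δ₀) - sqNorm (X.mulVec δ₀) / 2)) ≤
      fitStat a b γ X e := by
  have : (0 : ℝ) < n := Nat.cast_pos.2 hn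
  set gain : (Fin p → ℝ) → ℝ := fun δ => a * (e ⬝ᵥ X.mulVec δ) - sqNorm (X.mulVec δ) / 2
  have hgain (δ : Fin p → ℝ) : 2 * (gain δ₀ - n * b / 2 * sqNorm δ) ≤
      gain (δ + δ₀) + gain (-δ + δ₀) := by
    simp only [gain, Matrix.mulVec_add, Matrix.mulVec_neg, dotProduct_add, dotProduct_neg,
      neg_dotProduct, sqNorm_add, sqNorm_neg]
    linarith [(hX δ).2]
  have hcancel : √(n * b / (2 * Real.pi)) * √(Real.pi / (n * b / 2)) = 1 := by
    rw [← Real.sqrt_mul (by positivity), Real.sqrt_eq_one]; field_simp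
  calc ENNReal.ofReal (Real.exp (gain δ₀))
      = ENNReal.ofReal √(n * b / (2 * Real.pi)) ^ γ.card *
          ∫⁻ δ, ENNReal.ofReal (Real.exp (gain δ₀ - n * b / 2 * sqNorm δ)) ∂spikeSlab γ volume := by
        simp_rw [sub_eq_add_neg (gain δ₀), Real.exp_add, ENNReal.ofReal_mul (Real.exp_nonneg _),
          ← neg_mul]
        rw [lintegral_const_mul _ (by fun_prop),
          lintegral_spikeSlab_exp_neg_mul_sqNorm γ (by positivity), mul_left_comm, ← mul_pow,
          ← ENNReal.ofReal_mul (by positivity), hcancel, ENNReal.ofReal_one, one_pow, mul_one]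
    _ ≤ ENNReal.ofReal √(n * b / (2 * Real.pi)) ^ γ.card *
          ∫⁻ δ, ENNReal.ofReal (Real.exp (gain (δ + δ₀))) ∂spikeSlab γ volume := by
        gcongr _ * ?_
        exact lintegral_exp_le_of_add_neg _ (by fun_prop) (by fun_prop) hgain
    _ = fitStat a b γ X e := by
        rw [lintegral_spikeSlab_add volume hδ₀ fun δ => ENNReal.ofReal (Real.exp (gain δ)), fitStat]

theorem one_le_fitStat (hn : 0 < n) (hb : 0 < b) (hX : IsConditioned b X) (a : ℝ)
    (e : Fin n → ℝ) : 1 ≤ fitStat a b γ X e := by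
  simpa [sqNorm] using ofReal_exp_le_fitStat hn hb hX a e (δ₀ := 0) fun _ _ => rfl

theorem lintegral_fitStat_le {η : ℝ} {v : ℝ≥0} (hn : 0 < n) (hb : 0 < b) (hη : 0 < η)
    (hav : a ^ 2 * v = 1 - η) (γ : Finset (Fin p)) (hX : IsConditioned b X) :
    ∫⁻ e, fitStat a b γ X e ∂Measure.pi (fun _ : Fin n => gaussianReal 0 v) ≤
      ENNReal.ofReal √(b ^ 2 / η) ^ γ.card := by
  have : (0 : ℝ) < n := Nat.cast_pos.2 hn
  have hgain (δ : Fin p → ℝ) :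
      ∫⁻ e, ENNReal.ofReal (Real.exp (a * (e ⬝ᵥ X.mulVec δ) - sqNorm (X.mulVec δ) / 2))
          ∂Measure.pi (fun _ : Fin n => gaussianReal 0 v) ≤
        ENNReal.ofReal (Real.exp (-(η * n / (2 * b)) * sqNorm δ)) := by
    simp_rw [sub_eq_add_neg, Real.exp_add, ENNReal.ofReal_mul (Real.exp_nonneg _)]
    rw [lintegral_mul_const' _ _ ENNReal.ofReal_ne_top, lintegral_pi_gaussianReal_exp_dotProduct,
      ← ENNReal.ofReal_mul (Real.exp_nonneg _), ← Real.exp_add, hav]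
    refine ENNReal.ofReal_le_ofReal (Real.exp_le_exp.2 ?_)
    calc (1 - η) / 2 * sqNorm (X.mulVec δ) + -(sqNorm (X.mulVec δ) / 2)
        = -(η / 2 * sqNorm (X.mulVec δ)) := by ring
      _ ≤ -(η / 2 * (n / b * sqNorm δ)) := by have := (hX δ).1; gcongr
      _ = _ := by ring
  have hmeas : AEMeasurable (Function.uncurry fun (e : Fin n → ℝ) (δ : Fin p → ℝ) =>
      ENNReal.ofReal (Real.exp (a * (e ⬝ᵥ X.mulVec δ) - sqNorm (X.mulVec δ) / 2)))
      ((Measure.pi fun _ : Fin n => gaussianReal 0 v).prod (spikeSlab γ volume)) := by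
    simp only [Function.uncurry_def, sqNorm, dotProduct, Matrix.mulVec]
    fun_prop
  unfold fitStat
  rw [lintegral_const_mul' _ _ (ENNReal.pow_ne_top ENNReal.ofReal_ne_top),
    lintegral_lintegral_swap hmeas]
  refine (mul_le_mul_right (lintegral_mono hgain) _).trans_eq ?_
  rw [lintegral_spikeSlab_exp_neg_mul_sqNorm γ (by positivity), ← mul_pow,
    ← ENNReal.ofReal_mul (by positivity), ← Real.sqrt_mul (by positivity)]
  congr 3
  field_simp

theorem ResidualBound.mono {γ' : Finset (Fin p)} {e : Fin n → ℝ} {A T : ℝ} (hγ : γ ⊆ γ')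
    (hR : ResidualBound γ' X e A T) : ResidualBound γ X e A T :=
  fun δ hδ => hR δ fun j hj => hδ j fun hjγ => hj (hγ hjγ)

theorem sqNorm_sub_le_of_fit_le {ι κ : Type*} [Fintype ι] [Fintype κ] {X : Matrix ι κ ℝ}
    {e : ι → ℝ} {a w l : ℝ} (ha : 0 < a) (hw : 0 < w) {δ : κ → ℝ}
    (h : a * (e ⬝ᵥ X.mulVec ((a * w) • δ)) - sqNorm (X.mulVec ((a * w) • δ)) / 2 ≤ l) :
    sqNorm e - 2 * l / (a ^ 2 * w) + (1 - w) * sqNorm (X.mulVec δ) ≤ sqNorm (e - X.mulVec δ) := by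
  rw [Matrix.mulVec_smul, dotProduct_smul, sqNorm_smul, smul_eq_mul] at h
  have hdot : 2 * (e ⬝ᵥ X.mulVec δ) - w * sqNorm (X.mulVec δ) ≤ 2 * l / (a ^ 2 * w) := by
    rw [le_div_iff₀ (by positivity)]
    nlinarith
  rw [sqNorm_sub]
  linarith

theorem residualBound_of_fitStat_le {e : Fin n → ℝ} {v z l : ℝ} (hn : 0 < n) (hb : 0 < b)
    (hv : 0 < v) (hz : 1 < z) (hX : IsConditioned b X)
    (hfit : fitStat √(1 / (z * v)) b γ X e ≤ ENNReal.ofReal (Real.exp l)) :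
    ResidualBound γ X e ((1 - 1 / z) / (2 * b) * n) (sqNorm e - 2 * z ^ 2 * v * l) := by
  intro δ hδ
  have hz0 : 0 < z := by linarith
  have hz1 : 0 ≤ 1 - 1 / z := sub_nonneg.2 ((div_le_one hz0).2 hz.le)
  set a := √(1 / (z * v))
  have hgain := (ofReal_exp_le_fitStat hn hb hX a e (δ₀ := (a * (1 / z)) • δ)
    fun j hj => by simp [hδ j hj]).trans hfit
  rw [ENNReal.ofReal_le_ofReal_iff (Real.exp_nonneg _), Real.exp_le_exp] at hgain
  have hresidual := sqNorm_sub_le_of_fit_le (Real.sqrt_pos.2 (by positivity)) (by positivity) hgain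
  rw [Real.sq_sqrt (by positivity)] at hresidual
  calc sqNorm e - 2 * z ^ 2 * v * l + 2 * ((1 - 1 / z) / (2 * b) * n) * sqNorm δ
      = sqNorm e - 2 * l / (1 / (z * v) * (1 / z)) + (1 - 1 / z) * (n / b * sqNorm δ) := by
        field_simp
    _ ≤ sqNorm e - 2 * l / (1 / (z * v) * (1 / z)) + (1 - 1 / z) * sqNorm (X.mulVec δ) := by
        have := (hX δ).1
        gcongr
    _ ≤ _ := hresidual

theorem exists_residualBound {e : Fin n → ℝ} {v z l₁ G : ℝ} (hn : 0 < n) (hb : 0 < b)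
    (hv : 0 < v) (hz : 1 < z) (hX : IsConditioned b X)
    (hG : fitStat √(1 / (z * v)) b γ X e ≤ ENNReal.ofReal G)
    (hl₁ : fitStat √(1 / (z * v)) b Finset.univ X e ≤ ENNReal.ofReal (Real.exp l₁)) :
    ∃ l, 0 ≤ l ∧ l ≤ l₁ ∧ Real.exp l ≤ G ∧
      ResidualBound γ X e ((1 - 1 / z) / (2 * b) * n) (sqNorm e - 2 * z ^ 2 * v * l) := by
  have hG1 : 1 ≤ G := ENNReal.one_le_ofReal.1 ((one_le_fitStat hn hb hX _ e).trans hG)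
  have hexp : 1 ≤ Real.exp l₁ := ENNReal.one_le_ofReal.1 ((one_le_fitStat hn hb hX _ e).trans hl₁)
  have hlog : Real.exp (Real.log G) = G := Real.exp_log (by linarith)
  rcases le_total (Real.log G) l₁ with h | h
  · exact ⟨Real.log G, Real.log_nonneg hG1, h, hlog.le,
      residualBound_of_fitStat_le hn hb hv hz hX (hlog.symm ▸ hG)⟩
  · exact ⟨l₁, Real.one_le_exp_iff.1 hexp, le_rfl, (Real.exp_le_exp.2 h).trans_eq hlog,
      (residualBound_of_fitStat_le hn hb hv hz hX hl₁).mono (Finset.subset_univ γ)⟩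

end FitStatistic

section PosteriorOdds

variable {n p : ℕ} {γ γ₀ : Finset (Fin p)} {X : Matrix (Fin n) (Fin p) ℝ} {β₀ : Fin p → ℝ}
  {e : Fin n → ℝ} {g : Measure ℝ≥0} {φ Φ c : ℝ≥0} {ν A D T L Δ B κ κ' : ℝ}

theorem studentKernel_add_le_marginalLikelihood [IsFiniteMeasure g] (hν : 0 < ν) (hD : 0 ≤ D)
    (hβ₀ : ∀ j ∉ γ₀, β₀ j = 0) (hX : ∀ δ, sqNorm (X.mulVec δ) ≤ D * sqNorm δ) (hφ : φ ≠ 0)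
    (hg : g (Set.Icc φ Φ) ≠ 0) (hT : 0 ≤ T) (hL : 0 ≤ L) (hκ : (n + ν) / 2 ≤ κ * (1 + T))
    (hκ' : κ' * (1 + T + L) ≤ (n + ν) / 2) (hΔ : sqNorm e + sqNorm β₀ / φ - T ≤ Δ)
    (hΔ0 : 0 ≤ Δ) :
    studentKernel n ν (T + L) ≤
      ENNReal.ofReal (Real.exp (κ * Δ - κ' * L) *
        (√(1 + Φ * D) ^ γ₀.card / (g (Set.Icc φ Φ)).toReal)) *
      marginalLikelihood ν g X (X.mulVec β₀ + e) γ₀ := by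
  have hT₂ : 0 ≤ sqNorm e + sqNorm β₀ / φ :=
    add_nonneg (sqNorm_nonneg e) (div_nonneg (sqNorm_nonneg β₀) φ.2)
  rw [sub_eq_neg_add, Real.exp_add, ENNReal.ofReal_mul (by positivity),
    ENNReal.ofReal_mul (by positivity)]
  calc studentKernel n ν (T + L)
      ≤ ENNReal.ofReal (Real.exp (-(κ' * L))) * studentKernel n ν T :=
        studentKernel_add_le hν hT hL hκ'
    _ ≤ ENNReal.ofReal (Real.exp (-(κ' * L))) * (ENNReal.ofReal (Real.exp (κ * Δ)) *
          studentKernel n ν (sqNorm e + sqNorm β₀ / φ)) := by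
        gcongr _ * ?_
        exact studentKernel_le_exp_mul_of_sub_le hν hT hT₂ hκ hΔ hΔ0
    _ ≤ ENNReal.ofReal (Real.exp (-(κ' * L))) * (ENNReal.ofReal (Real.exp (κ * Δ)) *
          (ENNReal.ofReal (√(1 + Φ * D) ^ γ₀.card / (g (Set.Icc φ Φ)).toReal) *
            marginalLikelihood ν g X (X.mulVec β₀ + e) γ₀)) := by
        gcongr _ * (_ * ?_)
        exact studentKernel_le_marginalLikelihood g hD hβ₀ hX hφ hg
    _ = _ := by ring

theorem ResidualBound.marginalLikelihood_le_of_notMem [IsProbabilityMeasure g]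
    (hR : ResidualBound Finset.univ X e A T) (hν : 0 < ν) (hA : 0 ≤ A) (hD : 0 ≤ D)
    (hβ₀ : ∀ j ∉ γ₀, β₀ j = 0) (hX : ∀ δ, sqNorm (X.mulVec δ) ≤ D * sqNorm δ) (hφ : φ ≠ 0)
    (hg : g (Set.Icc φ Φ) ≠ 0) {j : Fin p} (hj : j ∉ γ) {ψ : ℝ} (hψ : 0 ≤ ψ)
    (hψj : ψ ≤ |β₀ j|) (hT : 0 ≤ T) (hκ : (n + ν) / 2 ≤ κ * (1 + T))
    (hκ' : κ' * (1 + T + 2 * A * ψ ^ 2) ≤ (n + ν) / 2)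
    (hΔ : sqNorm e + sqNorm β₀ / φ - T ≤ Δ) (hΔ0 : 0 ≤ Δ) :
    marginalLikelihood ν g X (X.mulVec β₀ + e) γ ≤
      ENNReal.ofReal (Real.exp (κ * Δ - κ' * (2 * A * ψ ^ 2)) *
        (√(1 + Φ * D) ^ γ₀.card / (g (Set.Icc φ Φ)).toReal)) *
      marginalLikelihood ν g X (X.mulVec β₀ + e) γ₀ := by
  refine le_trans ?_ (studentKernel_add_le_marginalLikelihood hν hD hβ₀ hX hφ hg hT
    (by positivity) hκ hκ' hΔ hΔ0)
  calc marginalLikelihood ν g X (X.mulVec β₀ + e) γ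
      ≤ ∫⁻ _, studentKernel n ν (T + 2 * A * ψ ^ 2) ∂g :=
        lintegral_mono fun c => hR.scaleMarginal_le_of_notMem hA hj hψ hψj c
    _ = studentKernel n ν (T + 2 * A * ψ ^ 2) := by simp

theorem ResidualBound.scaleMarginal_le_mul_scaleMarginal (hR : ResidualBound γ X e A T)
    (hν : 0 < ν) (hA : 0 < A) (hD : 0 ≤ D) (hγ : γ₀ ⊆ γ) (hβ₀ : ∀ j ∉ γ₀, β₀ j = 0)
    (hX : ∀ δ, sqNorm (X.mulVec δ) ≤ D * sqNorm δ) (hc : c ≠ 0) (hT : 0 ≤ T)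
    (hκ : (n + ν) / 2 ≤ κ * (1 + T)) (hκ0 : 0 ≤ κ)
    (hΔ : sqNorm e + sqNorm β₀ / c - (T + sqNorm β₀ / (c + 1 / A)) ≤ Δ) (hΔ0 : 0 ≤ Δ) :
    scaleMarginal ν X (X.mulVec β₀ + e) γ c ≤
      ENNReal.ofReal (√(1 / (A * c)) ^ γ.card * √(1 + c * D) ^ γ₀.card * Real.exp (κ * Δ)) *
        scaleMarginal ν X (X.mulVec β₀ + e) γ₀ c := by
  have hbias : 0 ≤ sqNorm β₀ / (c + 1 / A) := div_nonneg (sqNorm_nonneg β₀) (by positivity)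
  have hκbias : (n + ν) / 2 ≤ κ * (1 + (T + sqNorm β₀ / (c + 1 / A))) :=
    hκ.trans (by gcongr; linarith)
  rw [ENNReal.ofReal_mul (by positivity), ENNReal.ofReal_mul (by positivity),
    ENNReal.ofReal_pow (by positivity), ENNReal.ofReal_pow (by positivity)]
  calc scaleMarginal ν X (X.mulVec β₀ + e) γ c
      ≤ ENNReal.ofReal √(1 / (A * c)) ^ γ.card *
          studentKernel n ν (T + sqNorm β₀ / (c + 1 / A)) :=
        hR.scaleMarginal_le hA (fun j hj => hβ₀ j fun h => hj (hγ h)) hc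
    _ ≤ ENNReal.ofReal √(1 / (A * c)) ^ γ.card * (ENNReal.ofReal (Real.exp (κ * Δ)) *
          studentKernel n ν (sqNorm e + sqNorm β₀ / c)) := by
        gcongr _ * ?_
        exact studentKernel_le_exp_mul_of_sub_le hν (by positivity)
          (add_nonneg (sqNorm_nonneg e) (div_nonneg (sqNorm_nonneg β₀) c.2)) hκbias hΔ hΔ0
    _ ≤ ENNReal.ofReal √(1 / (A * c)) ^ γ.card * (ENNReal.ofReal (Real.exp (κ * Δ)) *
          (ENNReal.ofReal √(1 + c * D) ^ γ₀.card *
            scaleMarginal ν X (X.mulVec β₀ + e) γ₀ c)) := by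
        gcongr _ * (_ * ?_)
        exact studentKernel_le_scaleMarginal hD hβ₀ hX hc
    _ = _ := by ring

theorem ResidualBound.scaleMarginal_le_mul_marginalLikelihood [IsFiniteMeasure g]
    (hR : ResidualBound γ X e A T) (hν : 0 < ν) (hA : 0 < A) (hD : 0 ≤ D) (hγ : γ₀ ⊆ γ)
    (hβ₀ : ∀ j ∉ γ₀, β₀ j = 0) (hX : ∀ δ, sqNorm (X.mulVec δ) ≤ D * sqNorm δ) (hφ : φ ≠ 0)
    (hg : g (Set.Icc φ Φ) ≠ 0) (hT : 0 ≤ T) (hL : 0 ≤ L) (hκ : (n + ν) / 2 ≤ κ * (1 + T))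
    (hκ' : κ' * (1 + T + L) ≤ (n + ν) / 2) (hΔ : sqNorm e + sqNorm β₀ / φ - T ≤ Δ)
    (hΔ0 : 0 ≤ Δ) (hLc : L ≤ sqNorm β₀ / (2 * c + 1 / A)) :
    scaleMarginal ν X (X.mulVec β₀ + e) γ c ≤
      ENNReal.ofReal (√2 ^ γ.card * (Real.exp (κ * Δ - κ' * L) *
        (√(1 + Φ * D) ^ γ₀.card / (g (Set.Icc φ Φ)).toReal))) *
      marginalLikelihood ν g X (X.mulVec β₀ + e) γ₀ := by
  rw [ENNReal.ofReal_mul (by positivity), ENNReal.ofReal_pow (by positivity), mul_assoc]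
  calc scaleMarginal ν X (X.mulVec β₀ + e) γ c
      ≤ ENNReal.ofReal √2 ^ γ.card * studentKernel n ν (T + sqNorm β₀ / (2 * c + 1 / A)) :=
        hR.scaleMarginal_le_sqrt_two hA (fun j hj => hβ₀ j fun h => hj (hγ h)) c
    _ ≤ ENNReal.ofReal √2 ^ γ.card * studentKernel n ν (T + L) := by
        gcongr _ * ?_
        exact studentKernel_anti n ν (by linarith)
    _ ≤ _ := by
        gcongr _ * ?_
        exact studentKernel_add_le_marginalLikelihood hν hD hβ₀ hX hφ hg hT hL hκ hκ' hΔ hΔ0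

/-- The prior scale `c` is usable for comparing `γ` with the true model: either shrinking `β₀` with
slab variance `c` costs so little that the Occam factor of `γ` over `γ₀` is at most `W`, or it
costs at least `L`. Here `A` and `D` bound the curvature of the likelihood from below and above. -/
def ScaleDichotomy {p : ℕ} (γ γ₀ : Finset (Fin p)) (β₀ : Fin p → ℝ) (A D W L : ℝ) (c : ℝ≥0) :
    Prop :=
  (c ≠ 0 ∧ sqNorm β₀ / c - sqNorm β₀ / (c + 1 / A) ≤ 1 ∧
    √(1 / (A * c)) ^ γ.card * √(1 + c * D) ^ γ₀.card ≤ W) ∨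
  L ≤ sqNorm β₀ / (2 * c + 1 / A)

theorem marginalLikelihood_le_of_ae_scaleMarginal_le [IsProbabilityMeasure g] {y : Fin n → ℝ}
    {K₁ K₂ : ℝ≥0∞} (hK₁ : K₁ ≠ ∞)
    (h : ∀ᵐ c ∂g, scaleMarginal ν X y γ c ≤
      K₁ * scaleMarginal ν X y γ₀ c + K₂ * marginalLikelihood ν g X y γ₀) :
    marginalLikelihood ν g X y γ ≤ (K₁ + K₂) * marginalLikelihood ν g X y γ₀ := by
  rw [marginalLikelihood_eq_lintegral_scaleMarginal]
  refine (lintegral_mono_ae h).trans_eq ?_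
  rw [lintegral_add_right _ measurable_const, lintegral_const_mul' _ _ hK₁, lintegral_const,
    measure_univ, mul_one, ← marginalLikelihood_eq_lintegral_scaleMarginal, add_mul]

theorem ResidualBound.marginalLikelihood_le_of_superset [IsProbabilityMeasure g] {W : ℝ}
    (hR : ResidualBound γ X e A T) (hν : 0 < ν) (hA : 0 < A) (hD : 0 ≤ D) (hγ : γ₀ ⊆ γ)
    (hβ₀ : ∀ j ∉ γ₀, β₀ j = 0) (hX : ∀ δ, sqNorm (X.mulVec δ) ≤ D * sqNorm δ) (hφ : φ ≠ 0)
    (hg : g (Set.Icc φ Φ) ≠ 0) (hT : 0 ≤ T) (hL : 0 ≤ L) (hκ : (n + ν) / 2 ≤ κ * (1 + T))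
    (hκ0 : 0 ≤ κ) (hκ' : κ' * (1 + T + L) ≤ (n + ν) / 2) (hΔ : sqNorm e - T ≤ Δ) (hΔ0 : 0 ≤ Δ)
    (hB : sqNorm β₀ / φ ≤ B) (hW : 0 ≤ W)
    (hc : ∀ᵐ c ∂g, ScaleDichotomy γ γ₀ β₀ A D W L c) :
    marginalLikelihood ν g X (X.mulVec β₀ + e) γ ≤
      ENNReal.ofReal ((W * Real.exp κ + √2 ^ γ.card * (Real.exp (κ * B - κ' * L) *
        (√(1 + Φ * D) ^ γ₀.card / (g (Set.Icc φ Φ)).toReal))) * Real.exp (κ * Δ)) *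
      marginalLikelihood ν g X (X.mulVec β₀ + e) γ₀ := by
  have hB0 : 0 ≤ B := (div_nonneg (sqNorm_nonneg β₀) φ.2).trans hB
  rw [add_mul, ENNReal.ofReal_add (by positivity) (by positivity)]
  refine marginalLikelihood_le_of_ae_scaleMarginal_le ENNReal.ofReal_ne_top ?_
  filter_upwards [hc] with c hc
  rcases hc with ⟨hc0, hbias, hoccam⟩ | hLc
  · refine (hR.scaleMarginal_le_mul_scaleMarginal hν hA hD hγ hβ₀ hX hc0 hT hκ hκ0
      (Δ := Δ + 1) (by linarith) (by linarith)).trans (le_trans ?_ le_self_add)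
    rw [mul_add, mul_one, Real.exp_add, mul_comm (Real.exp (κ * Δ)), ← mul_assoc]
    gcongr ENNReal.ofReal (?_ * _ * _) * _
  · refine (hR.scaleMarginal_le_mul_marginalLikelihood hν hA hD hγ hβ₀ hX hφ hg hT hL hκ hκ'
      (Δ := Δ + B) (by linarith) (by linarith) hLc).trans (le_trans (le_of_eq ?_) le_add_self)
    rw [mul_add, add_sub_assoc, Real.exp_add]
    ring_nf

end PosteriorOdds

section Rates

variable {p : ℕ → ℕ} {r α β C : ℝ}

theorem eventually_le_mul_of_isLittleO {f g : ℕ → ℝ} (h : f =o[atTop] g) (hg : ∀ n, 0 ≤ g n)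
    (hC : 0 < C) : ∀ᶠ n in atTop, f n ≤ C * g n := by
  filter_upwards [h.def hC] with n hn
  rw [Real.norm_of_nonneg (hg n)] at hn
  exact (le_abs_self _).trans hn

theorem eventually_one_le_log_natCast : ∀ᶠ n : ℕ in atTop, 1 ≤ Real.log n :=
  (Real.tendsto_log_atTop.comp tendsto_natCast_atTop_atTop).eventually_ge_atTop 1

theorem isLittleO_rpow_mul_log (h : α < β) :
    (fun n : ℕ => (n : ℝ) ^ α * Real.log n) =o[atTop] fun n : ℕ => (n : ℝ) ^ β := by
  have hlog := (isLittleO_log_rpow_atTop (sub_pos.2 h)).comp_tendsto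
    (tendsto_natCast_atTop_atTop (R := ℝ))
  refine ((isBigO_refl (fun n : ℕ => (n : ℝ) ^ α) atTop).mul_isLittleO hlog).congr' .rfl ?_
  filter_upwards [eventually_gt_atTop 0] with n hn
  rw [Function.comp_apply, ← Real.rpow_add (Nat.cast_pos.2 hn), add_sub_cancel]

theorem isLittleO_rpow_rpow_natCast (h : α < β) :
    (fun n : ℕ => (n : ℝ) ^ α) =o[atTop] fun n : ℕ => (n : ℝ) ^ β := by
  refine (IsBigO.of_bound 1 ?_).trans_isLittleO (isLittleO_rpow_mul_log h)
  filter_upwards [eventually_one_le_log_natCast] with n hn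
  rw [one_mul, norm_mul]
  exact le_mul_of_one_le_right (norm_nonneg _) (hn.trans (le_abs_self _))

theorem isLittleO_log_natCast_sqrt :
    (fun n : ℕ => Real.log n) =o[atTop] fun n : ℕ => √n := by
  simp only [Real.sqrt_eq_rpow]
  exact (isLittleO_log_rpow_atTop one_half_pos).comp_tendsto tendsto_natCast_atTop_atTop

theorem isLittleO_sqrt_natCast : (fun n : ℕ => √n) =o[atTop] fun n : ℕ => (n : ℝ) := by
  simpa only [← Real.sqrt_eq_rpow, Real.rpow_one] using
    isLittleO_rpow_rpow_natCast (α := 1 / 2) (β := 1) (by norm_num)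

theorem isLittleO_sqrt_mul_log_natCast :
    (fun n : ℕ => √n * Real.log n) =o[atTop] fun n : ℕ => (n : ℝ) := by
  simpa only [← Real.sqrt_eq_rpow, Real.rpow_one] using
    isLittleO_rpow_mul_log (α := 1 / 2) (β := 1) (by norm_num)

theorem isBigO_natCast_add_one (hr : 0 ≤ r)
    (hp : (fun n => (p n : ℝ)) =O[atTop] fun n : ℕ => (n : ℝ) ^ r) :
    (fun n => (p n : ℝ) + 1) =O[atTop] fun n : ℕ => (n : ℝ) ^ r := by
  refine hp.add (IsBigO.of_bound 1 ?_)
  filter_upwards [eventually_ge_atTop 1] with n hn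
  rw [norm_one, one_mul, Real.norm_of_nonneg (by positivity)]
  exact Real.one_le_rpow (Nat.one_le_cast.2 hn) hr

theorem isLittleO_natCast_add_one_mul_log (hr0 : 0 ≤ r) (hr : r < 1)
    (hp : (fun n => (p n : ℝ)) =O[atTop] fun n : ℕ => (n : ℝ) ^ r) :
    (fun n => ((p n : ℝ) + 1) * Real.log n) =o[atTop] fun n : ℕ => (n : ℝ) := by
  simpa only [Real.rpow_one] using
    ((isBigO_natCast_add_one hr0 hp).mul (isBigO_refl _ _)).trans_isLittleO
      (isLittleO_rpow_mul_log hr)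

theorem isLittleO_natCast_add_one_sq_mul_log (hr0 : 0 ≤ r) (hr : r < 1 / 4)
    (hp : (fun n => (p n : ℝ)) =O[atTop] fun n : ℕ => (n : ℝ) ^ r) :
    (fun n => ((p n : ℝ) + 1) ^ 2 * Real.log n) =o[atTop] fun n : ℕ => √n := by
  have hsq : (fun n => ((p n : ℝ) + 1) ^ 2) =O[atTop] fun n : ℕ => (n : ℝ) ^ (r * 2) := by
    simpa only [Real.rpow_mul_natCast, Nat.cast_nonneg, Nat.cast_ofNat] using
      ((isBigO_natCast_add_one hr0 hp).pow 2).congr_right fun n =>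
        (Real.rpow_mul_natCast (Nat.cast_nonneg n) r 2).symm
  simpa only [Real.sqrt_eq_rpow] using (hsq.mul (isBigO_refl _ _)).trans_isLittleO
    (isLittleO_rpow_mul_log (by linarith))

theorem isLittleO_natCast_sqrt (hr : r < 1 / 2)
    (hp : (fun n => (p n : ℝ)) =O[atTop] fun n : ℕ => (n : ℝ) ^ r) :
    (fun n => (p n : ℝ)) =o[atTop] fun n : ℕ => √n := by
  simp only [Real.sqrt_eq_rpow]
  exact hp.trans_isLittleO (isLittleO_rpow_rpow_natCast hr)

theorem rpow_neg_one_div_four_sq (n : ℕ) : ((n : ℝ) ^ (-(1 / 4) : ℝ)) ^ 2 = 1 / √n := by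
  rw [← Real.rpow_mul_natCast (Nat.cast_nonneg n),
    show -(1 / 4 : ℝ) * (2 : ℕ) = -(1 / 2) by norm_num, Real.rpow_neg (Nat.cast_nonneg n),
    ← Real.sqrt_eq_rpow, one_div]

theorem sq_mul_rpow_mul_sqrt_log (a : ℝ) (n : ℕ) :
    (a * ((n : ℝ) ^ (-(1 / 4) : ℝ) * √(Real.log n))) ^ 2 = a ^ 2 * Real.log n / √n := by
  rw [mul_pow, mul_pow, Real.sq_sqrt (Real.log_natCast_nonneg n), rpow_neg_one_div_four_sq]
  ring

end Rates

section Regimes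

/-- The coefficient vector `β₀` of a regression with `n` observations has at most `K` nonzero
entries, squared norm at most `B`, and nonzero entries above the detection threshold
`a * n ^ (-1 / 4) * √(log n)`. -/
structure IsSparseSignal {p : ℕ} (n K : ℕ) (B a : ℝ) (β₀ : Fin p → ℝ) : Prop where
  card_le : (trueModel β₀).card ≤ K
  sqNorm_le : sqNorm β₀ ≤ B
  le_abs : ∀ j ∈ trueModel β₀, a * ((n : ℝ) ^ (-(1 / 4) : ℝ) * √(Real.log n)) ≤ |β₀ j|

variable {p : ℕ} {γ γ₀ : Finset (Fin p)} {β₀ : Fin p → ℝ} {a b d t L : ℝ} {c : ℝ≥0}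

theorem sqrt_pow_mul_sqrt_pow_le {N c : ℝ} {k m K : ℕ} (ha : 0 < a) (hb : 0 ≤ b) (hd : 0 < d)
    (ht : 0 < t) (hcN : 1 ≤ c * N) (hct : d ≤ t ^ 2 * (c * N)) (hk : k ≤ K) :
    √(1 / (a * N * c)) ^ (k + m) * √(1 + c * (N * b)) ^ k ≤
      (1 + √((1 + b) / a)) ^ K * (√(1 / (a * d)) * t) ^ m := by
  have : 0 < c * N := by linarith
  have hprod : √(1 / (a * N * c)) * √(1 + c * (N * b)) ≤ 1 + √((1 + b) / a) := by
    rw [← Real.sqrt_mul (by rw [mul_assoc, mul_comm N]; positivity)]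
    refine (Real.sqrt_le_sqrt ?_).trans (le_add_of_nonneg_left zero_le_one)
    rw [one_div_mul_eq_div, mul_assoc, mul_comm N c, div_le_div_iff₀ (by positivity) ha]
    nlinarith
  have hone : √(1 / (a * N * c)) ≤ √(1 / (a * d)) * t := by
    rw [← Real.sqrt_sq ht.le, ← Real.sqrt_mul (by positivity)]
    refine Real.sqrt_le_sqrt ?_
    rw [one_div_mul_eq_div, mul_assoc, mul_comm N c,
      div_le_div_iff₀ (by positivity) (by positivity)]
    nlinarith
  calc √(1 / (a * N * c)) ^ (k + m) * √(1 + c * (N * b)) ^ k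
      = (√(1 / (a * N * c)) * √(1 + c * (N * b))) ^ k * √(1 / (a * N * c)) ^ m := by ring
    _ ≤ (1 + √((1 + b) / a)) ^ k * (√(1 / (a * d)) * t) ^ m := by gcongr
    _ ≤ (1 + √((1 + b) / a)) ^ K * (√(1 / (a * d)) * t) ^ m := by
        gcongr
        exact le_add_of_nonneg_right (Real.sqrt_nonneg _)

theorem div_sub_div_add_one_div_le {S A c : ℝ} (hS : 0 ≤ S) (hA : 0 < A) (hc : 0 < c) :
    S / c - S / (c + 1 / A) ≤ S / (A * c ^ 2) := by
  have hdiff : S / c - S / (c + 1 / A) = S / (A * c ^ 2 + c) := by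
    field_simp
    ring
  rw [hdiff]
  exact div_le_div_of_nonneg_left hS (by positivity) (by linarith)

theorem scaleDichotomy_of_sqNorm_le {n K : ℕ} (ha : 0 < a) (hb : 0 ≤ b) (hd : 0 < d) (ht : 0 < t)
    (hγ : γ₀ ⊆ γ) (hk : γ₀.card ≤ K) (hcn : 1 ≤ c * (n : ℝ)) (hct : d ≤ t ^ 2 * (c * n))
    (hbias : sqNorm β₀ ≤ a * n * c ^ 2) :
    ScaleDichotomy γ γ₀ β₀ (a * n) (n * b)
      ((1 + √((1 + b) / a)) ^ K * (√(1 / (a * d)) * t) ^ (γ \ γ₀).card) L c := by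
  have hcn0 : 0 < c * (n : ℝ) := by linarith
  have hc : (0 : ℝ) < c := pos_of_mul_pos_left hcn0 (Nat.cast_nonneg n)
  have hn : (0 : ℝ) < n := pos_of_mul_pos_right hcn0 c.2
  refine Or.inl ⟨(NNReal.coe_pos.1 hc).ne', ?_, ?_⟩
  · exact (div_sub_div_add_one_div_le (sqNorm_nonneg β₀) (by positivity) hc).trans
      ((div_le_one (by positivity)).2 hbias)
  · rw [← Finset.card_sdiff_add_card_eq_card hγ, add_comm]
    exact sqrt_pow_mul_sqrt_pow_le ha hb hd ht hcn hct hk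

theorem lt_four_mul_of_div_lt {S c A E : ℝ} (hA : 0 < A) (hc : 0 ≤ c) (hE : 2 * E ≤ A * S)
    (h : S / (2 * c + 1 / A) < E) : S < 4 * c * E := by
  rw [div_lt_iff₀ (by positivity), mul_add, mul_one_div] at h
  have hEA : E / A ≤ S / 2 := by
    rw [div_le_iff₀ hA]
    linarith
  linarith

theorem le_mul_sq_of_lt_four_mul {S A c E d : ℝ} (hd : 0 < d) (hS : d ≤ S) (hSc : S < 4 * c * E)
    (hE : 16 * E ^ 2 ≤ d * A) : S ≤ A * c ^ 2 := by
  have hS0 : 0 < S := hd.trans_le hS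
  refine le_of_mul_le_mul_left ?_ hd
  calc d * S ≤ S * S := by gcongr
    _ ≤ (4 * c * E) * (4 * c * E) := mul_self_le_mul_self hS0.le hSc.le
    _ = 16 * E ^ 2 * c ^ 2 := by ring
    _ ≤ d * A * c ^ 2 := by gcongr
    _ = d * (A * c ^ 2) := by ring

theorem two_mul_le_mul_of_le_sqrt {x s A M t S : ℝ} (ha : 0 ≤ a) (hx : 0 ≤ x) (ht : 0 ≤ t)
    (hM : 2 * A * M ≤ a * s * √x) (hS : s * t ≤ S * √x) : 2 * (A * (M * t)) ≤ a * x * S :=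
  calc 2 * (A * (M * t)) = 2 * A * M * t := by ring
    _ ≤ a * s * √x * t := by gcongr
    _ = a * √x * (s * t) := by ring
    _ ≤ a * √x * (S * √x) := by gcongr
    _ = a * (√x * √x) * S := by ring
    _ = a * x * S := by rw [Real.mul_self_sqrt hx]

theorem scaleDichotomy_of_sq_log_le {n m K : ℕ} {s A₄ : ℝ} (ha : 0 < a) (hb : 0 ≤ b) (hs : 0 < s)
    (hA₄ : 0 < A₄) (hlog : 1 ≤ Real.log n) (hS : s * Real.log n / √n ≤ sqNorm β₀)
    (h₁ : ((m : ℝ) + 1) ^ 2 * Real.log n ≤ a * s / (16 * A₄ ^ 2) * √n)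
    (h₂ : ((m : ℝ) + 1) ^ 2 * Real.log n ≤ a * s / (2 * A₄) * √n)
    (h₃ : ((m : ℝ) + 1) ^ 2 * Real.log n ≤ s / (4 * A₄) * √n)
    (hγ : γ₀ ⊆ γ) (hk : γ₀.card ≤ K) (c : ℝ≥0) :
    ScaleDichotomy γ γ₀ β₀ (a * n) (n * b) ((1 + √((1 + b) / a)) ^ K *
      (√(1 / (a * (s / (4 * A₄)))) * (√((m : ℝ) + 1) * (n : ℝ) ^ (-(1 / 4) : ℝ))) ^
        (γ \ γ₀).card) (A₄ * ((m + 1) * Real.log n)) c := by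
  by_cases hL : A₄ * ((m + 1) * Real.log n) ≤ sqNorm β₀ / (2 * c + 1 / (a * n))
  · exact Or.inr hL
  have hn : (0 : ℝ) < n := Nat.cast_pos.2 (Nat.pos_of_ne_zero fun h => by
    simp only [h, Nat.cast_zero, Real.log_zero] at hlog
    linarith)
  have : (1 : ℝ) ≤ m + 1 := le_add_of_nonneg_left (Nat.cast_nonneg m)
  have hq : (0 : ℝ) < √n := Real.sqrt_pos.2 hn
  have hqq : (√n : ℝ) * √n = n := Real.mul_self_sqrt hn.le
  have hMsq : (m : ℝ) + 1 ≤ (m + 1) ^ 2 * Real.log n := by nlinarith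
  have hMA₄ : 2 * A₄ * (m + 1) ≤ a * s * √n := by
    linarith [(le_div_iff₀ (by positivity)).1 (hMsq.trans (h₂.trans_eq (div_mul_eq_mul_div _ _ _)))]
  have hMs : 4 * A₄ * (m + 1) ≤ s * √n := by
    linarith [(le_div_iff₀ (by positivity)).1 (hMsq.trans (h₃.trans_eq (div_mul_eq_mul_div _ _ _)))]
  have hSn := (div_le_iff₀ hq).1 hS
  have hSc : sqNorm β₀ < 4 * c * (A₄ * ((m + 1) * Real.log n)) :=
    lt_four_mul_of_div_lt (by positivity) c.2
      (two_mul_le_mul_of_le_sqrt ha.le hn.le (by positivity) hMA₄ hSn) (not_le.1 hL)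
  have hsc : s < 4 * A₄ * (m + 1) * c * √n := by
    refine lt_of_mul_lt_mul_right (hSn.trans_lt ?_) (zero_le_one.trans hlog)
    linarith [mul_lt_mul_of_pos_right hSc hq]
  have hcn : 1 ≤ c * (n : ℝ) := by
    refine le_of_mul_le_mul_left ?_ (show 0 < 4 * A₄ * ((m : ℝ) + 1) by positivity)
    rw [← hqq]
    nlinarith [mul_lt_mul_of_pos_right hsc hq]
  refine scaleDichotomy_of_sqNorm_le ha hb (by positivity) (by positivity) hγ hk hcn ?_ ?_
  · rw [mul_pow, Real.sq_sqrt (by positivity), rpow_neg_one_div_four_sq,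
      div_le_iff₀ (by positivity)]
    calc s ≤ 4 * A₄ * (m + 1) * c * √n := hsc.le
      _ = (m + 1) * (1 / √n) * (c * (√n * √n)) * (4 * A₄) := by field_simp
      _ = (m + 1) * (1 / √n) * (c * n) * (4 * A₄) := by rw [hqq]
  · refine le_mul_sq_of_lt_four_mul (by positivity) hS hSc ?_
    calc 16 * (A₄ * ((m + 1) * Real.log n)) ^ 2
        = 16 * A₄ ^ 2 * ((m + 1) ^ 2 * Real.log n) * Real.log n := by ring
      _ ≤ 16 * A₄ ^ 2 * (a * s / (16 * A₄ ^ 2) * √n) * Real.log n := by gcongr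
      _ = s * Real.log n / √n * (a * (√n * √n)) := by field_simp
      _ = s * Real.log n / √n * (a * n) := by rw [hqq]

theorem IsSparseSignal.log_div_sqrt_le {n K : ℕ} {B : ℝ} (ha : 0 ≤ a)
    (h : IsSparseSignal n K B a β₀) (hne : (trueModel β₀).Nonempty) :
    a ^ 2 * Real.log n / √n ≤ sqNorm β₀ := by
  obtain ⟨j, hj⟩ := hne
  rw [← sq_mul_rpow_mul_sqrt_log]
  calc _ ≤ |β₀ j| ^ 2 := pow_le_pow_left₀ (by positivity) (h.le_abs j hj) 2
    _ = β₀ j ^ 2 := sq_abs _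
    _ ≤ sqNorm β₀ := sq_apply_le_sqNorm β₀ j

/-- The shrinkage prior `g` penalizes each spurious variable at rate `n ^ (-ρ)`: almost every scale
falls under `ScaleDichotomy`, with an Occam factor of that order and a shrinkage cost that dominates
any prescribed multiple of `(m + 1) * log n` for models with `m` spurious variables. -/
def HasPenaltyRate (g : Measure ℝ≥0) (p : ℕ → ℕ) (β₀ : ∀ n, Fin (p n) → ℝ) (ρ : ℝ) : Prop :=
  ∀ a b A₄ : ℝ, 0 < a → 0 < b → 0 < A₄ → ∃ C₁ C₂ : ℝ, 0 ≤ C₁ ∧ 0 ≤ C₂ ∧ ∀ᶠ n : ℕ in atTop,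
    ∀ᵐ c ∂g, ∀ γ, trueModel (β₀ n) ⊆ γ →
      ScaleDichotomy γ (trueModel (β₀ n)) (β₀ n) (a * n) (n * b)
        (C₁ * (C₂ * (√((γ \ trueModel (β₀ n)).card + 1) * (n : ℝ) ^ (-ρ))) ^
          (γ \ trueModel (β₀ n)).card)
        (A₄ * (((γ \ trueModel (β₀ n)).card + 1) * Real.log n)) c

theorem hasPenaltyRate_one_half {g : Measure ℝ≥0} {p : ℕ → ℕ} {β₀ : ∀ n, Fin (p n) → ℝ} {K : ℕ}
    {B a₀ : ℝ} {φ : ℝ≥0} (hβ₀ : ∀ᶠ n in atTop, IsSparseSignal n K B a₀ (β₀ n)) (hφ : φ ≠ 0)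
    (hg : ∀ᵐ c ∂g, φ ≤ c) : HasPenaltyRate g p β₀ (1 / 2) := by
  intro a b A₄ ha hb _
  have hφ0 : (0 : ℝ) < φ := NNReal.coe_pos.2 (pos_iff_ne_zero.2 hφ)
  refine ⟨(1 + √((1 + b) / a)) ^ K, √(1 / (a * φ)), by positivity, by positivity, ?_⟩
  filter_upwards [hβ₀, eventually_gt_atTop 0,
    tendsto_natCast_atTop_atTop.eventually_ge_atTop (1 / (φ : ℝ)),
    tendsto_natCast_atTop_atTop.eventually_ge_atTop (B / (a * φ ^ 2))] with n hβ₀ hn hnφ hnB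
  have hn' : (0 : ℝ) < n := Nat.cast_pos.2 hn
  filter_upwards [hg] with c hc γ hγ
  have hφc : (φ : ℝ) ≤ c := NNReal.coe_le_coe.2 hc
  refine scaleDichotomy_of_sqNorm_le ha hb.le hφ0 (by positivity) hγ hβ₀.card_le ?_ ?_ ?_
  · rw [div_le_iff₀' hφ0] at hnφ
    exact hnφ.trans (by gcongr)
  · rw [mul_pow, Real.sq_sqrt (by positivity), ← Real.rpow_mul_natCast hn'.le,
      show -(1 / 2 : ℝ) * (2 : ℕ) = -1 by norm_num, Real.rpow_neg_one]
    calc (φ : ℝ) ≤ c := hφc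
      _ ≤ ((γ \ trueModel (β₀ n)).card + 1) * c :=
        le_mul_of_one_le_left c.2 (le_add_of_nonneg_left (Nat.cast_nonneg _))
      _ = _ := by field_simp
  · rw [div_le_iff₀' (by positivity)] at hnB
    calc sqNorm (β₀ n) ≤ a * φ ^ 2 * n := hβ₀.sqNorm_le.trans hnB
      _ ≤ a * c ^ 2 * n := by gcongr
      _ = a * n * c ^ 2 := by ring

theorem hasPenaltyRate_one_quarter (g : Measure ℝ≥0) {p : ℕ → ℕ} {β₀ : ∀ n, Fin (p n) → ℝ}
    {K : ℕ} {B a₀ r : ℝ} (ha₀ : 0 < a₀) (hr0 : 0 ≤ r) (hr : r < 1 / 4)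
    (hp : (fun n => (p n : ℝ)) =O[atTop] fun n : ℕ => (n : ℝ) ^ r)
    (hβ₀ : ∀ᶠ n in atTop, IsSparseSignal n K B a₀ (β₀ n))
    (hne : ∀ᶠ n in atTop, (trueModel (β₀ n)).Nonempty) : HasPenaltyRate g p β₀ (1 / 4) := by
  intro a b A₄ ha hb hA₄
  refine ⟨(1 + √((1 + b) / a)) ^ K, √(1 / (a * (a₀ ^ 2 / (4 * A₄)))), by positivity,
    by positivity, ?_⟩
  have hdom (C : ℝ) (hC : 0 < C) :
      ∀ᶠ n : ℕ in atTop, ((p n : ℝ) + 1) ^ 2 * Real.log n ≤ C * √n :=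
    eventually_le_mul_of_isLittleO (isLittleO_natCast_add_one_sq_mul_log hr0 hr hp)
      (fun n => Real.sqrt_nonneg _) hC
  filter_upwards [hβ₀, hne, eventually_one_le_log_natCast,
    hdom (a * a₀ ^ 2 / (16 * A₄ ^ 2)) (by positivity), hdom (a * a₀ ^ 2 / (2 * A₄)) (by positivity),
    hdom (a₀ ^ 2 / (4 * A₄)) (by positivity)] with n hβ₀ hne hlog h₁ h₂ h₃
  refine ae_of_all _ fun c γ hγ => ?_
  have hm : (((γ \ trueModel (β₀ n)).card : ℝ) + 1) ^ 2 * Real.log n ≤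
      ((p n : ℝ) + 1) ^ 2 * Real.log n := by
    gcongr
    exact card_finset_fin_le _
  exact scaleDichotomy_of_sq_log_le ha hb.le (by positivity) hA₄ hlog
    (hβ₀.log_div_sqrt_le ha₀.le hne) (hm.trans h₁) (hm.trans h₂) (hm.trans h₃) hγ hβ₀.card_le c

end Regimes

section Weights

variable {r s C ε : ℝ}

/-- The weight given to a model with `m` spurious variables when the fit statistics of all such
models are summed. There are at most `p ^ m / m !` of them, so that the factorial leaves a geometric
series in `p * n ^ (-r)`. -/
noncomputable def spuriousWeight (n : ℕ) (r : ℝ) (m : ℕ) : ℝ := ((n : ℝ) ^ (-r)) ^ m * m.factorial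

theorem spuriousWeight_pos {n : ℕ} (hn : 0 < n) (r : ℝ) (m : ℕ) : 0 < spuriousWeight n r m := by
  have : (0 : ℝ) < n := Nat.cast_pos.2 hn
  unfold spuriousWeight
  positivity

theorem one_le_natCast_factorial (m : ℕ) : (1 : ℝ) ≤ m.factorial :=
  Nat.one_le_cast.2 (Nat.factorial_pos m)

theorem exp_neg_mul_log_le_spuriousWeight {n : ℕ} (hn : 0 < n) (hr : r ≤ 1) (m : ℕ) :
    Real.exp (-(m * Real.log n)) ≤ spuriousWeight n r m := by
  have hn' : (0 : ℝ) < n := Nat.cast_pos.2 hn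
  refine le_trans ?_ (le_mul_of_one_le_right (by positivity) (one_le_natCast_factorial m))
  rw [Real.rpow_def_of_pos hn', ← Real.exp_nat_mul, Real.exp_le_exp]
  nlinarith [mul_nonneg (Nat.cast_nonneg (α := ℝ) m)
    (mul_nonneg (Real.log_natCast_nonneg n) (sub_nonneg.2 hr))]

theorem eventually_mul_rpow_neg_le (hr : 0 < r) (C : ℝ) (hε : 0 < ε) :
    ∀ᶠ n : ℕ in atTop, C * (n : ℝ) ^ (-r) ≤ ε := by
  have hlim := ((tendsto_rpow_neg_atTop hr).comp tendsto_natCast_atTop_atTop).const_mul C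
  rw [mul_zero] at hlim
  exact hlim.eventually_le_const hε

theorem sqrt_add_one_pow_le (m : ℕ) : √((m : ℝ) + 1) ^ m ≤ 3 ^ m * m.factorial := by
  have hexp : Real.exp 1 ≤ 3 := (Real.exp_one_lt_d9.trans (by norm_num)).le
  rcases Nat.eq_zero_or_pos m with rfl | hm
  · simp
  have hpow : ((m : ℝ) + 1) ^ m ≤ (3 ^ m) ^ 2 * m.factorial := by
    refine ((div_le_iff₀ (by positivity)).1
      (Real.pow_div_factorial_le_exp (x := (m : ℝ) + 1) (by positivity) m)).trans ?_
    gcongr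
    calc Real.exp (m + 1) ≤ Real.exp ((m * 2 : ℕ) * 1) := by
          refine Real.exp_le_exp.2 ?_
          have : (1 : ℝ) ≤ m := Nat.one_le_cast.2 hm
          push_cast
          linarith
      _ = (Real.exp 1 ^ m) ^ 2 := by rw [Real.exp_nat_mul, pow_mul]
      _ ≤ (3 ^ m) ^ 2 := by gcongr
  refine le_of_sq_le_sq ?_ (by positivity)
  rw [pow_right_comm, Real.sq_sqrt (by positivity), mul_pow]
  exact hpow.trans (by gcongr; exact le_self_pow₀ (one_le_natCast_factorial m) two_ne_zero)

theorem eventually_mul_pow_le_spuriousWeight_rpow {ρ C₁ C₂ : ℝ} (hs : 1 ≤ s) (hr : s * r < ρ)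
    (hC₁ : 0 ≤ C₁) (hC₂ : 0 ≤ C₂) (hε : 0 < ε) :
    ∀ᶠ n : ℕ in atTop, ∀ m : ℕ, m ≠ 0 →
      C₁ * (C₂ * (√((m : ℝ) + 1) * (n : ℝ) ^ (-ρ))) ^ m ≤ ε * spuriousWeight n r m ^ s := by
  have hgap : 0 < ρ - s * r := sub_pos.2 hr
  filter_upwards [eventually_mul_rpow_neg_le hgap (3 * C₂) one_pos,
    eventually_mul_rpow_neg_le hgap (C₁ * (3 * C₂)) hε, eventually_gt_atTop 0]
    with n hone hC hn m hm
  have hn' : (0 : ℝ) < n := Nat.cast_pos.2 hn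
  set w := ((n : ℝ) ^ (-r)) ^ s
  set y := (n : ℝ) ^ (-(ρ - s * r))
  have hyw : (n : ℝ) ^ (-ρ) = y * w := by
    simp only [y, w]
    rw [← Real.rpow_mul hn'.le, ← Real.rpow_add hn']
    congr 1
    ring
  have hweight : spuriousWeight n r m ^ s = w ^ m * (m.factorial : ℝ) ^ s := by
    rw [spuriousWeight, Real.mul_rpow (by positivity) (by positivity),
      ← Real.rpow_pow_comm (by positivity)]
  rw [hweight, hyw]
  calc C₁ * (C₂ * (√((m : ℝ) + 1) * (y * w))) ^ m
      = C₁ * (C₂ * y) ^ m * w ^ m * √((m : ℝ) + 1) ^ m := by ring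
    _ ≤ C₁ * (C₂ * y) ^ m * w ^ m * (3 ^ m * m.factorial) := by
        gcongr
        exact sqrt_add_one_pow_le m
    _ = C₁ * (3 * C₂ * y) ^ m * (w ^ m * m.factorial) := by ring
    _ ≤ C₁ * (3 * C₂ * y) * (w ^ m * m.factorial) := by
        gcongr
        exact pow_le_of_le_one (by positivity) hone hm
    _ ≤ ε * (w ^ m * m.factorial) := by
        rw [← mul_assoc C₁]
        gcongr
    _ ≤ ε * (w ^ m * (m.factorial : ℝ) ^ s) := by
        gcongr
        exact Real.self_le_rpow_of_one_le (one_le_natCast_factorial m) hs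

theorem sqrt_one_add_mul_pow_le {Φ b N : ℝ} {k K : ℕ} (hΦ : 0 ≤ Φ) (hb : 0 ≤ b) (hN : 1 ≤ N)
    (hk : k ≤ K) : √(1 + Φ * (N * b)) ^ k ≤ (1 + Φ * b) ^ K * N ^ K := by
  have hprod : 1 ≤ (1 + Φ * b) * N := by nlinarith [mul_nonneg hΦ hb]
  have hsqrt : √(1 + Φ * (N * b)) ≤ (1 + Φ * b) * N := by
    rw [Real.sqrt_le_left (by linarith)]
    nlinarith
  rw [← mul_pow]
  exact (pow_le_pow_left₀ (by positivity) hsqrt k).trans (pow_le_pow_right₀ hprod hk)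

theorem exp_log_sub_le_mul_spuriousWeight_rpow {n : ℕ} (hs : 0 ≤ s) (hr : r ≤ 1) (hn : 0 < n)
    (K m : ℕ) :
    Real.exp (m * Real.log n + K * Real.log n - (K + s + 1) * ((m + 1) * Real.log n)) ≤
      Real.exp (-Real.log n) * spuriousWeight n r m ^ s := by
  have hKm : 0 ≤ (K * m + s) * Real.log n := by positivity
  calc _ ≤ Real.exp (-Real.log n) * Real.exp (-(m * Real.log n)) ^ s := by
        rw [← Real.exp_mul, ← Real.exp_add, Real.exp_le_exp]
        linarith
    _ ≤ _ := by
        gcongr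
        exact exp_neg_mul_log_le_spuriousWeight hn hr m

theorem eventually_sqrt_two_pow_mul_exp_le_spuriousWeight_rpow {Φ b B q : ℝ} (K : ℕ) (hs : 0 ≤ s)
    (hr : r ≤ 1) (hΦ : 0 ≤ Φ) (hb : 0 ≤ b) (hq : 0 < q) (hε : 0 < ε) :
    ∀ᶠ n : ℕ in atTop, ∀ k ≤ K, ∀ m : ℕ,
      √2 ^ (k + m) * (Real.exp (B - (K + s + 1) * ((m + 1) * Real.log n)) *
        (√(1 + Φ * (n * b)) ^ k / q)) ≤ ε * spuriousWeight n r m ^ s := by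
  set C := √2 ^ K * Real.exp B * (1 + Φ * b) ^ K / q
  have hlim : Tendsto (fun n : ℕ => C * Real.exp (-Real.log n)) atTop (𝓝 (C * 0)) :=
    (Real.tendsto_exp_neg_atTop_nhds_zero.comp
      (Real.tendsto_log_atTop.comp tendsto_natCast_atTop_atTop)).const_mul C
  rw [mul_zero] at hlim
  filter_upwards [eventually_one_le_log_natCast, eventually_gt_atTop 0,
    hlim.eventually_le_const hε] with n hlog hn hC k hk m
  have hn1 : (1 : ℝ) ≤ n := Nat.one_le_cast.2 hn
  have hsqrt : √2 ≤ Real.exp (Real.log n) :=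
    (Real.sqrt_le_left (by positivity)).2 (by nlinarith [Real.add_one_le_exp (Real.log n)])
  have hdiffuse := exp_log_sub_le_mul_spuriousWeight_rpow hs hr hn K m
  calc √2 ^ (k + m) * (Real.exp (B - (K + s + 1) * ((m + 1) * Real.log n)) *
        (√(1 + Φ * (n * b)) ^ k / q))
      ≤ √2 ^ K * Real.exp (Real.log n) ^ m *
          (Real.exp (B - (K + s + 1) * ((m + 1) * Real.log n)) *
            ((1 + Φ * b) ^ K * Real.exp (Real.log n) ^ K / q)) := by
        rw [pow_add, Real.exp_log (by positivity)]
        rw [Real.exp_log (by positivity)] at hsqrt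
        gcongr
        · exact Real.one_le_sqrt.2 one_le_two
        · exact sqrt_one_add_mul_pow_le hΦ hb hn1 hk
    _ = C * Real.exp (m * Real.log n + K * Real.log n -
          (K + s + 1) * ((m + 1) * Real.log n)) := by
        rw [← Real.exp_nat_mul, ← Real.exp_nat_mul, sub_eq_add_neg, Real.exp_add, sub_eq_add_neg,
          Real.exp_add, Real.exp_add]
        ring
    _ ≤ C * (Real.exp (-Real.log n) * spuriousWeight n r m ^ s) := by gcongr
    _ ≤ ε * spuriousWeight n r m ^ s := by
        rw [← mul_assoc]
        have := spuriousWeight_pos hn r m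
        gcongr

end Weights

section Precision

variable {p : ℕ → ℕ} {l₁ f : ℕ → ℝ} {l v z ν C ε : ℝ}

theorem eventually_one_add_le_of_isLittleO (h : f =o[atTop] fun n : ℕ => (n : ℝ)) (hC : 0 < C) :
    ∀ᶠ n : ℕ in atTop, 1 + f n ≤ C * n :=
  eventually_le_mul_of_isLittleO ((isLittleO_const_left.2 <| Or.inr <|
    tendsto_norm_atTop_atTop.comp tendsto_natCast_atTop_atTop).add h)
    (fun n => Nat.cast_nonneg n) hC

theorem eventually_half_add_le_mul_one_add (hz : 1 < z) (hv : 0 < v) (hl : 1 / z < l)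
    (hl₁ : l₁ =o[atTop] fun n : ℕ => (n : ℝ)) :
    ∀ᶠ n : ℕ in atTop, ∀ E : ℝ, l * n * v ≤ E → 2 * z ^ 2 * v * l₁ n ≤ E ∧
      (n + ν) / 2 ≤ z / (2 * v) * (1 + (E - 2 * z ^ 2 * v * l₁ n)) := by
  have hz0 : 0 < z := by linarith
  have hl0 : 0 < l := (by positivity : 0 < 1 / z).trans hl
  have hzl : 0 < z * l - 1 := by
    rw [div_lt_iff₀' hz0] at hl
    linarith
  have hC : 0 < (z * l - 1) / (4 * z ^ 3) := by positivity
  filter_upwards [eventually_le_mul_of_isLittleO hl₁ (fun n => Nat.cast_nonneg n) hC,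
    tendsto_natCast_atTop_atTop.eventually_ge_atTop (2 * ν / (z * l - 1))] with n hn hν E hE
  have hgap : 2 * z ^ 2 * v * l₁ n ≤ (z * l - 1) / (2 * z) * n * v := by
    calc 2 * z ^ 2 * v * l₁ n ≤ 2 * z ^ 2 * v * ((z * l - 1) / (4 * z ^ 3) * n) := by gcongr
      _ = (z * l - 1) / (2 * z) * n * v := by
        field_simp
        ring
  have hT : (z * l + 1) / (2 * z) * n * v ≤ E - 2 * z ^ 2 * v * l₁ n := by
    have hsplit : l * n * v = (z * l + 1) / (2 * z) * n * v + (z * l - 1) / (2 * z) * n * v := by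
      field_simp
      ring
    linarith
  refine ⟨sub_nonneg.1 (le_trans (by positivity) hT), ?_⟩
  rw [div_le_iff₀ hzl] at hν
  calc (n + ν) / 2 ≤ z / (2 * v) * ((z * l + 1) / (2 * z) * n * v) := by
        have hsimp : z / (2 * v) * ((z * l + 1) / (2 * z) * n * v) = (z * l + 1) * n / 4 := by
          field_simp
          ring
        linarith
    _ ≤ z / (2 * v) * (1 + (E - 2 * z ^ 2 * v * l₁ n)) := by
        gcongr
        linarith

theorem one_div_mul_one_add_le_half {n : ℕ} {E L : ℝ} (hν : 0 ≤ ν) (hv : 0 < v)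
    (hE : E ≤ 4 * n * v) (hL : 1 + L ≤ 4 * v * n) :
    1 / (16 * v) * (1 + E + L) ≤ (n + ν) / 2 := by
  rw [one_div_mul_eq_div, div_le_iff₀ (by positivity)]
  nlinarith [mul_nonneg hν hv.le]

theorem eventually_two_pow_mul_exp_le {Φ b q C₁ C₂ C₃ : ℝ} (K : ℕ) (hΦ : 0 ≤ Φ) (hb : 0 ≤ b)
    (hq : 0 < q) (hC₃ : 0 < C₃) (hp : (fun n => (p n : ℝ)) =o[atTop] fun n : ℕ => √n)
    (hl₁ : l₁ =o[atTop] fun n : ℕ => √n) (hε : 0 < ε) :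
    ∀ᶠ n : ℕ in atTop, ∀ k ≤ K,
      2 ^ p n * (Real.exp (C₁ * l₁ n + C₂ - C₃ * (√n * Real.log n)) *
        (√(1 + Φ * (n * b)) ^ k / q)) ≤ ε := by
  set C₀ := C₂ + Real.log ((1 + Φ * b) ^ K / q) - Real.log ε
  have hconst : (fun _ : ℕ => C₀) =o[atTop] fun n : ℕ => √n :=
    isLittleO_const_left.2 <| Or.inr <| tendsto_norm_atTop_atTop.comp <|
      Real.tendsto_sqrt_atTop.comp tendsto_natCast_atTop_atTop
  have hexponent :=
    ((hp.add (isLittleO_log_natCast_sqrt.const_mul_left K)).add (hl₁.const_mul_left C₁)).add hconst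
  filter_upwards [eventually_le_mul_of_isLittleO hexponent (fun n => Real.sqrt_nonneg _) hC₃,
    eventually_one_le_log_natCast, eventually_gt_atTop 0] with n hexp hlog hn k hk
  have hn' : (0 : ℝ) < n := Nat.cast_pos.2 hn
  have hle : (p n : ℝ) + K * Real.log n + C₁ * l₁ n + C₀ ≤ C₃ * (√n * Real.log n) :=
    hexp.trans (by gcongr; exact le_mul_of_one_le_right (Real.sqrt_nonneg _) hlog)
  have htwo : (2 : ℝ) ≤ Real.exp 1 := by linarith [Real.add_one_le_exp (1 : ℝ)]
  calc 2 ^ p n * (Real.exp (C₁ * l₁ n + C₂ - C₃ * (√n * Real.log n)) *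
        (√(1 + Φ * (n * b)) ^ k / q))
      ≤ Real.exp 1 ^ p n * (Real.exp (C₁ * l₁ n + C₂ - C₃ * (√n * Real.log n)) *
        ((1 + Φ * b) ^ K * (n : ℝ) ^ K / q)) := by
        gcongr
        exact sqrt_one_add_mul_pow_le hΦ hb (Nat.one_le_cast.2 hn) hk
    _ = Real.exp (p n + (C₁ * l₁ n + C₂ - C₃ * (√n * Real.log n)) +
          (Real.log ((1 + Φ * b) ^ K / q) + K * Real.log n)) := by
        simp only [Real.exp_add, Real.exp_log (by positivity : 0 < (1 + Φ * b) ^ K / q),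
          Real.exp_nat_mul _ K, Real.exp_log hn', ← Real.exp_nat_mul _ (p n), mul_one]
        ring
    _ ≤ Real.exp (Real.log ε) := Real.exp_le_exp.2 (by linarith)
    _ = ε := Real.exp_log hε

end Precision

section FiniteSums

theorem le_mul_of_rpow_le {F M M₀ : ℝ≥0∞} {u W s ε : ℝ} (hs : 1 ≤ s) (hu : 0 < u)
    (huF : ENNReal.ofReal u * F ≤ 1) (hW : W ≤ ε * u ^ s)
    (hM : ∀ G : ℝ, F ≤ ENNReal.ofReal G → M ≤ ENNReal.ofReal (W * G ^ s) * M₀) (hε : 0 ≤ ε) :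
    M ≤ ENNReal.ofReal ε * M₀ * (ENNReal.ofReal u * F) := by
  have hF : F ≠ ∞ := by
    rintro rfl
    simp [ENNReal.mul_top, hu] at huF
  lift F to ℝ≥0 using hF
  have hG : (0 : ℝ) ≤ F := F.2
  rw [← ENNReal.ofReal_coe_nnreal, ← ENNReal.ofReal_mul hu.le] at huF ⊢
  rw [ENNReal.ofReal_le_one] at huF
  refine (hM F ENNReal.ofReal_coe_nnreal.ge).trans ?_
  rw [mul_right_comm, ← ENNReal.ofReal_mul hε]
  gcongr ENNReal.ofReal ?_ * _
  calc W * (F : ℝ) ^ s ≤ ε * u ^ s * F ^ s := by gcongr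
    _ = ε * (u * F) ^ s := by rw [Real.mul_rpow hu.le hG, mul_assoc]
    _ ≤ ε * (u * F) := by
        gcongr
        exact Real.rpow_le_self_of_le_one (by positivity) huF hs

theorem sum_le_mul_of_rpow_le {ι : Type*} {I : Finset ι} {F M : ι → ℝ≥0∞} {M₀ : ℝ≥0∞}
    {u W : ι → ℝ} {s ε : ℝ} (hs : 1 ≤ s) (hu : ∀ i ∈ I, 0 < u i)
    (hF : ∑ i ∈ I, ENNReal.ofReal (u i) * F i ≤ 1) (hW : ∀ i ∈ I, W i ≤ ε * u i ^ s)
    (hM : ∀ i ∈ I, ∀ G : ℝ, F i ≤ ENNReal.ofReal G → M i ≤ ENNReal.ofReal (W i * G ^ s) * M₀)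
    (hε : 0 ≤ ε) : ∑ i ∈ I, M i ≤ ENNReal.ofReal ε * M₀ := by
  calc ∑ i ∈ I, M i ≤ ∑ i ∈ I, ENNReal.ofReal ε * M₀ * (ENNReal.ofReal (u i) * F i) := by
        refine Finset.sum_le_sum fun i hi =>
          le_mul_of_rpow_le hs (hu i hi) ?_ (hW i hi) (hM i hi) hε
        exact (Finset.single_le_sum (f := fun i => ENNReal.ofReal (u i) * F i)
          (fun _ _ => zero_le) hi).trans hF
    _ ≤ ENNReal.ofReal ε * M₀ := by
        rw [← Finset.mul_sum]
        exact mul_le_of_le_one_right zero_le hF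

theorem sum_finset_fin_le {p : ℕ} {I : Finset (Finset (Fin p))} {M : Finset (Fin p) → ℝ≥0∞}
    {M₀ : ℝ≥0∞} {W : ℝ} (hM : ∀ γ ∈ I, M γ ≤ ENNReal.ofReal W * M₀) :
    ∑ γ ∈ I, M γ ≤ ENNReal.ofReal (2 ^ p * W) * M₀ := by
  calc ∑ γ ∈ I, M γ ≤ I.card • (ENNReal.ofReal W * M₀) := Finset.sum_le_card_nsmul I M _ hM
    _ ≤ (2 ^ p) • (ENNReal.ofReal W * M₀) := by
        gcongr
        simpa using I.card_le_univ
    _ = ENNReal.ofReal (2 ^ p * W) * M₀ := by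
        rw [nsmul_eq_mul, ENNReal.ofReal_mul (by positivity), ENNReal.ofReal_pow (by norm_num)]
        simp [mul_assoc]

theorem sum_ne_eq_sum_ssuperset_add {α M : Type*} [Fintype α] [DecidableEq α] [AddCommMonoid M]
    (s : Finset α) (f : Finset α → M) :
    ∑ t with t ≠ s, f t = ∑ t with s ⊂ t, f t + ∑ t with ¬ s ⊆ t, f t := by
  rw [← Finset.sum_filter_add_sum_filter_not ({t | t ≠ s} : Finset _) (s ⊆ ·)]
  simp only [Finset.filter_filter]
  congr 2 <;> ext t <;> simp only [Finset.mem_filter, Finset.mem_univ, true_and]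
  · rw [Finset.ssubset_iff_subset_ne]
    tauto
  · exact ⟨And.right, fun h => ⟨fun hts => h (hts ▸ subset_rfl), h⟩⟩

end FiniteSums

section RegularEvent

theorem eq_zero_of_notMem_trueModel {p : ℕ} {β : Fin p → ℝ} (j : Fin p) (hj : j ∉ trueModel β) :
    β j = 0 := by
  simpa [trueModel] using hj

variable {n p : ℕ} {γ γ₀ : Finset (Fin p)} {X : Matrix (Fin n) (Fin p) ℝ} {β₀ : Fin p → ℝ}
  {e : Fin n → ℝ} {g : Measure ℝ≥0} {φ Φ : ℝ≥0} {ν b v z l l₁ r B : ℝ}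

theorem marginalLikelihood_le_of_fitStat_le [IsProbabilityMeasure g] {G L W : ℝ} (hn : 0 < n)
    (hb : 0 < b) (hν : 0 < ν) (hv : 0 < v) (hz : 1 < z) (hX : IsConditioned b X) (hγ : γ₀ ⊆ γ)
    (hβ₀ : ∀ j ∉ γ₀, β₀ j = 0) (hG : fitStat √(1 / (z * v)) b γ X e ≤ ENNReal.ofReal G)
    (hl₁ : fitStat √(1 / (z * v)) b Finset.univ X e ≤ ENNReal.ofReal (Real.exp l₁))
    (hT : 2 * z ^ 2 * v * l₁ ≤ sqNorm e)
    (hκ : (n + ν) / 2 ≤ z / (2 * v) * (1 + (sqNorm e - 2 * z ^ 2 * v * l₁))) (hL : 0 ≤ L)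
    (hκ' : 1 / (16 * v) * (1 + sqNorm e + L) ≤ (n + ν) / 2) (hφ : φ ≠ 0)
    (hg : g (Set.Icc φ Φ) ≠ 0) (hB : sqNorm β₀ / φ ≤ B) (hW : 0 ≤ W)
    (hc : ∀ᵐ c ∂g, ScaleDichotomy γ γ₀ β₀ ((1 - 1 / z) / (2 * b) * n) (n * b) W L c) :
    marginalLikelihood ν g X (X.mulVec β₀ + e) γ ≤
      ENNReal.ofReal ((W * Real.exp (z / (2 * v)) + √2 ^ γ.card *
        (Real.exp (z / (2 * v) * B - 1 / (16 * v) * L) *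
          (√(1 + Φ * (n * b)) ^ γ₀.card / (g (Set.Icc φ Φ)).toReal))) * G ^ (z ^ 3)) *
      marginalLikelihood ν g X (X.mulVec β₀ + e) γ₀ := by
  have hz0 : 0 < z := one_pos.trans hz
  have hz1 : 0 < 1 - 1 / z := sub_pos.2 ((div_lt_one hz0).2 hz)
  obtain ⟨d, hd0, hd₁, hdG, hR⟩ := exists_residualBound hn hb hv hz hX hG hl₁
  have hdrop : 2 * z ^ 2 * v * d ≤ 2 * z ^ 2 * v * l₁ := by gcongr
  refine (hR.marginalLikelihood_le_of_superset hν (by positivity) (D := n * b) (by positivity) hγ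
    hβ₀ (fun δ => (hX δ).2) hφ hg (by linarith) hL (hκ.trans (by gcongr)) (by positivity)
    (hκ'.trans' (by gcongr; linarith [show 0 ≤ 2 * z ^ 2 * v * d by positivity]))
    (Δ := 2 * z ^ 2 * v * d) (by linarith) (by positivity) hB hW hc).trans ?_
  have hexp : Real.exp (z / (2 * v) * (2 * z ^ 2 * v * d)) = Real.exp d ^ (z ^ 3) := by
    rw [← Real.exp_mul]
    congr 1
    field_simp
  rw [hexp]
  gcongr

theorem marginalLikelihood_le_of_fitStat_univ_le [IsProbabilityMeasure g] {j : Fin p} {ψ : ℝ}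
    (hn : 0 < n) (hb : 0 < b) (hν : 0 < ν) (hv : 0 < v) (hz : 1 < z) (hX : IsConditioned b X)
    (hβ₀ : ∀ j ∉ γ₀, β₀ j = 0) (hj : j ∉ γ) (hψ : 0 ≤ ψ) (hψj : ψ ≤ |β₀ j|)
    (hl₁ : fitStat √(1 / (z * v)) b Finset.univ X e ≤ ENNReal.ofReal (Real.exp l₁))
    (hT : 2 * z ^ 2 * v * l₁ ≤ sqNorm e)
    (hκ : (n + ν) / 2 ≤ z / (2 * v) * (1 + (sqNorm e - 2 * z ^ 2 * v * l₁)))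
    (hκ' : 1 / (16 * v) * (1 + sqNorm e + (1 - 1 / z) / b * n * ψ ^ 2) ≤ (n + ν) / 2)
    (hφ : φ ≠ 0) (hg : g (Set.Icc φ Φ) ≠ 0) (hB : sqNorm β₀ / φ ≤ B) :
    marginalLikelihood ν g X (X.mulVec β₀ + e) γ ≤
      ENNReal.ofReal (Real.exp (z ^ 3 * l₁ + z / (2 * v) * B -
        1 / (16 * v) * ((1 - 1 / z) / b * n * ψ ^ 2)) *
          (√(1 + Φ * (n * b)) ^ γ₀.card / (g (Set.Icc φ Φ)).toReal)) *
      marginalLikelihood ν g X (X.mulVec β₀ + e) γ₀ := by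
  have hz0 : 0 < z := one_pos.trans hz
  have hz1 : 0 < 1 - 1 / z := sub_pos.2 ((div_lt_one hz0).2 hz)
  have hB0 : 0 ≤ B := (div_nonneg (sqNorm_nonneg β₀) φ.2).trans hB
  obtain ⟨d, hd0, hd₁, -, hR⟩ := exists_residualBound hn hb hv hz hX hl₁ hl₁
  have hd : 0 ≤ 2 * z ^ 2 * v * d := by positivity
  have hdrop : 2 * z ^ 2 * v * d ≤ 2 * z ^ 2 * v * l₁ := by gcongr
  have hpenalty : 2 * ((1 - 1 / z) / (2 * b) * n) * ψ ^ 2 = (1 - 1 / z) / b * n * ψ ^ 2 := by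
    field_simp
  have hgain : z / (2 * v) * (2 * z ^ 2 * v * l₁ + B) = z ^ 3 * l₁ + z / (2 * v) * B := by
    field_simp
  refine (hR.marginalLikelihood_le_of_notMem hν (by positivity) (D := n * b) (by positivity)
    hβ₀ (fun δ => (hX δ).2) hφ hg hj hψ hψj (by linarith) (hκ.trans (by gcongr))
    (κ' := 1 / (16 * v)) (hκ'.trans' (by rw [hpenalty]; gcongr; linarith))
    (Δ := 2 * z ^ 2 * v * l₁ + B) (by linarith) (by linarith)).trans_eq ?_
  rw [hpenalty, hgain]

/-- The pair of a design `X` and an error vector `e` is regular for the model `γ₀`: `X` is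
conditioned, `e` has squared norm comparable to `n v`, and no model fits `e` too well: the full
model has fit statistic at most `exp l₁`, and those of the models `γ ⊋ γ₀` sum to at most `1` when
weighted by `spuriousWeight`. -/
structure IsRegular (γ₀ : Finset (Fin p)) (b v z l l₁ r : ℝ) (X : Matrix (Fin n) (Fin p) ℝ)
    (e : Fin n → ℝ) : Prop where
  isConditioned : IsConditioned b X
  le_sqNorm : l * n * v ≤ sqNorm e
  sqNorm_le : sqNorm e ≤ 4 * n * v
  fitStat_univ_le : fitStat √(1 / (z * v)) b Finset.univ X e ≤ ENNReal.ofReal (Real.exp l₁)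
  sum_fitStat_le : ∑ γ with γ₀ ⊂ γ, ENNReal.ofReal (spuriousWeight n r (γ \ γ₀).card) *
    fitStat √(1 / (z * v)) b γ X e ≤ 1

end RegularEvent

section Consistency

variable {p : ℕ → ℕ} {β₀ : ∀ n, Fin (p n) → ℝ} {g : Measure ℝ≥0} [IsProbabilityMeasure g]
  {φ Φ : ℝ≥0} {K : ℕ} {a₀ b v z l ν r ρ B ε : ℝ} {l₁ : ℕ → ℝ}

theorem eventually_sum_ssuperset_marginalLikelihood_le (hb : 0 < b) (hν : 0 < ν) (hv : 0 < v)
    (hz : 1 < z) (hl : 1 / z < l) (hr : r ≤ 1) (hρ : z ^ 3 * r < ρ)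
    (hp : (fun n => ((p n : ℝ) + 1) * Real.log n) =o[atTop] fun n : ℕ => (n : ℝ))
    (hl₁ : l₁ =o[atTop] fun n : ℕ => (n : ℝ))
    (hβ₀ : ∀ᶠ n in atTop, IsSparseSignal n K B a₀ (β₀ n)) (hg : HasPenaltyRate g p β₀ ρ)
    (hφ : φ ≠ 0) (hΦ : g (Set.Icc φ Φ) ≠ 0) (hε : 0 < ε) :
    ∀ᶠ n : ℕ in atTop, ∀ (X : Matrix (Fin n) (Fin (p n)) ℝ) (e : Fin n → ℝ),
      IsRegular (trueModel (β₀ n)) b v z l (l₁ n) r X e →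
      ∑ γ with trueModel (β₀ n) ⊂ γ, marginalLikelihood ν g X (X.mulVec (β₀ n) + e) γ ≤
        ENNReal.ofReal ε *
          marginalLikelihood ν g X (X.mulVec (β₀ n) + e) (trueModel (β₀ n)) := by
  have hz0 : 0 < z := one_pos.trans hz
  have hz1 : 0 < 1 - 1 / z := sub_pos.2 ((div_lt_one hz0).2 hz)
  have hs : 1 ≤ z ^ 3 := one_le_pow₀ hz.le
  have hq : 0 < (g (Set.Icc φ Φ)).toReal := ENNReal.toReal_pos hΦ (measure_ne_top _ _)
  set A₄ : ℝ := 16 * v * (K + z ^ 3 + 1) with hA₄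
  have hA₄0 : 0 < A₄ := by positivity
  obtain ⟨C₁, C₂, hC₁, hC₂, hpenalty⟩ :=
    hg ((1 - 1 / z) / (2 * b)) b A₄ (by positivity) hb hA₄0
  filter_upwards [hpenalty, hβ₀, eventually_gt_atTop 0,
    eventually_mul_pow_le_spuriousWeight_rpow (C₁ := C₁ * Real.exp (z / (2 * v))) hs hρ
      (by positivity) hC₂ (half_pos hε),
    eventually_sqrt_two_pow_mul_exp_le_spuriousWeight_rpow (B := z / (2 * v) * (B / φ)) K
      (zero_le_one.trans hs) hr Φ.2 hb.le hq (half_pos hε),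
    eventually_half_add_le_mul_one_add (ν := ν) hz hv hl hl₁,
    eventually_one_add_le_of_isLittleO (hp.const_mul_left A₄) (C := 4 * v) (by positivity)]
    with n hpenalty hβ₀ hn hW₁ hW₂ hprec hcost X e hXe
  obtain ⟨hT, hκ⟩ := hprec _ hXe.le_sqNorm
  have hlog := Real.log_natCast_nonneg n
  refine sum_le_mul_of_rpow_le hs (fun γ _ => spuriousWeight_pos hn r _) hXe.sum_fitStat_le
    (fun γ hγ => ?_) (fun γ hγ G hG => marginalLikelihood_le_of_fitStat_le hn hb hν hv hz
      hXe.isConditioned (Finset.mem_filter.1 hγ).2.1 eq_zero_of_notMem_trueModel hG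
      hXe.fitStat_univ_le hT hκ (by positivity)
      (one_div_mul_one_add_le_half hν.le hv hXe.sqNorm_le (hcost.trans' ?_)) hφ hΦ
      (div_le_div_of_nonneg_right hβ₀.sqNorm_le φ.2) (by positivity)
      (hpenalty.mono fun c hc => hc γ (Finset.mem_filter.1 hγ).2.1)) hε.le
  · obtain ⟨hsub, hnot⟩ := (Finset.mem_filter.1 hγ).2
    have hm : (γ \ trueModel (β₀ n)).card ≠ 0 :=
      Finset.card_ne_zero.2 (Finset.sdiff_nonempty.2 hnot)
    rw [← Finset.card_sdiff_add_card_eq_card hsub, add_comm (Finset.card _) (Finset.card _)]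
    have hcancel (t : ℝ) : 1 / (16 * v) * (A₄ * t) = (K + z ^ 3 + 1) * t := by
      rw [hA₄]
      field_simp
    have h₁ := hW₁ _ hm
    have h₂ := hW₂ _ hβ₀.card_le (γ \ trueModel (β₀ n)).card
    rw [mul_right_comm] at h₁
    rw [hcancel]
    exact (add_le_add h₁ h₂).trans_eq (by ring)
  · gcongr
    simpa using Finset.card_le_univ (γ \ trueModel (β₀ n))

theorem eventually_sum_not_subset_marginalLikelihood_le (ha₀ : 0 < a₀) (hb : 0 < b) (hν : 0 < ν)
    (hv : 0 < v) (hz : 1 < z) (hl : 1 / z < l)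
    (hp : (fun n => (p n : ℝ)) =o[atTop] fun n : ℕ => √n) (hl₁ : l₁ =o[atTop] fun n : ℕ => √n)
    (hβ₀ : ∀ᶠ n in atTop, IsSparseSignal n K B a₀ (β₀ n)) (hφ : φ ≠ 0)
    (hΦ : g (Set.Icc φ Φ) ≠ 0) (hε : 0 < ε) :
    ∀ᶠ n : ℕ in atTop, ∀ (X : Matrix (Fin n) (Fin (p n)) ℝ) (e : Fin n → ℝ),
      IsRegular (trueModel (β₀ n)) b v z l (l₁ n) r X e →
      ∑ γ with ¬ trueModel (β₀ n) ⊆ γ, marginalLikelihood ν g X (X.mulVec (β₀ n) + e) γ ≤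
        ENNReal.ofReal ε *
          marginalLikelihood ν g X (X.mulVec (β₀ n) + e) (trueModel (β₀ n)) := by
  have hz1 : 0 < 1 - 1 / z := sub_pos.2 ((div_lt_one (one_pos.trans hz)).2 hz)
  have hq : 0 < (g (Set.Icc φ Φ)).toReal := ENNReal.toReal_pos hΦ (measure_ne_top _ _)
  set A := (1 - 1 / z) / b * a₀ ^ 2 with hA
  have : 0 < A := by positivity
  have hpenalty (n : ℕ) : (1 - 1 / z) / b * n *
      (a₀ * ((n : ℝ) ^ (-(1 / 4) : ℝ) * √(Real.log n))) ^ 2 = A * (√n * Real.log n) := by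
    rw [sq_mul_rpow_mul_sqrt_log, hA]
    calc _ = (1 - 1 / z) / b * a₀ ^ 2 * Real.log n * (n / √n) := by ring
      _ = _ := by rw [Real.div_sqrt]; ring
  filter_upwards [hβ₀, eventually_gt_atTop 0,
    eventually_half_add_le_mul_one_add (ν := ν) hz hv hl
      (hl₁.trans isLittleO_sqrt_natCast),
    eventually_one_add_le_of_isLittleO (isLittleO_sqrt_mul_log_natCast.const_mul_left A)
      (C := 4 * v) (by positivity),
    eventually_two_pow_mul_exp_le (C₁ := z ^ 3) (C₂ := z / (2 * v) * (B / φ))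
      (C₃ := 1 / (16 * v) * A) K Φ.2 hb.le hq (by positivity) hp hl₁ hε]
    with n hβ₀ hn hprec hcost hW X e hXe
  obtain ⟨hT, hκ⟩ := hprec _ hXe.le_sqNorm
  have hM (γ) (hγ : γ ∈ ({γ | ¬ trueModel (β₀ n) ⊆ γ} : Finset (Finset (Fin (p n))))) :=
    let ⟨j, hj₀, hj⟩ := Finset.not_subset.1 (Finset.mem_filter.1 hγ).2
    marginalLikelihood_le_of_fitStat_univ_le hn hb hν hv hz hXe.isConditioned
      eq_zero_of_notMem_trueModel hj (by positivity) (hβ₀.le_abs j hj₀) hXe.fitStat_univ_le hT hκ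
      (by rw [hpenalty]; exact one_div_mul_one_add_le_half hν.le hv hXe.sqNorm_le hcost) hφ hΦ
      (div_le_div_of_nonneg_right hβ₀.sqNorm_le φ.2)
  refine (sum_finset_fin_le hM).trans ?_
  gcongr ENNReal.ofReal ?_ * _
  rw [hpenalty, ← mul_assoc (1 / (16 * v))]
  exact hW _ hβ₀.card_le

theorem eventually_sum_ne_marginalLikelihood_le {s : ℝ} (ha₀ : 0 < a₀) (hb : 0 < b) (hν : 0 < ν)
    (hv : 0 < v) (hz : 1 < z) (hl : 1 / z < l) (hr : r ≤ 1) (hρ : z ^ 3 * r < ρ) (hs0 : 0 ≤ s)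
    (hs : s < 1 / 2) (hp : (fun n => (p n : ℝ)) =O[atTop] fun n : ℕ => (n : ℝ) ^ s)
    (hl₁ : l₁ =o[atTop] fun n : ℕ => √n)
    (hβ₀ : ∀ᶠ n in atTop, IsSparseSignal n K B a₀ (β₀ n)) (hg : HasPenaltyRate g p β₀ ρ)
    (hφ : φ ≠ 0) (hΦ : g (Set.Icc φ Φ) ≠ 0) (hε : 0 < ε) :
    ∀ᶠ n : ℕ in atTop, ∀ (X : Matrix (Fin n) (Fin (p n)) ℝ) (e : Fin n → ℝ),
      IsRegular (trueModel (β₀ n)) b v z l (l₁ n) r X e →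
      ∑ γ with γ ≠ trueModel (β₀ n), marginalLikelihood ν g X (X.mulVec (β₀ n) + e) γ ≤
        ENNReal.ofReal ε *
          marginalLikelihood ν g X (X.mulVec (β₀ n) + e) (trueModel (β₀ n)) := by
  filter_upwards [
    eventually_sum_ssuperset_marginalLikelihood_le hb hν hv hz hl hr hρ
      (isLittleO_natCast_add_one_mul_log hs0 (by linarith) hp)
      (hl₁.trans isLittleO_sqrt_natCast) hβ₀ hg hφ hΦ (half_pos hε),
    eventually_sum_not_subset_marginalLikelihood_le ha₀ hb hν hv hz hl
      (isLittleO_natCast_sqrt hs hp) hl₁ hβ₀ hφ hΦ (half_pos hε)]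
    with n hsup hmiss X e hXe
  rw [sum_ne_eq_sum_ssuperset_add, ← add_halves ε, ENNReal.ofReal_add (by positivity)
    (by positivity), add_mul]
  exact add_le_add (hsup X e hXe) (hmiss X e hXe)

end Consistency

section SpuriousSum

theorem sum_ssuperset_card_sdiff_le {α : Type*} [Fintype α] [DecidableEq α] (s : Finset α)
    {f : ℕ → ℝ} (hf : ∀ m, 0 ≤ f m) :
    ∑ t with s ⊂ t, f (t \ s).card ≤
      ∑ m ∈ Finset.range (Fintype.card α), (Fintype.card α).choose (m + 1) * f (m + 1) := by
  have hinj : Set.InjOn (· \ s) (({t | s ⊂ t} : Finset (Finset α)) : Set (Finset α)) :=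
    fun t ht u hu h => by
      rw [← Finset.sdiff_union_of_subset (Finset.mem_filter.1 ht).2.1,
        ← Finset.sdiff_union_of_subset (Finset.mem_filter.1 hu).2.1]
      exact congrArg (· ∪ s) h
  have hsub : Finset.image (· \ s) ({t | s ⊂ t} : Finset (Finset α)) ⊆ Finset.univ.erase ∅ := by
    refine Finset.image_subset_iff.2 fun t ht => Finset.mem_erase.2 ⟨?_, Finset.mem_univ _⟩
    exact (Finset.sdiff_nonempty.2 (Finset.mem_filter.1 ht).2.2).ne_empty
  calc ∑ t with s ⊂ t, f (t \ s).card
      = ∑ t ∈ Finset.image (· \ s) ({t | s ⊂ t} : Finset (Finset α)), f t.card :=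
        (Finset.sum_image (f := fun t => f t.card) hinj).symm
    _ ≤ ∑ t ∈ Finset.univ.erase (∅ : Finset α), f t.card :=
        Finset.sum_le_sum_of_subset_of_nonneg hsub fun _ _ _ => hf _
    _ = ∑ t ∈ (Finset.univ : Finset α).powerset, f t.card - f 0 := by
        rw [Finset.sum_erase_eq_sub (Finset.mem_univ _), Finset.powerset_univ, Finset.card_empty]
    _ = _ := by
        rw [Finset.sum_powerset_apply_card, Finset.card_univ, Finset.sum_range_succ']
        simp

theorem sum_choose_mul_factorial_le {p : ℕ} {x : ℝ} (hx : 0 ≤ x) (hpx : p * x ≤ 1 / 2) :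
    ∑ m ∈ Finset.range p, (p.choose (m + 1) : ℝ) * (x ^ (m + 1) * (m + 1).factorial) ≤
      2 * (p * x) := by
  have hchoose (m : ℕ) : (p.choose (m + 1) : ℝ) * (m + 1).factorial ≤ (p : ℝ) ^ (m + 1) := by
    rw [mul_comm]
    exact_mod_cast (Nat.descFactorial_eq_factorial_mul_choose p _).symm.trans_le
      (Nat.descFactorial_le_pow p _)
  calc ∑ m ∈ Finset.range p, (p.choose (m + 1) : ℝ) * (x ^ (m + 1) * (m + 1).factorial)
      = ∑ m ∈ Finset.range p, (p.choose (m + 1) * (m + 1).factorial : ℝ) * x ^ (m + 1) :=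
        Finset.sum_congr rfl fun m _ => by ring
    _ ≤ ∑ m ∈ Finset.range p, (p : ℝ) ^ (m + 1) * x ^ (m + 1) := by
        gcongr with m
        exact hchoose m
    _ = ∑ m ∈ Finset.range p, p * x * (p * x) ^ m :=
        Finset.sum_congr rfl fun m _ => by ring
    _ ≤ ∑ m ∈ Finset.range p, p * x * (1 / 2 : ℝ) ^ m := by gcongr
    _ = p * x * ∑ m ∈ Finset.range p, (1 / 2 : ℝ) ^ m := (Finset.mul_sum _ _ _).symm
    _ ≤ p * x * 2 := by gcongr; exact sum_geometric_two_le p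
    _ = 2 * (p * x) := mul_comm _ _

theorem measurable_fitStat_right {n p : ℕ} (a b : ℝ) (γ : Finset (Fin p))
    (X : Matrix (Fin n) (Fin p) ℝ) : Measurable fun e => fitStat a b γ X e :=
  (measurable_fitStat (n := n) a b γ).of_uncurry_left (x := (X : Fin n → Fin p → ℝ))

theorem lintegral_sum_spuriousWeight_mul_fitStat_le {n p K : ℕ} {a b η r R : ℝ} {v : ℝ≥0}
    {γ₀ : Finset (Fin p)} {X : Matrix (Fin n) (Fin p) ℝ} (hn : 0 < n) (hb : 0 < b) (hη : 0 < η)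
    (hav : a ^ 2 * v = 1 - η) (hk : γ₀.card ≤ K) (hX : IsConditioned b X) (hR₁ : 1 ≤ R)
    (hR : √(b ^ 2 / η) ≤ R) (hpr : p * (R * (n : ℝ) ^ (-r)) ≤ 1 / 2) :
    ∫⁻ e, ∑ γ with γ₀ ⊂ γ, ENNReal.ofReal (spuriousWeight n r (γ \ γ₀).card) * fitStat a b γ X e
        ∂Measure.pi (fun _ : Fin n => gaussianReal 0 v) ≤
      ENNReal.ofReal (R ^ K * (2 * (p * (R * (n : ℝ) ^ (-r))))) := by
  have hterm (γ) (hγ : γ ∈ ({γ | γ₀ ⊂ γ} : Finset (Finset (Fin p)))) :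
      ∫⁻ e, ENNReal.ofReal (spuriousWeight n r (γ \ γ₀).card) * fitStat a b γ X e
          ∂Measure.pi (fun _ : Fin n => gaussianReal 0 v) ≤
        ENNReal.ofReal (R ^ K *
          ((R * (n : ℝ) ^ (-r)) ^ (γ \ γ₀).card * (γ \ γ₀).card.factorial)) := by
    have hw := (spuriousWeight_pos hn r (γ \ γ₀).card).le
    rw [lintegral_const_mul' _ _ ENNReal.ofReal_ne_top]
    refine (mul_le_mul_right (lintegral_fitStat_le hn hb hη hav γ hX) _).trans ?_
    rw [← ENNReal.ofReal_pow (by positivity), ← ENNReal.ofReal_mul hw]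
    refine ENNReal.ofReal_le_ofReal ?_
    rw [← Finset.card_sdiff_add_card_eq_card (Finset.mem_filter.1 hγ).2.1]
    calc spuriousWeight n r (γ \ γ₀).card * √(b ^ 2 / η) ^ ((γ \ γ₀).card + γ₀.card)
        ≤ spuriousWeight n r (γ \ γ₀).card * R ^ ((γ \ γ₀).card + K) := by
          gcongr ?_ * ?_
          exact (pow_le_pow_left₀ (by positivity) hR _).trans (by gcongr)
      _ = _ := by
          rw [spuriousWeight]
          ring
  rw [lintegral_finsetSum _ fun γ _ => (measurable_fitStat_right a b γ X).const_mul _]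
  refine (Finset.sum_le_sum hterm).trans ?_
  rw [← ENNReal.ofReal_sum_of_nonneg fun γ _ => by positivity, ← Finset.mul_sum]
  gcongr ENNReal.ofReal (_ * ?_)
  have hsum := sum_ssuperset_card_sdiff_le γ₀
    (f := fun m => (R * (n : ℝ) ^ (-r)) ^ m * m.factorial) fun m => by positivity
  rw [Fintype.card_fin] at hsum
  exact hsum.trans (sum_choose_mul_factorial_le (by positivity) hpr)

end SpuriousSum

section RegularProbability

variable {n p K : ℕ} {b z l l₁ r R : ℝ} {v : ℝ≥0} {γ₀ : Finset (Fin p)}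

theorem measurableSet_isRegular (γ₀ : Finset (Fin p)) (b v z l l₁ r : ℝ) :
    MeasurableSet {q : (Fin n → Fin p → ℝ) × (Fin n → ℝ) |
      IsRegular γ₀ b v z l l₁ r (Matrix.of q.1) q.2} := by
  have hnorm : Measurable fun q : (Fin n → Fin p → ℝ) × (Fin n → ℝ) => sqNorm q.2 := by fun_prop
  have hfit := measurable_fitStat (n := n) (p := p) √(1 / (z * v)) b
  have hset : {q : (Fin n → Fin p → ℝ) × (Fin n → ℝ) |
        IsRegular γ₀ b v z l l₁ r (Matrix.of q.1) q.2} =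
      {q | IsConditioned b (Matrix.of q.1)} ∩ ({q | l * n * v ≤ sqNorm q.2} ∩
      ({q | sqNorm q.2 ≤ 4 * n * v} ∩
      ({q | fitStat √(1 / (z * v)) b Finset.univ (Matrix.of q.1) q.2 ≤
        ENNReal.ofReal (Real.exp l₁)} ∩
      {q | ∑ γ with γ₀ ⊂ γ, ENNReal.ofReal (spuriousWeight n r (γ \ γ₀).card) *
        fitStat √(1 / (z * v)) b γ (Matrix.of q.1) q.2 ≤ 1}))) :=
    Set.ext fun q => ⟨fun ⟨h₁, h₂, h₃, h₄, h₅⟩ => ⟨h₁, h₂, h₃, h₄, h₅⟩,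
      fun ⟨h₁, h₂, h₃, h₄, h₅⟩ => ⟨h₁, h₂, h₃, h₄, h₅⟩⟩
  rw [hset]
  exact ((isClosed_isConditioned n p b).measurableSet.preimage measurable_fst).inter
    ((measurableSet_le measurable_const hnorm).inter
    ((measurableSet_le hnorm measurable_const).inter
    ((measurableSet_le (hfit _) measurable_const).inter
    (measurableSet_le (Finset.measurable_fun_sum _ fun γ _ => (hfit _).const_mul _)
      measurable_const))))

theorem pi_gaussianReal_le_fitStat_univ_le {a η : ℝ} {X : Matrix (Fin n) (Fin p) ℝ} (hn : 0 < n)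
    (hb : 0 < b) (hη : 0 < η) (hav : a ^ 2 * v = 1 - η) (hX : IsConditioned b X)
    (hR : √(b ^ 2 / η) ≤ R) :
    Measure.pi (fun _ : Fin n => gaussianReal 0 v) {e |
        ENNReal.ofReal (Real.exp (R * p + Real.log n)) ≤ fitStat a b Finset.univ X e} ≤
      ENNReal.ofReal (n : ℝ)⁻¹ := by
  have hexp : √(b ^ 2 / η) ^ p ≤ Real.exp (R * p) := by
    rw [mul_comm, Real.exp_nat_mul]
    exact pow_le_pow_left₀ (by positivity) (hR.trans (by linarith [Real.add_one_le_exp R])) p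
  calc _ ≤ (∫⁻ e, fitStat a b Finset.univ X e ∂Measure.pi fun _ : Fin n => gaussianReal 0 v) /
          ENNReal.ofReal (Real.exp (R * p + Real.log n)) :=
        meas_ge_le_lintegral_div (measurable_fitStat_right a b _ X).aemeasurable
          (ENNReal.ofReal_pos.2 (Real.exp_pos _)).ne' ENNReal.ofReal_ne_top
    _ ≤ ENNReal.ofReal (√(b ^ 2 / η) ^ p) / ENNReal.ofReal (Real.exp (R * p + Real.log n)) := by
        gcongr
        simpa [ENNReal.ofReal_pow] using lintegral_fitStat_le hn hb hη hav Finset.univ hX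
    _ ≤ ENNReal.ofReal (n : ℝ)⁻¹ := by
        rw [← ENNReal.ofReal_div_of_pos (Real.exp_pos _), Real.exp_add,
          Real.exp_log (Nat.cast_pos.2 hn)]
        refine ENNReal.ofReal_le_ofReal ((div_le_iff₀ (by positivity)).2 (hexp.trans_eq ?_))
        field_simp

theorem pi_gaussianReal_not_isRegular_le {X : Matrix (Fin n) (Fin p) ℝ} {t₁ t₂ : ℝ≥0∞}
    (hn : 0 < n) (hb : 0 < b) (hz : 1 < z) (hv : v ≠ 0) (hk : γ₀.card ≤ K)
    (hX : IsConditioned b X) (hR₁ : 1 ≤ R) (hR : √(b ^ 2 / (1 - 1 / z)) ≤ R)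
    (hpr : p * (R * (n : ℝ) ^ (-r)) ≤ 1 / 2)
    (hlower : Measure.pi (fun _ : Fin n => gaussianReal 0 v) {e | sqNorm e < l * n * v} ≤ t₁)
    (hupper : Measure.pi (fun _ : Fin n => gaussianReal 0 v) {e | 4 * n * v < sqNorm e} ≤ t₂) :
    Measure.pi (fun _ : Fin n => gaussianReal 0 v)
        {e | ¬ IsRegular γ₀ b v z l (R * p + Real.log n) r X e} ≤
      t₁ + (t₂ + (ENNReal.ofReal (n : ℝ)⁻¹ +
        ENNReal.ofReal (R ^ K * (2 * (p * (R * (n : ℝ) ^ (-r))))))) := by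
  have : (0 : ℝ) < v := NNReal.coe_pos.2 (pos_iff_ne_zero.2 hv)
  have hz1 : 0 < 1 - 1 / z := sub_pos.2 ((div_lt_one (one_pos.trans hz)).2 hz)
  have hav : √(1 / (z * v)) ^ 2 * v = 1 - (1 - 1 / z) := by
    rw [Real.sq_sqrt (by positivity)]
    field_simp
    ring
  have hsub : {e | ¬ IsRegular γ₀ b v z l (R * p + Real.log n) r X e} ⊆
      {e | sqNorm e < l * n * v} ∪ ({e | 4 * n * v < sqNorm e} ∪
        ({e | ENNReal.ofReal (Real.exp (R * p + Real.log n)) ≤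
            fitStat √(1 / (z * v)) b Finset.univ X e} ∪
          {e | 1 ≤ ∑ γ with γ₀ ⊂ γ, ENNReal.ofReal (spuriousWeight n r (γ \ γ₀).card) *
            fitStat √(1 / (z * v)) b γ X e})) := by
    intro e he
    by_contra! hmem
    simp only [Set.mem_union, Set.mem_ofPred_eq, not_or, not_lt, not_le] at hmem
    exact he ⟨hX, hmem.1, hmem.2.1, hmem.2.2.1.le, hmem.2.2.2.le⟩
  refine (measure_mono hsub).trans ((measure_union_le _ _).trans (add_le_add hlower
    ((measure_union_le _ _).trans (add_le_add hupper ((measure_union_le _ _).trans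
      (add_le_add (pi_gaussianReal_le_fitStat_univ_le hn hb hz1 hav hX hR) ?_))))))
  refine (meas_le_lintegral₀ (Finset.measurable_fun_sum _ fun γ _ =>
    (measurable_fitStat_right _ b γ X).const_mul _).aemeasurable fun e he => he).trans ?_
  exact lintegral_sum_spuriousWeight_mul_fitStat_le hn hb hz1 hav hk hX hR₁ hR hpr

theorem measure_prodMk_mem_le {Ω E F : Type*} [MeasurableSpace Ω] [MeasurableSpace E]
    [MeasurableSpace F] {P : Measure Ω} [IsProbabilityMeasure P] {κ : Measure F} [SFinite κ]
    {X : Ω → E} {ε : Ω → F} (hX : AEMeasurable X P) (hε : HasLaw ε κ P) (hind : IndepFun X ε P)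
    {s : Set (E × F)} (hs : MeasurableSet s) {t : ℝ≥0∞}
    (h : ∀ᵐ ω ∂P, κ (Prod.mk (X ω) ⁻¹' s) ≤ t) : P {ω | (X ω, ε ω) ∈ s} ≤ t := by
  have hlaw : P.map (fun ω => (X ω, ε ω)) = (P.map X).prod κ := by
    rw [(indepFun_iff_map_prod_eq_prod_map_map hX hε.aemeasurable).1 hind, hε.map_eq]
  calc P {ω | (X ω, ε ω) ∈ s} = (P.map X).prod κ s := by
        rw [← hlaw, Measure.map_apply_of_aemeasurable (hX.prodMk hε.aemeasurable) hs]
        rfl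
    _ = ∫⁻ ω, κ (Prod.mk (X ω) ⁻¹' s) ∂P := by
        rw [Measure.prod_apply hs,
          lintegral_map' (measurable_measure_prodMk_left hs).aemeasurable hX]
    _ ≤ ∫⁻ _, t ∂P := lintegral_mono_ae h
    _ = t := by simp

theorem tendsto_natCast_mul_rpow_neg {p : ℕ → ℕ} {s : ℝ} (hs : s < r)
    (hp : (fun n => (p n : ℝ)) =O[atTop] fun n : ℕ => (n : ℝ) ^ s) (R : ℝ) :
    Tendsto (fun n : ℕ => (p n : ℝ) * (R * (n : ℝ) ^ (-r))) atTop (𝓝 0) := by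
  have hlim :=
    (hp.trans_isLittleO (isLittleO_rpow_rpow_natCast hs)).tendsto_div_nhds_zero.const_mul R
  rw [mul_zero] at hlim
  refine hlim.congr fun n => ?_
  rw [Real.rpow_neg (Nat.cast_nonneg n)]
  ring

end RegularProbability

section RegularLimit

variable {Ω : Type*} [MeasurableSpace Ω] {P : Measure Ω} [IsProbabilityMeasure P] {p : ℕ → ℕ}
  {X : ∀ n, Ω → Fin n → Fin (p n) → ℝ} {ε : ∀ n, Ω → Fin n → ℝ} {v : ℝ≥0} {b z l r s : ℝ} {K : ℕ}
  {γ₀ : ∀ n, Finset (Fin (p n))}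

theorem exists_tendsto_measure_not_isRegular (hv : v ≠ 0) (hb : 0 < b) (hz : 1 < z) (hl₀ : 0 < l)
    (hl₁ : l < 1) (hs : s < r) (hX : ∀ n, AEMeasurable (X n) P)
    (hε : ∀ n, HasLaw (ε n) (Measure.pi fun _ : Fin n => gaussianReal 0 v) P)
    (hind : ∀ n, IndepFun (X n) (ε n) P)
    (hwell : ∀ᶠ n in atTop, ∀ᵐ ω ∂P, WellConditioned b (Matrix.of (X n ω)))
    (hp : (fun n => (p n : ℝ)) =O[atTop] fun n : ℕ => (n : ℝ) ^ s)
    (hk : ∀ᶠ n in atTop, (γ₀ n).card ≤ K) :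
    ∃ R : ℝ, Tendsto (fun n => P {ω | ¬ IsRegular (γ₀ n) b v z l (R * p n + Real.log n) r
      (Matrix.of (X n ω)) (ε n ω)}) atTop (𝓝 0) := by
  obtain ⟨q₁, -, hq₁, hlower⟩ := exists_pi_gaussianReal_sqNorm_lt_le hl₀ hl₁
  obtain ⟨q₂, -, hq₂, hupper⟩ := exists_pi_gaussianReal_lt_sqNorm_le
  set R := max 1 √(b ^ 2 / (1 - 1 / z))
  have hpr := tendsto_natCast_mul_rpow_neg hs hp R
  have hbound : Tendsto (fun n : ℕ => ENNReal.ofReal q₁ ^ n + (ENNReal.ofReal q₂ ^ n +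
      (ENNReal.ofReal (n : ℝ)⁻¹ +
        ENNReal.ofReal (R ^ K * (2 * (p n * (R * (n : ℝ) ^ (-r)))))))) atTop (𝓝 0) := by
    have hinv := ENNReal.tendsto_ofReal (tendsto_inv_atTop_nhds_zero_nat (𝕜 := ℝ))
    have hspurious := ENNReal.tendsto_ofReal ((hpr.const_mul 2).const_mul (R ^ K))
    have hpow {q : ℝ} (hq : q < 1) : Tendsto (fun n => ENNReal.ofReal q ^ n) atTop (𝓝 0) :=
      ENNReal.tendsto_pow_atTop_nhds_zero_of_lt_one (ENNReal.ofReal_lt_one.2 hq)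
    simpa using (hpow hq₁).add ((hpow hq₂).add (hinv.add hspurious))
  refine ⟨R, tendsto_of_tendsto_of_tendsto_of_le_of_le' tendsto_const_nhds hbound
    (Eventually.of_forall fun _ => zero_le) ?_⟩
  filter_upwards [hwell, hk, eventually_gt_atTop 0,
    hpr.eventually_le_const one_half_pos] with n hwell hk hn hpr
  refine measure_prodMk_mem_le (hX n) (hε n) (hind n)
    (measurableSet_isRegular (γ₀ n) b v z l (R * p n + Real.log n) r).compl ?_
  filter_upwards [hwell] with ω hω
  exact pi_gaussianReal_not_isRegular_le hn hb hz hv hk (hω.isConditioned hn) (le_max_left _ _)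
    (le_max_right _ _) hpr (hlower n v hv) (hupper n v hv)

end RegularLimit

section Posterior

variable {n p : ℕ} {ν θ : ℝ} {g : Measure ℝ≥0} {X : Matrix (Fin n) (Fin p) ℝ} {y : Fin n → ℝ}
  {γ₀ : Finset (Fin p)}

/-- The model `γ₀` has positive marginal likelihood, and all other models together have at most the
fraction `θ` of it: the event on which the posterior concentrates at `γ₀`. -/
structure IsDominant (ν : ℝ) (g : Measure ℝ≥0) (X : Matrix (Fin n) (Fin p) ℝ) (y : Fin n → ℝ)
    (γ₀ : Finset (Fin p)) (θ : ℝ) : Prop where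
  ne_zero : marginalLikelihood ν g X y γ₀ ≠ 0
  sum_ne_le : ∑ γ with γ ≠ γ₀, marginalLikelihood ν g X y γ ≤
    ENNReal.ofReal θ * marginalLikelihood ν g X y γ₀

variable {π : PMF (Finset (Fin p))} {C₀ : ℝ≥0}

theorem pmf_ne_zero_of_forall_le {α : Type*} {π : PMF α} {a : α} {C : ℝ≥0∞}
    (hπ : ∀ x, π x ≤ C * π a) : π a ≠ 0 := by
  intro ha
  have hzero (x) : π x = 0 := by simpa [ha] using hπ x
  simpa [hzero] using π.tsum_coe

theorem mul_marginalLikelihood_ne_top [IsProbabilityMeasure g] (hν : 0 < ν) (γ : Finset (Fin p)) :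
    π γ * marginalLikelihood ν g X y γ ≠ ∞ :=
  ENNReal.mul_ne_top (π.apply_ne_top γ) (marginalLikelihood_ne_top hν g)

theorem posterior_eq_div [IsProbabilityMeasure g] (hν : 0 < ν) (γ : Finset (Fin p)) :
    posterior ν g π X y γ = (π γ * marginalLikelihood ν g X y γ).toReal /
      ∑ γ', (π γ' * marginalLikelihood ν g X y γ').toReal := by
  rw [posterior, ENNReal.toReal_div,
    ENNReal.toReal_sum fun γ' _ => mul_marginalLikelihood_ne_top hν γ']

namespace IsDominant

theorem sum_mul_le (h : IsDominant ν g X y γ₀ θ) (hπ : ∀ γ, π γ ≤ C₀ * π γ₀) :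
    ∑ γ with γ ≠ γ₀, π γ * marginalLikelihood ν g X y γ ≤
      C₀ * ENNReal.ofReal θ * (π γ₀ * marginalLikelihood ν g X y γ₀) :=
  calc _ ≤ ∑ γ with γ ≠ γ₀, C₀ * π γ₀ * marginalLikelihood ν g X y γ := by
        gcongr with γ
        exact hπ γ
    _ = C₀ * π γ₀ * ∑ γ with γ ≠ γ₀, marginalLikelihood ν g X y γ := by rw [Finset.mul_sum]
    _ ≤ C₀ * π γ₀ * (ENNReal.ofReal θ * marginalLikelihood ν g X y γ₀) := by
        gcongr
        exact h.sum_ne_le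
    _ = _ := by ring

variable [IsProbabilityMeasure g]

theorem sum_toReal_le (h : IsDominant ν g X y γ₀ θ) (hν : 0 < ν) (hθ : 0 ≤ θ)
    (hπ : ∀ γ, π γ ≤ C₀ * π γ₀) :
    ∑ γ with γ ≠ γ₀, (π γ * marginalLikelihood ν g X y γ).toReal ≤
      C₀ * θ * (π γ₀ * marginalLikelihood ν g X y γ₀).toReal := by
  rw [← ENNReal.toReal_sum fun γ' _ => mul_marginalLikelihood_ne_top hν γ']
  refine (ENNReal.toReal_mono ?_ (h.sum_mul_le hπ)).trans_eq ?_
  · exact ENNReal.mul_ne_top (ENNReal.mul_ne_top ENNReal.coe_ne_top ENNReal.ofReal_ne_top)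
      (mul_marginalLikelihood_ne_top hν γ₀)
  · rw [ENNReal.toReal_mul (a := C₀ * ENNReal.ofReal θ), ENNReal.toReal_mul (a := (C₀ : ℝ≥0∞)),
      ENNReal.toReal_ofReal hθ, ENNReal.coe_toReal]

theorem toReal_pos (h : IsDominant ν g X y γ₀ θ) (hν : 0 < ν) (hπ : ∀ γ, π γ ≤ C₀ * π γ₀) :
    0 < (π γ₀ * marginalLikelihood ν g X y γ₀).toReal :=
  ENNReal.toReal_pos (mul_ne_zero (pmf_ne_zero_of_forall_le hπ) h.ne_zero)
    (mul_marginalLikelihood_ne_top hν γ₀)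

theorem norm_posterior_sub_one_le (h : IsDominant ν g X y γ₀ θ) (hν : 0 < ν) (hθ : 0 ≤ θ)
    (hπ : ∀ γ, π γ ≤ C₀ * π γ₀) : ‖posterior ν g π X y γ₀ - 1‖ ≤ C₀ * θ := by
  have hw := h.toReal_pos hν hπ
  have hs : 0 ≤ ∑ γ with γ ≠ γ₀, (π γ * marginalLikelihood ν g X y γ).toReal :=
    Finset.sum_nonneg fun _ _ => ENNReal.toReal_nonneg
  have hsw := h.sum_toReal_le hν hθ hπ
  rw [posterior_eq_div hν, ← Finset.add_sum_erase _ _ (Finset.mem_univ γ₀), ← Finset.filter_ne']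
  set w := (π γ₀ * marginalLikelihood ν g X y γ₀).toReal
  set s := ∑ γ with γ ≠ γ₀, (π γ * marginalLikelihood ν g X y γ).toReal
  have hcompl : w / (w + s) - 1 = -(s / (w + s)) := by field_simp; ring
  rw [hcompl, norm_neg, Real.norm_of_nonneg (by positivity), div_le_iff₀ (by positivity)]
  exact hsw.trans (by gcongr; linarith)

theorem norm_maxPosteriorOdds_le (h : IsDominant ν g X y γ₀ θ) (hν : 0 < ν) (hθ : 0 ≤ θ)
    (hπ : ∀ γ, π γ ≤ C₀ * π γ₀) : ‖maxPosteriorOdds ν g π X y γ₀‖ ≤ C₀ * θ := by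
  have hw := h.toReal_pos hν hπ
  have hle {s : Finset (Finset (Fin p))} {γ : Finset (Fin p)} (hγ : γ ∈ s) :=
    Finset.single_le_sum (f := fun γ => (π γ * marginalLikelihood ν g X y γ).toReal)
      (fun _ _ => ENNReal.toReal_nonneg) hγ
  have htotal := hw.trans_le (hle (Finset.mem_univ γ₀))
  have hodds : 0 ≤ maxPosteriorOdds ν g π X y γ₀ :=
    Real.iSup_nonneg fun _ => div_nonneg ENNReal.toReal_nonneg ENNReal.toReal_nonneg
  rw [Real.norm_of_nonneg hodds]
  refine Real.iSup_le (fun ⟨γ, hγ⟩ => ?_) (by positivity)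
  rw [posterior_eq_div hν, posterior_eq_div hν, div_div_div_cancel_right₀ htotal.ne',
    div_le_iff₀ hw]
  exact (hle (by simpa using hγ)).trans (h.sum_toReal_le hν hθ hπ)

end IsDominant

theorem marginalLikelihood_trueModel_ne_zero [IsFiniteMeasure g] {b : ℝ} {φ Φ : ℝ≥0}
    (hb : 0 ≤ b) (hν : 0 < ν) (hφ : φ ≠ 0) (hΦ : g (Set.Icc φ Φ) ≠ 0) (hX : IsConditioned b X)
    (β₀ : Fin p → ℝ) (e : Fin n → ℝ) :
    marginalLikelihood ν g X (X.mulVec β₀ + e) (trueModel β₀) ≠ 0 := by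
  intro hzero
  have hlower := studentKernel_le_marginalLikelihood (ν := ν) (e := e) g (D := n * b)
    (by positivity) (eq_zero_of_notMem_trueModel (β := β₀)) (fun δ => (hX δ).2) hφ hΦ
  rw [hzero, mul_zero] at hlower
  exact hlower.not_gt (studentKernel_pos hν
    (add_nonneg (sqNorm_nonneg e) (div_nonneg (sqNorm_nonneg β₀) φ.2)))

end Posterior

section Convergence

theorem exists_one_lt_pow_mul_lt {r ρ : ℝ} (h : r < ρ) (k : ℕ) :
    ∃ z : ℝ, 1 < z ∧ z ^ k * r < ρ := by
  have hlim : Tendsto (fun z : ℝ => z ^ k * r) (𝓝[>] 1) (𝓝 (1 ^ k * r)) :=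
    ((continuous_id.pow k).mul continuous_const).continuousAt.tendsto.mono_left nhdsWithin_le_nhds
  obtain ⟨z, hz, hz1⟩ :=
    ((hlim.eventually_lt_const (by simpa using h)).and self_mem_nhdsWithin).exists
  exact ⟨z, hz1, hz⟩

theorem exists_Icc_ne_zero_of_ne_dirac {g : Measure ℝ≥0} [IsProbabilityMeasure g]
    (hg : g ≠ Measure.dirac 0) : ∃ φ Φ : ℝ≥0, φ ≠ 0 ∧ g (Set.Icc φ Φ) ≠ 0 := by
  by_contra! hnull
  have hcompl : g {0}ᶜ = 0 := by
    refine measure_mono_null (t := ⋃ k : ℕ, Set.Icc ((k : ℝ≥0) + 1)⁻¹ k) (fun c hc => ?_)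
      (measure_iUnion_null fun k => hnull _ _ (by positivity))
    obtain ⟨k, hk⟩ := exists_nat_ge (max c c⁻¹)
    refine Set.mem_iUnion.2 ⟨k, ?_, (le_max_left _ _).trans hk⟩
    refine inv_le_of_inv_le₀ (pos_iff_ne_zero.2 hc) ?_
    exact ((le_max_right _ _).trans hk).trans (le_add_of_nonneg_right zero_le_one)
  have hzero : (id : ℝ≥0 → ℝ≥0) =ᵐ[g] fun _ => 0 := ae_iff.2 hcompl
  refine hg ?_
  calc g = g.map id := Measure.map_id.symm
    _ = g.map fun _ => 0 := Measure.map_congr hzero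
    _ = Measure.dirac 0 := by rw [Measure.map_const, measure_univ, one_smul]

theorem tendstoInMeasure_of_forall_norm_sub_le {Ω : Type*} [MeasurableSpace Ω] {P : Measure Ω}
    {f : ℕ → Ω → ℝ} {c : ℝ} {C : ℝ≥0} {G : ℝ → ℕ → Ω → Prop}
    (hG : ∀ θ, 0 < θ → Tendsto (fun n => P {ω | ¬ G θ n ω}) atTop (𝓝 0))
    (h : ∀ θ, 0 < θ → ∀ᶠ n in atTop, ∀ ω, G θ n ω → ‖f n ω - c‖ ≤ C * θ) :
    TendstoInMeasure P f atTop fun _ => c := by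
  refine tendstoInMeasure_iff_norm.2 fun δ hδ => ?_
  have hθ : 0 < δ / (C + 1) := by positivity
  have hlt : (C : ℝ) * (δ / (C + 1)) < δ := by
    rw [mul_div_assoc', div_lt_iff₀ (by positivity)]
    linarith
  refine tendsto_of_tendsto_of_tendsto_of_le_of_le' tendsto_const_nhds (hG _ hθ)
    (Eventually.of_forall fun _ => zero_le) ?_
  filter_upwards [h _ hθ] with n hn
  exact measure_mono fun ω hω hGω => (hn ω hGω).not_gt (hlt.trans_le hω)

variable {Ω : Type*} [MeasurableSpace Ω] {P : Measure Ω} [IsProbabilityMeasure P] {p : ℕ → ℕ}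
  {X : ∀ n, Ω → Fin n → Fin (p n) → ℝ} {ε : ∀ n, Ω → Fin n → ℝ} {β₀ : ∀ n, Fin (p n) → ℝ}
  {v : ℝ≥0} {g : Measure ℝ≥0} [IsProbabilityMeasure g] {ν b s ρ a B θ : ℝ} {K : ℕ} {φ Φ : ℝ≥0}

theorem tendsto_measure_not_isDominant (hv : v ≠ 0) (hν : 0 < ν) (hb : 0 < b)
    (hX : ∀ n, AEMeasurable (X n) P)
    (hε : ∀ n, HasLaw (ε n) (Measure.pi fun _ : Fin n => gaussianReal 0 v) P)
    (hind : ∀ n, IndepFun (X n) (ε n) P)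
    (hwell : ∀ᶠ n in atTop, ∀ᵐ ω ∂P, WellConditioned b (Matrix.of (X n ω)))
    (hs₀ : 0 ≤ s) (hs : s < ρ) (hρ : ρ ≤ 1 / 2)
    (hp : (fun n => (p n : ℝ)) =O[atTop] fun n : ℕ => (n : ℝ) ^ s)
    (ha : 0 < a) (hβ₀ : ∀ᶠ n in atTop, IsSparseSignal n K B a (β₀ n))
    (hg : HasPenaltyRate g p β₀ ρ) (hφ : φ ≠ 0) (hΦ : g (Set.Icc φ Φ) ≠ 0) (hθ : 0 < θ) :
    Tendsto (fun n => P {ω | ¬ IsDominant ν g (Matrix.of (X n ω))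
      ((Matrix.of (X n ω)).mulVec (β₀ n) + ε n ω) (trueModel (β₀ n)) θ}) atTop (𝓝 0) := by
  obtain ⟨r, hsr, hrρ⟩ := exists_between hs
  obtain ⟨z, hz, hzr⟩ := exists_one_lt_pow_mul_lt hrρ 3
  obtain ⟨l, hzl, hl⟩ := exists_between (show 1 / z < 1 by rwa [div_lt_one (by linarith)])
  have hl₀ : 0 < l := lt_trans (by positivity) hzl
  obtain ⟨R, hR⟩ := exists_tendsto_measure_not_isRegular hv hb hz hl₀ hl hsr hX hε hind hwell hp
    (hβ₀.mono fun n h => h.card_le)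
  have hexponent : (fun n => R * p n + Real.log n) =o[atTop] fun n : ℕ => √n :=
    ((isLittleO_natCast_sqrt (hs.trans_le hρ) hp).const_mul_left R).add isLittleO_log_natCast_sqrt
  refine tendsto_of_tendsto_of_tendsto_of_le_of_le' tendsto_const_nhds hR
    (Eventually.of_forall fun _ => zero_le) ?_
  filter_upwards [eventually_sum_ne_marginalLikelihood_le ha hb hν
    (NNReal.coe_pos.2 (pos_iff_ne_zero.2 hv)) hz hzl (by linarith) hzr hs₀ (hs.trans_le hρ) hp
    hexponent hβ₀ hg hφ hΦ hθ] with n hn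
  refine measure_mono fun ω hω hregular => hω ⟨?_, hn _ _ hregular⟩
  exact marginalLikelihood_trueModel_ne_zero hb.le hν hφ hΦ hregular.isConditioned _ _

theorem exists_isSparseSignal {ψ : ℕ → ℝ}
    (hcard : (fun n => ((trueModel (β₀ n)).card : ℝ)) =O[atTop] fun _ => (1 : ℝ))
    (hnorm : (fun n => ‖WithLp.toLp 2 (β₀ n)‖) =O[atTop] fun _ => (1 : ℝ))
    (hψ : (fun n : ℕ => (n : ℝ) ^ (-(1 / 4) : ℝ) * √(Real.log n)) =O[atTop] ψ)
    (hψpos : ∀ᶠ n in atTop, 0 < ψ n)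
    (hsignal : ∀ᶠ n in atTop, ∀ j ∈ trueModel (β₀ n), ψ n ≤ |β₀ n j|) :
    ∃ (K : ℕ) (B a : ℝ), 0 < a ∧ ∀ᶠ n in atTop, IsSparseSignal n K B a (β₀ n) := by
  obtain ⟨K, hK⟩ := hcard.bound
  obtain ⟨C, hC⟩ := hnorm.bound
  obtain ⟨D, hD, hDψ⟩ := hψ.exists_pos
  refine ⟨⌈K⌉₊, C ^ 2, D⁻¹, inv_pos.2 hD, ?_⟩
  filter_upwards [hK, hC, hDψ.bound, hψpos, hsignal] with n hK hC hDψ hψpos hsignal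
  rw [Real.norm_natCast, norm_one, mul_one] at hK
  rw [norm_norm, norm_one, mul_one] at hC
  rw [Real.norm_of_nonneg (by positivity), Real.norm_of_nonneg hψpos.le,
    ← inv_mul_le_iff₀ hD] at hDψ
  refine ⟨Nat.cast_le.1 (hK.trans (Nat.le_ceil K)), ?_, fun j hj => hDψ.trans (hsignal j hj)⟩
  calc sqNorm (β₀ n) = ‖WithLp.toLp 2 (β₀ n)‖ ^ 2 := by simp [EuclideanSpace.norm_sq_eq, sqNorm]
    _ ≤ C ^ 2 := pow_le_pow_left₀ (norm_nonneg _) hC 2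

end Convergence

end BayesVarSel

open BayesVarSel in
theorem mainTheorem6_general {Ω : Type*} [MeasurableSpace Ω] {P : Measure Ω}
    [IsProbabilityMeasure P] {p : ℕ → ℕ} {X : ∀ n, Ω → Fin n → Fin (p n) → ℝ}
    {ε : ∀ n, Ω → Fin n → ℝ} {β₀ : ∀ n, Fin (p n) → ℝ} {v : ℝ≥0} {ν : ℝ} {g : Measure ℝ≥0}
    [IsProbabilityMeasure g] {π : ∀ n, PMF (Finset (Fin (p n)))} {C₀ : ℝ≥0} {b B a s : ℝ} {K : ℕ}
    (hv : v ≠ 0) (hν : 0 < ν) (hb : 0 < b) (hX : ∀ n, AEMeasurable (X n) P)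
    (hε : ∀ n, HasLaw (ε n) (Measure.pi fun _ : Fin n => gaussianReal 0 v) P)
    (hind : ∀ n, IndepFun (X n) (ε n) P)
    (hwell : ∀ᶠ n in atTop, ∀ᵐ ω ∂P, WellConditioned b (Matrix.of (X n ω)))
    (hπ : ∀ᶠ n in atTop, ∀ γ, π n γ ≤ C₀ * π n (trueModel (β₀ n)))
    (ha : 0 < a) (hβ₀ : ∀ᶠ n in atTop, IsSparseSignal n K B a (β₀ n))
    (hs : 0 ≤ s) (hp : (fun n => (p n : ℝ)) =O[atTop] fun n : ℕ => (n : ℝ) ^ s)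
    (hg : (s < 1 / 2 ∧ ∃ φ : ℝ≥0, φ ≠ 0 ∧ ∀ᵐ c ∂g, φ ≤ c) ∨
      (s < 1 / 4 ∧ g ≠ Measure.dirac 0 ∧ ∀ᶠ n in atTop, (trueModel (β₀ n)).Nonempty)) :
    TendstoInMeasure P (fun n ω => maxPosteriorOdds ν g (π n) (Matrix.of (X n ω))
        ((Matrix.of (X n ω)).mulVec (β₀ n) + ε n ω) (trueModel (β₀ n))) atTop (fun _ => 0) ∧
      TendstoInMeasure P (fun n ω => posterior ν g (π n) (Matrix.of (X n ω))
        ((Matrix.of (X n ω)).mulVec (β₀ n) + ε n ω) (trueModel (β₀ n))) atTop (fun _ => 1) := by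
  obtain ⟨ρ, hsρ, hρ, hrate⟩ : ∃ ρ, s < ρ ∧ ρ ≤ 1 / 2 ∧ HasPenaltyRate g p β₀ ρ := by
    rcases hg with ⟨hs2, φ, hφ, hge⟩ | ⟨hs4, -, hne⟩
    · exact ⟨1 / 2, hs2, le_rfl, hasPenaltyRate_one_half hβ₀ hφ hge⟩
    · exact ⟨1 / 4, hs4, by norm_num, hasPenaltyRate_one_quarter g ha hs hs4 hp hβ₀ hne⟩
  have hdirac : g ≠ Measure.dirac 0 := by
    rcases hg with ⟨-, φ, hφ, hge⟩ | ⟨-, hdirac, -⟩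
    · rintro rfl
      exact hφ (by simpa using hge)
    · exact hdirac
  obtain ⟨φ, Φ, hφ, hΦ⟩ := exists_Icc_ne_zero_of_ne_dirac hdirac
  have hdominant (θ : ℝ) (hθ : 0 < θ) := tendsto_measure_not_isDominant hv hν hb hX hε hind hwell
    hs hsρ hρ hp ha hβ₀ hrate hφ hΦ hθ
  exact ⟨tendstoInMeasure_of_forall_norm_sub_le hdominant fun θ hθ => hπ.mono fun n hn ω h => by
      simpa using h.norm_maxPosteriorOdds_le hν hθ.le hn,
    tendstoInMeasure_of_forall_norm_sub_le hdominant fun θ hθ => hπ.mono fun n hn ω h =>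
      h.norm_posterior_sub_one_le hν hθ.le hn⟩

theorem mainTheorem6 {Ω : Type*} [MeasurableSpace Ω] (P : Measure Ω) [IsProbabilityMeasure P]
    -- dimensions, design matrices (random or deterministic), errors, true coefficients
    (p : ℕ → ℕ) (X : ∀ n, Ω → Fin n → Fin (p n) → ℝ) (ε : ∀ n, Ω → Fin n → ℝ)
    (β₀ : ∀ n, Fin (p n) → ℝ)
    -- error variance, hyperparameter of the variance prior, prior of `c`, priors on the models
    (σ₀ : ℝ≥0) (ν : ℝ) (g : Measure ℝ≥0) [IsProbabilityMeasure g]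
    (π : ∀ n, PMF (Finset (Fin (p n)))) (ψ : ℕ → ℝ) (C₀ : ℝ≥0) (b : ℝ)
    (hσ₀ : 0 < σ₀) (hν : 0 < ν) (hb : 0 < b)
    -- `ε ∼ N(0, σ₀² Iₙ)`, independent of `X`
    (hX : ∀ n, AEMeasurable (X n) P)
    (hε : ∀ n, HasLaw (ε n) (Measure.pi fun _ : Fin n => gaussianReal 0 (σ₀ ^ 2)) P)
    (hind : ∀ n, IndepFun (X n) (ε n) P)
    -- the eigenvalues of `Xᵀ X / n` are bounded above and away from zero
    (hwell : ∀ᶠ n in atTop, ∀ᵐ ω ∂P, BayesVarSel.WellConditioned b (Matrix.of (X n ω)))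
    -- the prior odds are bounded
    (hπ : ∀ᶠ n in atTop, ∀ γ, π n γ ≤ C₀ * π n (BayesVarSel.trueModel (β₀ n)))
    -- the true model is nonnull, of bounded size, with bounded coefficient vector
    (hnonnull : ∀ᶠ n in atTop, (BayesVarSel.trueModel (β₀ n)).Nonempty)
    (hsize : (fun n => ((BayesVarSel.trueModel (β₀ n)).card : ℝ)) =O[atTop] fun _ => (1 : ℝ))
    (hβ₀ : (fun n => ‖WithLp.toLp 2 (β₀ n)‖) =O[atTop] fun _ => (1 : ℝ))
    -- the signal strength
    (hψpos : ∀ᶠ n in atTop, 0 < ψ n)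
    (hψ : ψ =Θ[atTop] fun n : ℕ => (n : ℝ) ^ (-(1 / 4) : ℝ) * √(Real.log n))
    (hsignal : ∀ᶠ n in atTop, ∀ j ∈ BayesVarSel.trueModel (β₀ n), ψ n ≤ |β₀ n j|) :
    (∀ φ Φ : ℝ≥0, 0 < φ → g.support ⊆ Set.Icc φ Φ →
      ∀ r : ℝ, 0 < r → r < 1 / 2 →
      (fun n => (p n : ℝ)) =Θ[atTop] (fun n : ℕ => (n : ℝ) ^ r) →
      TendstoInMeasure P
        (fun n ω => BayesVarSel.maxPosteriorOdds ν g (π n) (Matrix.of (X n ω))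
          ((Matrix.of (X n ω)).mulVec (β₀ n) + ε n ω) (BayesVarSel.trueModel (β₀ n)))
        atTop (fun _ => 0)) ∧
    (g ≠ Measure.dirac 0 →
      ∀ r : ℝ, 0 < r → r < 1 / 4 →
      (fun n => (p n : ℝ)) =Θ[atTop] (fun n : ℕ => (n : ℝ) ^ r) →
      TendstoInMeasure P
        (fun n ω => BayesVarSel.posterior ν g (π n) (Matrix.of (X n ω))
          ((Matrix.of (X n ω)).mulVec (β₀ n) + ε n ω) (BayesVarSel.trueModel (β₀ n)))
        atTop (fun _ => 1)) := by
  obtain ⟨K, B, a, ha, hβ₀⟩ :=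
    BayesVarSel.exists_isSparseSignal hsize hβ₀ hψ.isBigO_symm hψpos hsignal
  have hσ₀ : σ₀ ^ 2 ≠ 0 := (pow_pos hσ₀ 2).ne'
  refine ⟨fun φ Φ hφ hsupp r hr hr2 hp => ?_, fun hg r hr hr4 hp => ?_⟩
  · have hge : ∀ᵐ c ∂g, φ ≤ c :=
      Filter.mem_of_superset Measure.support_mem_ae (hsupp.trans fun c hc => hc.1)
    exact (mainTheorem6_general hσ₀ hν hb hX hε hind hwell hπ ha hβ₀ hr.le hp.isBigO
      (.inl ⟨hr2, φ, hφ.ne', hge⟩)).1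
  · exact (mainTheorem6_general hσ₀ hν hb hX hε hind hwell hπ ha hβ₀ hr.le hp.isBigO
      (.inr ⟨hr4, hg, hnonnull⟩)).2
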